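/- **Setting.** Let $n\ge 2$. For a graph $\mathcal G$ on $\{1,\dots,n\}$, a gossip matrix of $\mathcal G$ is a matrix $W\in\mathbb R^{n\times n}$ with $W_{ij}=0$ whenever $i\ne j$ and $(i,j)$ is not an edge, and with $\ker W=\{x: x_1=\dots=x_n\}$. Let $(W_t)_{t\ge 0}$ be a stationary time-homogeneous Markov chain of gossip matrices of graphs $\mathcal G_t$ (more generally, $W_t=W(Z_t)$ for a measurable function $W$ of a stationary Markov chain $Z_t$), with $\mathbf 1^\top W_t=0$, with Markov kernel $Q$ and unique invariant distribution $\pi$, such that for some integer $\tau\ge1$ and all $m\in\mathbb N$, $\sup_{s,s'}\tfrac12\|Q^m(s,\cdot)-Q^m(s',\cdot)\|_{TV}\le (1/4)^{\lfloor m/\tau\rfloor}$. Let $\tilde W=\mathbb E_\pi[W]$ be symmetric positive semidefinite and a gossip matrix of some connected graph, and suppose that every possible $W$ satisfies $\|W-\tilde W\|\le\rho$ in the spectral norm. Let $\lambda_{\max}$ and $\lambda_{\min}$ be the largest and the smallest positive eigenvalue of $\tilde W$, $\chi=\lambda_{\max}/\lambda_{\min}$ and $\kappa=\sqrt\chi+\rho^2/\lambda_{\min}^2$.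 For $x^0\in\mathbb R^n$ let $x^*$ be the vector all of whose coordinates equal $\frac1n\sum_j x^0_j$. **Algorithm.** Let $J_0,J_1,\dots$ be i.i.d. with $\mathbb P(J_k=j)=2^{-j}$, $j\ge1$, independent of the chain. For $b\in\mathbb N$, $b\ge 1$, and $\gamma>0$ put $p=\frac14$, $\beta=\sqrt{4p^2\lambda_{\min}\gamma/3}$, $\eta=\sqrt{12/(\lambda_{\min}\gamma)}$, $\theta=\frac{p\eta^{-1}-1}{\beta p\eta^{-1}-1}$, $M=\max\{2,\sqrt{\frac14(1+\frac2\beta)}\}$, $B=\lceil b\log_2M\rceil$. Starting from $x_f^0=x^0$, $T^0=0$, iterate $$x_g^k=\theta x_f^k+(1-\theta)x^k,\qquad g_j^k=2^{-j}B^{-1}\sum_{i=1}^{2^jB}W_{T^k+i}\,x_g^k,$$ $$g^k=g_0^k+\begin{cases}2^{J_k}(g^k_{J_k}-g^k_{J_k-1}),&2^{J_k}\le M,\\0,&\text{otherwise,}\end{cases}\qquad x_f^{k+1}=x_g^k-p\gamma g^k,$$ $$x^{k+1}=\eta x_f^{k+1}+(p-\eta)x_f^k+(1-p)(1-\beta)x^k+(1-p)\beta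 x_g^k,\qquad T^{k+1}=T^k+2^{J_k}B.$$ The number of communications needed for the estimators $g^0,\dots,g^{N-1}$ is $K_N=\sum_{k<N}c_k$, where $c_k=2^{J_k}B$ if $2^{J_k}\le M$ and $c_k=B$ otherwise (only $g_0^k$ is then used). The total number of network rounds elapsed is $T^N=\sum_{k<N}2^{J_k}B\ge K_N$ (almost surely). **Statement.** There is a universal $q\in\mathbb N$, and for each $c>0$ a constant $C>0$ depending only on $c$, such that in every setting as above, with $b=\tau$ and every $\gamma$ satisfying $$0<\gamma<\min\Big\{\frac3{4\lambda_{\max}},\frac{\lambda_{\min}^3}{[1800\rho^2(\tau b^{-1}+\tau^2b^{-2})]^2}\Big\},\qquad \gamma\ge c\,\min\Big\{\frac1{\lambda_{\max}},\frac{\lambda_{\min}^3}{\rho^4}\Big\}$$ (that is, $\gamma\simeq\min\{1/\lambda_{\max},\lambda_{\min}^3/\rho^4\}$; if $\rho=0$ the second entries of the minima are $+\infty$), for every $x^0$ and every $\varepsilon>0$, with $\ell=\log(2+\|x^0-x^*\|^2/\varepsilon)$, there is a deterministic number of iterations $N$ such that: 1. $\mathbb E\|x^k-x^*\|^2\le\varepsilon$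 for all $k\ge N$; 2. $\mathbb E[K_N]\le C\,\tau\,\kappa\,\ell\,\log^q(2+\kappa)$; 3. for every $\delta\in(0,1)$, with probability at least $1-\delta$, $T^N\le C\,\delta^{-1}\,\tau\,\kappa\,\ell\,\log^q(2+\kappa+\ell+\delta^{-1})$. So an $\varepsilon$-approximate solution takes $\tilde{\mathcal O}\big(\tau\big[\sqrt\chi+\rho^2/\lambda_{\min}^2\big]\log\frac1\varepsilon\big)$ communications. -/

import Mathlib

open MeasureTheory ProbabilityTheory

namespace MarkovConsensus

noncomputable section

/-! ### Gossip matrices and their spectral characteristics -/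

/-- `W` is a gossip matrix of the graph `G`: off-diagonal entries vanish outside the edges, and the
kernel of `W` is the set of constant vectors. -/
def IsGossip {n : ℕ} (G : SimpleGraph (Fin n)) (W : Matrix (Fin n) (Fin n) ℝ) : Prop :=
  (∀ i j, i ≠ j → ¬ G.Adj i j → W i j = 0) ∧
    ∀ x : Fin n → ℝ, W.mulVec x = 0 ↔ ∀ i j, x i = x j

/-- The largest eigenvalue. -/
def lamMax {n : ℕ} (A : Matrix (Fin n) (Fin n) ℝ) : ℝ := sSup (spectrum ℝ A)

/-- The smallest positive eigenvalue. -/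
def lamMin {n : ℕ} (A : Matrix (Fin n) (Fin n) ℝ) : ℝ := sInf {l | l ∈ spectrum ℝ A ∧ 0 < l}

/-- The condition number `χ`. -/
def chi {n : ℕ} (A : Matrix (Fin n) (Fin n) ℝ) : ℝ := lamMax A / lamMin A

/-- The action of a matrix on Euclidean space. -/
def act {n : ℕ} (A : Matrix (Fin n) (Fin n) ℝ) :
    EuclideanSpace ℝ (Fin n) →L[ℝ] EuclideanSpace ℝ (Fin n) :=
  Matrix.toEuclideanCLM (𝕜 := ℝ) A

/-- The consensus vector: every coordinate is the average of the coordinates of `x`. -/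
def consensus {n : ℕ} (x : EuclideanSpace ℝ (Fin n)) : EuclideanSpace ℝ (Fin n) :=
  WithLp.toLp 2 (fun _ => (∑ j, x j) / (n : ℝ))

/-! ### Stationary, uniformly geometrically ergodic Markov chains -/

theorem isMarkovKernel_pow {S : Type*} [MeasurableSpace S] (Q : Kernel S S) [IsMarkovKernel Q]
    (m : ℕ) : IsMarkovKernel (Q ^ m) := by
  induction m with
  | zero => rw [pow_zero]; exact inferInstanceAs (IsMarkovKernel Kernel.id)
  | succ k ih => rw [pow_succ]; exact inferInstanceAs (IsMarkovKernel ((Q ^ k) ∘ₖ Q))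

instance instMarkovPow {S : Type*} [MeasurableSpace S] (Q : Kernel S S) [IsMarkovKernel Q]
    (m : ℕ) : IsMarkovKernel (Q ^ m) := isMarkovKernel_pow Q m

/-- The total variation norm `|μ - ν|(S)` of the signed measure `μ - ν`. -/
def tvNorm {S : Type*} [MeasurableSpace S] (μ ν : Measure S) [IsFiniteMeasure μ]
    [IsFiniteMeasure ν] : ℝ :=
  (μ.toSignedMeasure - ν.toSignedMeasure).totalVariation.real Set.univ

/-- `Q` is uniformly geometrically ergodic with mixing time `τ`:
`sup_{s, s'} (1/2) ‖Q^m(s, ·) - Q^m(s', ·)‖_TV ≤ (1/4)^⌊m/τ⌋` for all `m`. -/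
def UniformlyErgodic {S : Type*} [MeasurableSpace S] (Q : Kernel S S) [IsMarkovKernel Q]
    (τ : ℕ) : Prop :=
  0 < τ ∧ ∀ (m : ℕ) (s s' : S), (1 / 2) * tvNorm ((Q ^ m) s) ((Q ^ m) s') ≤ (1 / 4 : ℝ) ^ (m / τ)

/-- The σ-algebra generated by `Z 0, …, Z k`. -/
abbrev pastSigma {Ω S : Type*} [MeasurableSpace S] (Z : ℕ → Ω → S) (k : ℕ) : MeasurableSpace Ω :=
  MeasurableSpace.comap (fun ω (i : Fin (k + 1)) => Z i ω) inferInstance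

/-- Under `P`, the process `Z` is a stationary time-homogeneous Markov chain with kernel `Q`
and initial law `π`, where `π` is the unique invariant distribution of `Q`. -/
structure IsStationaryChain {Ω S : Type*} [MeasurableSpace Ω] [MeasurableSpace S]
    (P : Measure Ω) (Z : ℕ → Ω → S) (Q : Kernel S S) (π : Measure S) : Prop where
  measurable : ∀ k, Measurable (Z k)
  initial : P.map (Z 0) = π
  invariant : Kernel.Invariant Q π
  unique : ∀ π' : Measure S, IsProbabilityMeasure π' → Kernel.Invariant Q π' → π' = π
  markov : ∀ (k : ℕ) (A : Set S), MeasurableSet A →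
    P[(Z (k + 1) ⁻¹' A).indicator (fun _ => (1 : ℝ)) | pastSigma Z k]
      =ᵐ[P] fun ω => (Q (Z k ω)).real A

/-- The standing assumptions on the random network. A state `s` of the chain carries
a graph `graph s` and a gossip matrix `W s` of it (for instance, `S` is the set of possible
gossip matrices and `W` is the inclusion); `Wt` is the mean gossip matrix. -/
structure NetworkAssumptions {n : ℕ} {Ω S : Type*} [MeasurableSpace Ω] [MeasurableSpace S]
    (P : Measure Ω) (Z : ℕ → Ω → S) (Q : Kernel S S) [IsMarkovKernel Q] (π : Measure S)
    (graph : S → SimpleGraph (Fin n)) (W : S → Matrix (Fin n) (Fin n) ℝ)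
    (Wt : Matrix (Fin n) (Fin n) ℝ) (τ : ℕ) (ρ : ℝ) : Prop where
  gossip : ∀ s, IsGossip (graph s) (W s)
  /-- `1ᵀ W = 0`: a communication round preserves the sum of the local values. -/
  sum_preserving : ∀ s, Matrix.vecMul 1 (W s) = 0
  measurable : ∀ i j, Measurable fun s => W s i j
  chain : IsStationaryChain P Z Q π
  ergodic : UniformlyErgodic Q τ
  unbiased : ∀ i j, ∫ s, W s i j ∂π = Wt i j
  mean_gossip : ∃ G : SimpleGraph (Fin n), G.Connected ∧ IsGossip G Wt
  /-- symmetry and positive semidefiniteness, without which `√Wt` has no meaning -/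
  mean_posSemidef : Wt.PosSemidef
  bounded : ∀ s, ‖act (W s - Wt)‖ ≤ ρ

/-- The variables `J 0, J 1, …` are i.i.d., geometric with parameter `1/2` on `{1, 2, …}`, and
independent of the network process `Z`. -/
structure IsGeometricSeed {Ω S : Type*} [MeasurableSpace Ω] [MeasurableSpace S]
    (P : Measure Ω) (Z : ℕ → Ω → S) (J : ℕ → Ω → ℕ) : Prop where
  measurable : ∀ k, Measurable (J k)
  law : ∀ k j, 1 ≤ j → P.real {ω | J k ω = j} = (1 / 2 : ℝ) ^ j
  iIndep : iIndepFun J P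
  indep : IndepFun (fun ω k => J k ω) (fun ω k => Z k ω) P

/-! ### The algorithm -/

/-- The parameters of the algorithm. -/
structure Params where
  γ : ℝ
  p : ℝ
  β : ℝ
  η : ℝ
  θ : ℝ
  M : ℝ
  B : ℕ

/-- The prescribed parameters, for the smallest positive eigenvalue `l`, step size `γ` and base
batch size `b`. -/
def params (l γ : ℝ) (b : ℕ) : Params :=
  let p : ℝ := 1 / 4
  let β : ℝ := Real.sqrt (4 * p ^ 2 * l * γ / 3)
  let η : ℝ := Real.sqrt (12 / (l * γ))
  let M : ℝ := max 2 (Real.sqrt ((1 / 4) * (1 + 2 / β)))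
  { γ := γ
    p := p
    β := β
    η := η
    θ := (p * η⁻¹ - 1) / (β * p * η⁻¹ - 1)
    M := M
    B := ⌈(b : ℝ) * Real.logb 2 M⌉₊ }

/-- The step sizes `0 < γ < min {3 / (4 λmax), λmin³ / (1800 ρ² (τ/b + τ²/b²))²}`. The denominators
are cleared, so that for `ρ = 0` the second bound is no restriction. -/
def AdmissibleStep {n : ℕ} (Wt : Matrix (Fin n) (Fin n) ℝ) (ρ : ℝ) (τ b : ℕ) (γ : ℝ) : Prop :=
  0 < γ ∧ γ * (4 * lamMax Wt) < 3 ∧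
    γ * (1800 * ρ ^ 2 * ((τ : ℝ) / b + (τ : ℝ) ^ 2 / (b : ℝ) ^ 2)) ^ 2 < lamMin Wt ^ 3

/-- `γ ≥ c · min {1 / λmax, λmin³ / ρ⁴}`, denominators cleared. -/
def StepAtLeast {n : ℕ} (Wt : Matrix (Fin n) (Fin n) ℝ) (ρ c γ : ℝ) : Prop :=
  c ≤ γ * lamMax Wt ∨ c * lamMin Wt ^ 3 ≤ γ * ρ ^ 4

/-- The state of the algorithm: `x`, `x_f` and the time counter `T`. -/
structure AlgState (n : ℕ) where
  x : EuclideanSpace ℝ (Fin n)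
  xf : EuclideanSpace ℝ (Fin n)
  T : ℕ

/-- `g_j = 2^{-j} B^{-1} ∑_{i=1}^{2^j B} W_{T+i} y`. -/
def batchMean {n : ℕ} (w : ℕ → Matrix (Fin n) (Fin n) ℝ) (B T j : ℕ)
    (y : EuclideanSpace ℝ (Fin n)) : EuclideanSpace ℝ (Fin n) :=
  ((2 : ℝ) ^ j * (B : ℝ))⁻¹ • ∑ i ∈ Finset.Icc 1 (2 ^ j * B), act (w (T + i)) y

/-- The randomised batch estimator `g`. -/
def estimator {n : ℕ} (w : ℕ → Matrix (Fin n) (Fin n) ℝ) (M : ℝ) (B T j : ℕ)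
    (y : EuclideanSpace ℝ (Fin n)) : EuclideanSpace ℝ (Fin n) :=
  open Classical in
  batchMean w B T 0 y +
    if (2 : ℝ) ^ j ≤ M then (2 : ℝ) ^ j • (batchMean w B T j y - batchMean w B T (j - 1) y) else 0

/-- One iteration, for the matrix sequence `w` and the sampled value `j`. -/
def step {n : ℕ} (q : Params) (w : ℕ → Matrix (Fin n) (Fin n) ℝ) (j : ℕ) (a : AlgState n) :
    AlgState n :=
  let xg := q.θ • a.xf + (1 - q.θ) • a.x
  let g := estimator w q.M q.B a.T j xg
  let xf' := xg - (q.p * q.γ) • g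
  { x := q.η • xf' + (q.p - q.η) • a.xf + ((1 - q.p) * (1 - q.β)) • a.x
      + ((1 - q.p) * q.β) • xg
    xf := xf'
    T := a.T + 2 ^ j * q.B }

/-- The state after `k` iterations started from `x0`. -/
def run {n : ℕ} (q : Params) (w : ℕ → Matrix (Fin n) (Fin n) ℝ) (J : ℕ → ℕ)
    (x0 : EuclideanSpace ℝ (Fin n)) : ℕ → AlgState n
  | 0 => { x := x0, xf := x0, T := 0 }
  | k + 1 => step q w (J k) (run q w J x0 k)

/-- The number of communications during the first `N` iterations whose results enter the estimators:
`2^J B` in an iteration with `2^J ≤ M`, and only the first `B` ones in an iteration with `2^J > M`.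
The number of all network rounds that elapse is the counter `T` of the state. -/
def neededComm (q : Params) (J : ℕ → ℕ) (N : ℕ) : ℕ :=
  open Classical in
  ∑ k ∈ Finset.range N, if (2 : ℝ) ^ J k ≤ q.M then 2 ^ J k * q.B else q.B

/-- The random trajectory of the algorithm with the prescribed parameters, run over the network
`W (Z 1 ω), W (Z 2 ω), …` with the seed `J`. -/
def trajectory {n : ℕ} {Ω S : Type*} (Z : ℕ → Ω → S) (W : S → Matrix (Fin n) (Fin n) ℝ)
    (J : ℕ → Ω → ℕ) (q : Params) (x0 : EuclideanSpace ℝ (Fin n)) (k : ℕ) (ω : Ω) : AlgState n :=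
  run q (fun t => W (Z t ω)) (fun i => J i ω) x0 k

/-- The squared error `‖x^k - x*‖²`. -/
def sqError {n : ℕ} {Ω S : Type*} (Z : ℕ → Ω → S) (W : S → Matrix (Fin n) (Fin n) ℝ)
    (J : ℕ → Ω → ℕ) (q : Params) (x0 : EuclideanSpace ℝ (Fin n)) (k : ℕ) (ω : Ω) : ℝ :=
  ‖(trajectory Z W J q x0 k ω).x - consensus x0‖ ^ 2

/-- The accuracy factor `log (2 + ‖x^0 - x*‖² / ε)`. -/
def logAccuracy {n : ℕ} (x0 : EuclideanSpace ℝ (Fin n)) (ε : ℝ) : ℝ :=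
  Real.log (2 + ‖x0 - consensus x0‖ ^ 2 / ε)

/-- The condition-number factor `√χ + ρ² / λmin²`. -/
def kappa {n : ℕ} (Wt : Matrix (Fin n) (Fin n) ℝ) (ρ : ℝ) : ℝ :=
  Real.sqrt (chi Wt) + ρ ^ 2 / lamMin Wt ^ 2

end

end MarkovConsensus

/-!
The iteration has the closed form `x⁺ = (1 - β) x + β x_g - (3β/μ) g`,
`x_f⁺ = x_g - (3β²/μ) g`, where `μ = λmin`, `β² = μγ/12` and `g` estimates the gradient `W̃ x_g` of
`f(y) = ⟨y, W̃ y⟩ / 2`. All gossip matrices annihilate the consensus vector and preserve the sum of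
the coordinates, so the start may be centred and the run stays in the sum-zero subspace, on which
`f` is `μ`-strongly convex. For an arbitrary estimate `g` with error `e = g - W̃ x_g`, the function
`V = ‖x‖² + (24/μ) f(x_f)` satisfies
`V⁺ ≤ (1 - β/4) V - (3/4) β ‖x‖² - 2 β ‖x_g‖² - (6β/μ) ⟨(1 - β) x + β x_g, e⟩ + 36 (β²/μ²) ‖e‖²`
(`lyapunov_step_le`).

It remains to see that the two negative terms absorb the error in expectation. The noise is
multiplicative, `‖(W - W̃) y‖ ≤ ρ ‖y‖`, and the Markov property together with the mixing assumption
gives `|E ⟨u, (W_{t+m} - W̃) v⟩| ≤ 2 ρ (1/4)^⌊m/τ⌋ E ‖u‖ ‖v‖` for vectors `u`, `v` known at time `t`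
(`NetworkAssumptions.abs_integral_inner_noise_le`). Summed over a batch of length `2ᵃB`, this
bounds the bias of the batch mean by order `ρτ/(2ᵃB)` and its variance by order `ρ²τ/(2ᵃB)`.
Averaged over the level `J`, the randomised estimator telescopes to the finest batch mean, of
length about `MB` (`levelMean_telescope`), so its bias is of order `ρ/M`, whereas each of the
`log₂ M ≤ B/τ` levels contributes order `ρ²τ/B` to its variance. Since `M²` is of order at least
`1/β` and the restriction on `γ` says that `β` is small against `μ²/ρ²`, both errors are absorbed
(`NetworkAssumptions.levelMean_lyapunov_le`).

In this argument the seed is held fixed, which makes the time counter deterministic; independence of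
seed and network is then used in the form of Fubini's theorem
(`IsGeometricSeed.integral_eq_integral_integral`), and only the current level is averaged out. The
result is `E V_{k+1} ≤ (1 - β/4) E V_k`, and `1/β` is at most a constant times `κ`.

An iteration needs on average at most `B (1 + log₂ M)` communications. The number of elapsed rounds
has infinite mean, because a level `j` of length `2ʲB` has probability `2⁻ʲ`; it is controlled in
probability by truncating all levels at `log₂ (2N/δ)` and applying Markov's inequality to the rest
(`IsGeometricSeed.measureReal_rounds_le`).
-/


namespace MarkovConsensus

/-! ### Spectral bounds for the mean gossip matrix -/

section Spectral

variable {n : ℕ}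

theorem act_apply (A : Matrix (Fin n) (Fin n) ℝ) (x : EuclideanSpace ℝ (Fin n)) (i : Fin n) :
    act A x i = ∑ j, A i j * x j := rfl

theorem inner_eq_sum (x y : EuclideanSpace ℝ (Fin n)) : inner ℝ x y = ∑ i, x i * y i := by
  simp [PiLp.inner_apply, mul_comm]

theorem act_sub (A B : Matrix (Fin n) (Fin n) ℝ) : act (A - B) = act A - act B :=
  map_sub (Matrix.toEuclideanCLM (𝕜 := ℝ)) A B

theorem inner_act_symm {A : Matrix (Fin n) (Fin n) ℝ} (hA : A.IsHermitian)
    (x y : EuclideanSpace ℝ (Fin n)) : inner ℝ (act A x) y = inner ℝ x (act A y) := by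
  have h : star (act A) = act A := by
    unfold act
    rw [← map_star, Matrix.star_eq_conjTranspose, hA]
  rw [ContinuousLinearMap.star_eq_adjoint] at h
  conv_rhs => rw [← h, ContinuousLinearMap.adjoint_inner_right]

theorem act_eigenvectorBasis {A : Matrix (Fin n) (Fin n) ℝ} (hA : A.IsHermitian) (i : Fin n) :
    act A (hA.eigenvectorBasis i) = hA.eigenvalues i • hA.eigenvectorBasis i := by
  ext k
  have := congrFun (hA.mulVec_eigenvectorBasis i) k
  simpa [act_apply, Matrix.mulVec, dotProduct] using this

theorem inner_act_eq_sum {A : Matrix (Fin n) (Fin n) ℝ} (hA : A.IsHermitian)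
    (x : EuclideanSpace ℝ (Fin n)) :
    inner ℝ x (act A x) = ∑ i, hA.eigenvalues i * inner ℝ (hA.eigenvectorBasis i) x ^ 2 := by
  rw [← hA.eigenvectorBasis.sum_inner_mul_inner]
  refine Finset.sum_congr rfl fun i _ => ?_
  rw [← inner_act_symm hA, act_eigenvectorBasis, real_inner_smul_left, real_inner_comm]
  ring

theorem inner_act_nonneg {A : Matrix (Fin n) (Fin n) ℝ} (hA : A.PosSemidef)
    (z : EuclideanSpace ℝ (Fin n)) : 0 ≤ inner ℝ z (act A z) := by
  rw [inner_act_eq_sum hA.isHermitian z]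
  exact Finset.sum_nonneg fun i _ => mul_nonneg (hA.eigenvalues_nonneg i) (sq_nonneg _)

theorem norm_sq_eq_sum {A : Matrix (Fin n) (Fin n) ℝ} (hA : A.IsHermitian)
    (x : EuclideanSpace ℝ (Fin n)) :
    ‖x‖ ^ 2 = ∑ i, inner ℝ (hA.eigenvectorBasis i) x ^ 2 := by
  rw [← real_inner_self_eq_norm_sq, ← hA.eigenvectorBasis.sum_inner_mul_inner]
  refine Finset.sum_congr rfl fun i _ => ?_
  rw [real_inner_comm, sq]

theorem eigenvalue_le_lamMax {A : Matrix (Fin n) (Fin n) ℝ} (hA : A.IsHermitian) (i : Fin n) :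
    hA.eigenvalues i ≤ lamMax A := by
  refine le_csSup ?_ (hA.eigenvalues_mem_spectrum_real i)
  rw [hA.spectrum_real_eq_range_eigenvalues]
  exact (Set.finite_range _).bddAbove

theorem lamMin_le_eigenvalue {A : Matrix (Fin n) (Fin n) ℝ} (hA : A.IsHermitian) (i : Fin n)
    (hi : 0 < hA.eigenvalues i) : lamMin A ≤ hA.eigenvalues i :=
  csInf_le ⟨0, fun _ h => h.2.le⟩ ⟨hA.eigenvalues_mem_spectrum_real i, hi⟩

theorem inner_act_le {A : Matrix (Fin n) (Fin n) ℝ} (hA : A.IsHermitian)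
    (x : EuclideanSpace ℝ (Fin n)) : inner ℝ x (act A x) ≤ lamMax A * ‖x‖ ^ 2 := by
  rw [inner_act_eq_sum hA, norm_sq_eq_sum hA, Finset.mul_sum]
  exact Finset.sum_le_sum fun i _ =>
    mul_le_mul_of_nonneg_right (eigenvalue_le_lamMax hA i) (sq_nonneg _)

/-- On the orthogonal complement of the constants, `⟨x, A x⟩ ≥ λmin ‖x‖²`: an eigenvector with
eigenvalue `0` is constant, hence orthogonal to `x`. -/
theorem lamMin_mul_le_inner_act {A : Matrix (Fin n) (Fin n) ℝ} (hA : A.PosSemidef)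
    {G : SimpleGraph (Fin n)} (hG : IsGossip G A)
    (x : EuclideanSpace ℝ (Fin n)) (hx : ∑ i, x i = 0) :
    lamMin A * ‖x‖ ^ 2 ≤ inner ℝ x (act A x) := by
  have hH := hA.isHermitian
  rw [inner_act_eq_sum hH, norm_sq_eq_sum hH, Finset.mul_sum]
  refine Finset.sum_le_sum fun i _ => ?_
  rcases (hA.eigenvalues_nonneg i).eq_or_lt with h0 | h0
  · have hk : A.mulVec (hH.eigenvectorBasis i).ofLp = 0 := by
      rw [hH.mulVec_eigenvectorBasis, ← h0, zero_smul]
    have hc := (hG.2 _).1 hk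
    have : inner ℝ (hH.eigenvectorBasis i) x = 0 := by
      rw [inner_eq_sum]
      calc ∑ k, hH.eigenvectorBasis i k * x k = ∑ k, hH.eigenvectorBasis i i * x k :=
            Finset.sum_congr rfl fun k _ => by rw [hc k i]
        _ = 0 := by rw [← Finset.mul_sum, hx, mul_zero]
    rw [this]; simp
  · exact mul_le_mul_of_nonneg_right (lamMin_le_eigenvalue hH i h0) (sq_nonneg _)

theorem lamMin_pos_and_le {A : Matrix (Fin n) (Fin n) ℝ} (hn : 2 ≤ n) (hA : A.PosSemidef)
    {G : SimpleGraph (Fin n)} (hG : IsGossip G A) : 0 < lamMin A ∧ lamMin A ≤ lamMax A := by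
  have hH := hA.isHermitian
  have hex : ∃ i, 0 < hH.eigenvalues i := by
    by_contra! h
    have hz : hH.eigenvalues = 0 :=
      funext fun i => le_antisymm (h i) (hA.eigenvalues_nonneg i)
    have hA0 : A = 0 := hH.eigenvalues_eq_zero_iff.1 hz
    -- the zero matrix also annihilates the first basis vector, which is not constant
    have := (hG.2 (Pi.single ⟨0, by omega⟩ 1)).1 (by rw [hA0, Matrix.zero_mulVec])
      ⟨0, by omega⟩ ⟨1, by omega⟩
    simp at this
  obtain ⟨i, hi⟩ := hex
  have hne : {l | l ∈ spectrum ℝ A ∧ 0 < l}.Nonempty :=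
    ⟨_, hH.eigenvalues_mem_spectrum_real i, hi⟩
  have hfin : {l | l ∈ spectrum ℝ A ∧ 0 < l}.Finite := by
    refine Set.Finite.subset ?_ (fun _ h => h.1)
    rw [hH.spectrum_real_eq_range_eigenvalues]
    exact Set.finite_range _
  exact ⟨(hne.csInf_mem hfin).2, (lamMin_le_eigenvalue hH i hi).trans (eigenvalue_le_lamMax hH i)⟩

end Spectral

/-! ### Mixing of the network process -/

section Mixing

theorem integrable_of_bounded {α E : Type*} [MeasurableSpace α] [NormedAddCommGroup E]
    {μ : Measure α} [IsFiniteMeasure μ] {f : α → E} (hf : StronglyMeasurable f) {C : ℝ}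
    (hC : ∀ x, ‖f x‖ ≤ C) : Integrable f μ :=
  Integrable.of_bound hf.aestronglyMeasurable C (Filter.Eventually.of_forall hC)

/-- Both sides are compared through the Jordan decomposition `μ - ν = pos - neg`, which gives
`μ + neg = ν + pos` as measures. -/
theorem abs_integral_sub_le_tvNorm {S : Type*} [MeasurableSpace S] (μ ν : Measure S)
    [IsFiniteMeasure μ] [IsFiniteMeasure ν] {h : S → ℝ} (hm : StronglyMeasurable h) {a : ℝ}
    (ha : ∀ s, |h s| ≤ a) : |∫ s, h s ∂μ - ∫ s, h s ∂ν| ≤ a * tvNorm μ ν := by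
  set s : SignedMeasure S := μ.toSignedMeasure - ν.toSignedMeasure with hs
  set pos := s.toJordanDecomposition.posPart
  set neg := s.toJordanDecomposition.negPart
  have hI : ∀ (κ : Measure S) [IsFiniteMeasure κ], Integrable h κ := fun κ _ =>
    integrable_of_bounded hm (C := a) ha
  have hsum : μ + neg = ν + pos := by
    ext A hA
    have h1 := s.apply_eq_posPart_real_sub_negPart_real hA
    rw [hs, sub_apply, Measure.toSignedMeasure_apply_measurable hA,
      Measure.toSignedMeasure_apply_measurable hA, ← hs] at h1
    have h2 : (μ + neg).real A = (ν + pos).real A := by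
      rw [measureReal_add_apply, measureReal_add_apply]
      change μ.real A - ν.real A = pos.real A - neg.real A at h1
      linarith
    exact (measureReal_eq_measureReal_iff).1 h2
  have heq : ∫ s, h s ∂μ + ∫ s, h s ∂neg = ∫ s, h s ∂ν + ∫ s, h s ∂pos := by
    rw [← integral_add_measure (hI _) (hI _), ← integral_add_measure (hI _) (hI _), hsum]
  have hb : ∀ (κ : Measure S) [IsFiniteMeasure κ], |∫ s, h s ∂κ| ≤ a * κ.real Set.univ :=
    fun κ _ => norm_integral_le_of_norm_le_const (f := h) (Filter.Eventually.of_forall ha)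
  have htv : tvNorm μ ν = pos.real Set.univ + neg.real Set.univ := by
    unfold tvNorm SignedMeasure.totalVariation
    rw [measureReal_add_apply]
  have e : ∫ s, h s ∂μ - ∫ s, h s ∂ν = ∫ s, h s ∂pos - ∫ s, h s ∂neg := by linarith
  rw [e, htv, mul_add]
  exact (abs_sub _ _).trans (add_le_add (hb pos) (hb neg))

theorem integral_bind_kernel {α β : Type*} [MeasurableSpace α] [MeasurableSpace β] (μ : Measure α)
    [IsFiniteMeasure μ] (κ : Kernel α β) [IsMarkovKernel κ] {h : β → ℝ}
    (hm : StronglyMeasurable h) {a : ℝ} (ha : ∀ s, |h s| ≤ a) :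
    ∫ y, h y ∂(μ.bind κ) = ∫ x, ∫ y, h y ∂(κ x) ∂μ := by
  have hi : Integrable h ((κ ∘ₖ Kernel.const Unit μ) ()) := by
    refine integrable_of_bounded hm (C := a) ha
  have := Kernel.integral_comp (κ := Kernel.const Unit μ) (η := κ) (a := ()) hi
  rw [Measure.comp_eq_comp_const_apply, this, Kernel.const_apply]

theorem invariant_pow {S : Type*} [MeasurableSpace S] {Q : Kernel S S} {π : Measure S}
    (h : Kernel.Invariant Q π) (m : ℕ) : π.bind (Q ^ m) = π := by
  induction m with
  | zero => rw [pow_zero]; exact Measure.id_comp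
  | succ k ih =>
    rw [_root_.pow_succ]
    change π.bind ((Q ^ k) ∘ₖ Q) = π
    rw [← Measure.comp_assoc, h.def, ih]

/-- A function with stationary mean zero has mean at most `2 a (1/4)^⌊m/τ⌋` after `m` steps. -/
theorem abs_integral_pow_le {S : Type*} [MeasurableSpace S] {Q : Kernel S S} [IsMarkovKernel Q]
    {π : Measure S} [IsProbabilityMeasure π] (hπ : Kernel.Invariant Q π) {τ : ℕ}
    (hQ : UniformlyErgodic Q τ) {h : S → ℝ} (hm : StronglyMeasurable h) {a : ℝ}
    (ha : ∀ s, |h s| ≤ a) (h0 : ∫ s, h s ∂π = 0) (m : ℕ) (s : S) :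
    |∫ y, h y ∂((Q ^ m) s)| ≤ 2 * a * (1 / 4 : ℝ) ^ (m / τ) := by
  have ha0 : 0 ≤ a := (abs_nonneg _).trans (ha s)
  have hk : StronglyMeasurable fun s' => ∫ y, h y ∂((Q ^ m) s') := hm.integral_kernel
  have hkb : ∀ s', ‖∫ y, h y ∂((Q ^ m) s')‖ ≤ a := fun s' => by
    have := norm_integral_le_of_norm_le_const (μ := (Q ^ m) s') (f := h) (C := a)
      (Filter.Eventually.of_forall ha)
    simpa using this
  have hmean : ∫ s', ∫ y, h y ∂((Q ^ m) s') ∂π = 0 := by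
    rw [← integral_bind_kernel π (Q ^ m) hm ha, invariant_pow hπ, h0]
  -- `π` is invariant, so the mean under `Q ^ m s` is an average of differences of two starts
  have heq : ∫ y, h y ∂((Q ^ m) s)
      = ∫ s', (∫ y, h y ∂((Q ^ m) s) - ∫ y, h y ∂((Q ^ m) s')) ∂π := by
    rw [integral_sub (integrable_const _) (integrable_of_bounded hk hkb), hmean]
    simp
  rw [heq]
  have := norm_integral_le_of_norm_le_const (μ := π)
    (f := fun s' => ∫ y, h y ∂((Q ^ m) s) - ∫ y, h y ∂((Q ^ m) s'))
    (C := 2 * a * (1 / 4 : ℝ) ^ (m / τ)) (Filter.Eventually.of_forall fun s' => by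
      have h1 := abs_integral_sub_le_tvNorm ((Q ^ m) s) ((Q ^ m) s') hm ha
      have h2 := hQ.2 m s s'
      calc ‖∫ y, h y ∂((Q ^ m) s) - ∫ y, h y ∂((Q ^ m) s')‖
          ≤ a * tvNorm ((Q ^ m) s) ((Q ^ m) s') := h1
        _ ≤ a * (2 * (1 / 4 : ℝ) ^ (m / τ)) := mul_le_mul_of_nonneg_left (by linarith) ha0
        _ = _ := by ring)
  simpa using this

theorem pastSigma_le {Ω S : Type*} [MeasurableSpace Ω] [MeasurableSpace S] {Z : ℕ → Ω → S}
    (hZ : ∀ k, Measurable (Z k)) (k : ℕ) :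
    pastSigma Z k ≤ ‹MeasurableSpace Ω› := by
  have h : Measurable (fun ω (i : Fin (k + 1)) => Z i ω) := measurable_pi_lambda _ fun i => hZ i
  rintro _ ⟨s, hs, rfl⟩
  exact h hs

theorem measurable_pastSigma {Ω S : Type*} [MeasurableSpace S] (Z : ℕ → Ω → S)
    {i k : ℕ} (h : i ≤ k) :
    Measurable[pastSigma Z k] (Z i) := by
  have h1 : Measurable[pastSigma Z k] (fun ω (i : Fin (k + 1)) => Z i ω) :=
    comap_measurable _
  exact (measurable_pi_apply (⟨i, by omega⟩ : Fin (k + 1))).comp h1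

theorem pastSigma_mono {Ω S : Type*} [MeasurableSpace S] (Z : ℕ → Ω → S)
    {i k : ℕ} (h : i ≤ k) :
    pastSigma Z i ≤ pastSigma Z k := by
  have h : Measurable[pastSigma Z k] (fun ω (j : Fin (i + 1)) => Z j ω) :=
    @measurable_pi_lambda _ _ _ (pastSigma Z k) _ _ fun j => measurable_pastSigma Z (by omega)
  rintro _ ⟨s, hs, rfl⟩
  exact h hs

variable {Ω S : Type*} [MeasurableSpace Ω] [MeasurableSpace S] {P : Measure Ω}
  [IsProbabilityMeasure P] {Z : ℕ → Ω → S} {Q : Kernel S S} {π : Measure S}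

theorem IsStationaryChain.isProbabilityMeasure (hC : IsStationaryChain P Z Q π) :
    IsProbabilityMeasure π := by
  rw [← hC.initial]
  exact Measure.isProbabilityMeasure_map (hC.measurable 0).aemeasurable

variable [IsMarkovKernel Q]

/-- The Markov property over `m` steps: on a past event, the law of `Z (k + m)` is that of `Z k`
pushed through `Q ^ m`. -/
theorem IsStationaryChain.map_restrict (hC : IsStationaryChain P Z Q π) {k : ℕ} {A : Set Ω}
    (hA : MeasurableSet[pastSigma Z k] A) (m : ℕ) :
    (P.restrict A).map (Z (k + m)) = ((P.restrict A).map (Z k)).bind (Q ^ m) := by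
  induction m with
  | zero => rw [pow_zero]; exact Measure.id_comp.symm
  | succ m ih =>
    have hle := pastSigma_le hC.measurable (k + m)
    have hA' : MeasurableSet[pastSigma Z (k + m)] A := pastSigma_mono Z (by omega) A hA
    have hstep : (P.restrict A).map (Z (k + m + 1)) = ((P.restrict A).map (Z (k + m))).bind Q := by
      ext B hB
      have hpre : MeasurableSet (Z (k + m + 1) ⁻¹' B) := hC.measurable _ hB
      have h1 := setIntegral_condExp hle (μ := P)
        (f := (Z (k + m + 1) ⁻¹' B).indicator fun _ => (1 : ℝ))
        ((integrable_const 1).indicator hpre) hA'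
      rw [setIntegral_congr_ae (hle _ hA')
        ((hC.markov (k + m) B hB).mono fun ω h _ => h)] at h1
      have hmQ : Measurable fun s => Q s B := Q.measurable_coe hB
      rw [Measure.map_apply (hC.measurable _) hB, Measure.bind_apply hB Q.aemeasurable,
        lintegral_map hmQ (hC.measurable _)]
      rw [setIntegral_indicator hpre, setIntegral_const, smul_eq_mul, mul_one] at h1
      have h2 : ∫ ω in A, (Q (Z (k + m) ω)).real B ∂P
          = (∫⁻ ω in A, Q (Z (k + m) ω) B ∂P).toReal :=
        integral_toReal (hmQ.comp (hC.measurable _)).aemeasurable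
          (Filter.Eventually.of_forall fun ω => measure_lt_top _ _)
      rw [h2, Measure.real] at h1
      rw [Measure.restrict_apply hpre, Set.inter_comm]
      have hfin : ∫⁻ ω in A, Q (Z (k + m) ω) B ∂P ≠ ⊤ := by
        refine ne_of_lt (lt_of_le_of_lt (lintegral_mono fun ω => prob_le_one (μ := Q _)) ?_)
        simp
      exact ((ENNReal.toReal_eq_toReal_iff' hfin (measure_ne_top _ _)).1 h1).symm
    rw [← add_assoc, hstep, ih, Measure.comp_assoc, _root_.pow_succ']
    rfl

theorem IsStationaryChain.condExp_ae_eq (hC : IsStationaryChain P Z Q π) (k m : ℕ) {h : S → ℝ}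
    (hm : StronglyMeasurable h) {a : ℝ} (ha : ∀ s, |h s| ≤ a) :
    P[fun ω => h (Z (k + m) ω) | pastSigma Z k] =ᵐ[P] fun ω => ∫ y, h y ∂((Q ^ m) (Z k ω)) := by
  have hle := pastSigma_le hC.measurable k
  have hk : StronglyMeasurable fun s' => ∫ y, h y ∂((Q ^ m) s') := hm.integral_kernel
  have hkb : ∀ s', ‖∫ y, h y ∂((Q ^ m) s')‖ ≤ a := fun s' => by
    have := norm_integral_le_of_norm_le_const (μ := (Q ^ m) s') (f := h) (C := a)
      (Filter.Eventually.of_forall ha)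
    simpa using this
  have hi : Integrable (fun ω => h (Z (k + m) ω)) P :=
    integrable_of_bounded (hm.comp_measurable (hC.measurable _)) (C := a) fun ω => ha _
  have hi' : Integrable (fun ω => ∫ y, h y ∂((Q ^ m) (Z k ω))) P :=
    integrable_of_bounded (hk.comp_measurable (hC.measurable _)) (C := a) fun ω => hkb _
  symm
  refine ae_eq_condExp_of_forall_setIntegral_eq hle hi (fun _ _ _ => hi'.integrableOn) ?_ ?_
  · intro A hA _
    have h1 : ∫ ω in A, h (Z (k + m) ω) ∂P = ∫ s, h s ∂((P.restrict A).map (Z (k + m))) :=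
      (integral_map (hC.measurable _).aemeasurable hm.aestronglyMeasurable).symm
    have h2 : ∫ ω in A, (∫ y, h y ∂((Q ^ m) (Z k ω))) ∂P
        = ∫ s, ∫ y, h y ∂((Q ^ m) s) ∂((P.restrict A).map (Z k)) :=
      (integral_map (hC.measurable _).aemeasurable hk.aestronglyMeasurable).symm
    rw [h1, h2, hC.map_restrict hA, integral_bind_kernel _ _ hm ha]
  · exact (hk.comp_measurable (measurable_pastSigma Z le_rfl)).aestronglyMeasurable

theorem IsStationaryChain.integral_mul_eq (hC : IsStationaryChain P Z Q π) (k m : ℕ) {h : S → ℝ}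
    (hm : StronglyMeasurable h) {a : ℝ} (ha : ∀ s, |h s| ≤ a) {g : Ω → ℝ}
    (hg : StronglyMeasurable[pastSigma Z k] g) {c : ℝ} (hc : ∀ ω, |g ω| ≤ c) :
    ∫ ω, g ω * h (Z (k + m) ω) ∂P = ∫ ω, g ω * ∫ y, h y ∂((Q ^ m) (Z k ω)) ∂P := by
  have hle := pastSigma_le hC.measurable k
  have hi : Integrable (fun ω => h (Z (k + m) ω)) P :=
    integrable_of_bounded (hm.comp_measurable (hC.measurable _)) (C := a) fun ω => ha _
  have h1 := condExp_stronglyMeasurable_mul_of_bound hle hg hi c (Filter.Eventually.of_forall hc)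
  calc ∫ ω, g ω * h (Z (k + m) ω) ∂P
      = ∫ ω, (P[g * fun ω => h (Z (k + m) ω) | pastSigma Z k]) ω ∂P := (integral_condExp hle).symm
    _ = _ := by
      refine integral_congr_ae ?_
      filter_upwards [h1, hC.condExp_ae_eq k m hm ha] with ω h1 h2
      rw [h1, Pi.mul_apply, h2]

end Mixing

/-! ### Bias and variance of batch means -/

section Noise

theorem sum_range_quarter_pow_div_le {τ : ℕ} (hτ : 0 < τ) (n : ℕ) :
    ∑ d ∈ Finset.range n, (1 / 4 : ℝ) ^ (d / τ) ≤ 4 / 3 * τ := by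
  induction n using Nat.strong_induction_on with
  | _ n ih =>
    have hτ' : (0 : ℝ) < τ := by exact_mod_cast hτ
    rcases le_or_gt n τ with h | h
    · calc ∑ d ∈ Finset.range n, (1 / 4 : ℝ) ^ (d / τ) ≤ ∑ d ∈ Finset.range n, (1 : ℝ) :=
            Finset.sum_le_sum fun d _ => pow_le_one₀ (by norm_num) (by norm_num)
        _ = n := by simp
        _ ≤ τ := by exact_mod_cast h
        _ ≤ 4 / 3 * τ := by linarith
    · obtain ⟨k, rfl⟩ := Nat.exists_eq_add_of_lt h
      have hk := ih (k + 1) (by omega)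
      rw [add_assoc, Finset.sum_range_add]
      have h1 : ∑ d ∈ Finset.range τ, (1 / 4 : ℝ) ^ (d / τ) ≤ τ := by
        calc ∑ d ∈ Finset.range τ, (1 / 4 : ℝ) ^ (d / τ) ≤ ∑ d ∈ Finset.range τ, (1 : ℝ) :=
              Finset.sum_le_sum fun d _ => pow_le_one₀ (by norm_num) (by norm_num)
          _ = τ := by simp
      have h2 : ∑ d ∈ Finset.range (k + 1), (1 / 4 : ℝ) ^ ((τ + d) / τ)
          = 1 / 4 * ∑ d ∈ Finset.range (k + 1), (1 / 4 : ℝ) ^ (d / τ) := by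
        rw [Finset.mul_sum]
        refine Finset.sum_congr rfl fun d _ => ?_
        rw [Nat.add_div_left d hτ, pow_succ]; ring
      rw [h2]; linarith

theorem sum_quarter_pow_div_le {τ : ℕ} (hτ : 0 < τ) (s : Finset ℕ) {f : ℕ → ℕ}
    (hf : Set.InjOn f s) : ∑ i ∈ s, (1 / 4 : ℝ) ^ (f i / τ) ≤ 4 / 3 * τ := by
  rw [← Finset.sum_image (f := fun d => (1 / 4 : ℝ) ^ (d / τ)) hf]
  refine le_trans (Finset.sum_le_sum_of_subset_of_nonneg
    (t := Finset.range ((s.image f).sup id + 1)) (fun d hd => ?_) fun _ _ _ => by positivity)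
    (sum_range_quarter_pow_div_le hτ _)
  exact Finset.mem_range.2 (Nat.lt_succ_of_le (Finset.le_sup (f := id) hd))

theorem sum_quarter_pow_dist_div_le {τ : ℕ} (hτ : 0 < τ) (s : Finset ℕ) (i : ℕ) :
    ∑ j ∈ s, (1 / 4 : ℝ) ^ (Nat.dist i j / τ) ≤ 8 / 3 * τ := by
  rw [← Finset.sum_filter_add_sum_filter_not s (fun j => i ≤ j)]
  have h1 := sum_quarter_pow_div_le hτ (s.filter fun j => i ≤ j) (f := Nat.dist i)
    (fun a ha b hb h => by
      simp only [Finset.coe_filter, Set.mem_ofPred_eq] at ha hb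
      simp only [Nat.dist] at h; omega)
  have h2 := sum_quarter_pow_div_le hτ (s.filter fun j => ¬ i ≤ j) (f := Nat.dist i)
    (fun a ha b hb h => by
      simp only [Finset.coe_filter, Set.mem_ofPred_eq] at ha hb
      simp only [Nat.dist] at h; omega)
  linarith

theorem stronglyMeasurable_act {Ω : Type*} {n : ℕ} (m : MeasurableSpace Ω)
    {A : Ω → Matrix (Fin n) (Fin n) ℝ} (hA : ∀ i j, Measurable[m] fun ω => A ω i j)
    {v : Ω → EuclideanSpace ℝ (Fin n)} (hv : StronglyMeasurable[m] v) :
    StronglyMeasurable[m] fun ω => act (A ω) (v ω) := by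
  refine Measurable.stronglyMeasurable ?_
  have hv' : ∀ j, Measurable[m] fun ω => v ω j := fun j =>
    (EuclideanSpace.proj (𝕜 := ℝ) j).continuous.measurable.comp hv.measurable
  refine (WithLp.measurable_toLp 2 _).comp (measurable_pi_lambda
    (fun ω i => ∑ j, A ω i j * v ω j) fun i => ?_)
  exact Finset.measurable_sum _ fun j _ => (hA i j).mul (hv' j)

theorem abs_entry_le_norm_act {n : ℕ} (A : Matrix (Fin n) (Fin n) ℝ) (i j : Fin n) :
    |A i j| ≤ ‖act A‖ := by
  have h : A i j = act A (EuclideanSpace.single j 1) i := by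
    rw [act_apply]; simp
  have h1 := PiLp.norm_apply_le (act A (EuclideanSpace.single j 1)) i
  have h2 := (act A).le_opNorm (EuclideanSpace.single j 1)
  rw [h]
  refine h1.trans (h2.trans ?_)
  simp

variable {n : ℕ} {Ω S : Type*} [MeasurableSpace Ω] [MeasurableSpace S] {P : Measure Ω}
  {Z : ℕ → Ω → S} {Q : Kernel S S} [IsMarkovKernel Q] {π : Measure S}
  {graph : S → SimpleGraph (Fin n)} {W : S → Matrix (Fin n) (Fin n) ℝ}
  {Wt : Matrix (Fin n) (Fin n) ℝ} {τ : ℕ} {ρ : ℝ}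

theorem NetworkAssumptions.norm_noise_le (hN : NetworkAssumptions P Z Q π graph W Wt τ ρ) (s : S)
    (y : EuclideanSpace ℝ (Fin n)) : ‖act (W s - Wt) y‖ ≤ ρ * ‖y‖ :=
  (act (W s - Wt)).le_of_opNorm_le (hN.bounded s) y

theorem stronglyMeasurable_noise (hN : NetworkAssumptions P Z Q π graph W Wt τ ρ) (t : ℕ)
    {v : Ω → EuclideanSpace ℝ (Fin n)} (hv : StronglyMeasurable[pastSigma Z t] v) {k s : ℕ}
    (hts : t ≤ s) (hks : k ≤ s) :
    StronglyMeasurable[pastSigma Z s] fun ω => act (W (Z k ω) - Wt) (v ω) :=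
  stronglyMeasurable_act _
    (fun i j => ((hN.measurable i j).sub_const _).comp (measurable_pastSigma Z hks))
    (hv.mono (pastSigma_mono Z hts))

variable [IsProbabilityMeasure P]

theorem NetworkAssumptions.noise_nonneg (hN : NetworkAssumptions P Z Q π graph W Wt τ ρ) :
    0 ≤ ρ := by
  obtain ⟨ω⟩ := nonempty_of_isProbabilityMeasure P
  exact (norm_nonneg _).trans (hN.bounded (Z 0 ω))

theorem inner_act_eq_sum_entries (u v : EuclideanSpace ℝ (Fin n))
    (A : Matrix (Fin n) (Fin n) ℝ) :
    inner ℝ u (act A v) = ∑ i, ∑ j, u i * v j * A i j := by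
  rw [inner_eq_sum]
  refine Finset.sum_congr rfl fun i _ => ?_
  rw [act_apply, Finset.mul_sum]
  exact Finset.sum_congr rfl fun j _ => by ring

/-- The noise `m` rounds ahead is nearly unbiased given the past: tested against vectors known at
time `t`, its mean is of order `(1/4)^⌊m/τ⌋`. -/
theorem NetworkAssumptions.abs_integral_inner_noise_le
    (hN : NetworkAssumptions P Z Q π graph W Wt τ ρ) (t m : ℕ)
    {u v : Ω → EuclideanSpace ℝ (Fin n)} (hu : StronglyMeasurable[pastSigma Z t] u)
    (hv : StronglyMeasurable[pastSigma Z t] v) {cu cv : ℝ} (hcu : ∀ ω, ‖u ω‖ ≤ cu)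
    (hcv : ∀ ω, ‖v ω‖ ≤ cv) :
    |∫ ω, inner ℝ (u ω) (act (W (Z (t + m) ω) - Wt) (v ω)) ∂P|
      ≤ 2 * ρ * (1 / 4 : ℝ) ^ (m / τ) * ∫ ω, ‖u ω‖ * ‖v ω‖ ∂P := by
  have hπ := hN.chain.isProbabilityMeasure
  have hle := pastSigma_le hN.chain.measurable t
  have hρ := hN.noise_nonneg
  have hZ := hN.chain.measurable
  have hd : ∀ i j, StronglyMeasurable fun s => (W s - Wt) i j := fun i j =>
    ((hN.measurable i j).sub_const _).stronglyMeasurable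
  have hdb : ∀ i j s, |(W s - Wt) i j| ≤ ρ := fun i j s =>
    (abs_entry_le_norm_act _ i j).trans (hN.bounded s)
  have hco : ∀ j : Fin n, Continuous fun x : EuclideanSpace ℝ (Fin n) => x j := fun j =>
    (EuclideanSpace.proj (𝕜 := ℝ) j).continuous
  have hg : ∀ i j, StronglyMeasurable[pastSigma Z t] fun ω => u ω i * v ω j := fun i j =>
    ((hco i).comp_stronglyMeasurable hu).mul ((hco j).comp_stronglyMeasurable hv)
  have hgb : ∀ i j ω, |u ω i * v ω j| ≤ cu * cv := fun i j ω => by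
    rw [abs_mul]
    exact mul_le_mul ((PiLp.norm_apply_le (u ω) i).trans (hcu ω))
      ((PiLp.norm_apply_le (v ω) j).trans (hcv ω)) (abs_nonneg _) ((norm_nonneg _).trans (hcu ω))
  have hKm : ∀ i j, StronglyMeasurable fun s' => ∫ y, (W y - Wt) i j ∂((Q ^ m) s') :=
    fun i j => (hd i j).integral_kernel
  have hKb : ∀ i j s', ‖∫ y, (W y - Wt) i j ∂((Q ^ m) s')‖ ≤ ρ := fun i j s' => by
    have := norm_integral_le_of_norm_le_const (μ := (Q ^ m) s') (f := fun y => (W y - Wt) i j)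
      (C := ρ) (Filter.Eventually.of_forall (hdb i j))
    simpa using this
  -- entrywise, the noise at time `t + m` may be replaced by its conditional mean
  have hlhs : ∫ ω, inner ℝ (u ω) (act (W (Z (t + m) ω) - Wt) (v ω)) ∂P
      = ∫ ω, ∑ i, ∑ j, u ω i * v ω j * ∫ y, (W y - Wt) i j ∂((Q ^ m) (Z t ω)) ∂P := by
    have hi1 : ∀ i j, Integrable (fun ω => u ω i * v ω j * (W (Z (t + m) ω) - Wt) i j) P :=
      fun i j => integrable_of_bounded
        (((hg i j).mono hle).mul ((hd i j).comp_measurable (hZ _))) (C := cu * cv * ρ) fun ω => by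
          rw [norm_mul]
          exact mul_le_mul (hgb i j ω) (hdb i j _) (abs_nonneg _)
            ((abs_nonneg _).trans (hgb i j ω))
    have hi2 : ∀ i j, Integrable
        (fun ω => u ω i * v ω j * ∫ y, (W y - Wt) i j ∂((Q ^ m) (Z t ω))) P :=
      fun i j => integrable_of_bounded
        (((hg i j).mono hle).mul ((hKm i j).comp_measurable (hZ _))) (C := cu * cv * ρ)
        fun ω => by
          rw [norm_mul]
          exact mul_le_mul (hgb i j ω) (hKb i j _) (norm_nonneg _)
            ((abs_nonneg _).trans (hgb i j ω))
    simp_rw [inner_act_eq_sum_entries]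
    rw [integral_finsetSum _ fun i _ => integrable_finsetSum _ fun j _ => hi1 i j,
      integral_finsetSum _ fun i _ => integrable_finsetSum _ fun j _ => hi2 i j]
    refine Finset.sum_congr rfl fun i _ => ?_
    rw [integral_finsetSum _ fun j _ => hi1 i j, integral_finsetSum _ fun j _ => hi2 i j]
    exact Finset.sum_congr rfl fun j _ =>
      hN.chain.integral_mul_eq t m (hd i j) (hdb i j) (hg i j) (hgb i j)
  -- for fixed vectors, the mixing bound applies to the scalar function `⟨a, (W s - Wt) b⟩`
  have hpt : ∀ (a b : EuclideanSpace ℝ (Fin n)) (s : S),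
      |∑ i, ∑ j, a i * b j * ∫ y, (W y - Wt) i j ∂((Q ^ m) s)|
        ≤ 2 * ρ * (1 / 4 : ℝ) ^ (m / τ) * (‖a‖ * ‖b‖) := by
    intro a b s
    have hint : ∀ (μ : Measure S) [IsFiniteMeasure μ] i j,
        Integrable (fun y => a i * b j * (W y - Wt) i j) μ := fun μ _ i j =>
      (integrable_of_bounded (hd i j) (C := ρ) (hdb i j)).const_mul _
    have heq : ∀ (μ : Measure S) [IsFiniteMeasure μ],
        ∫ y, inner ℝ a (act (W y - Wt) b) ∂μ
          = ∑ i, ∑ j, a i * b j * ∫ y, (W y - Wt) i j ∂μ := by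
      intro μ _
      simp_rw [inner_act_eq_sum_entries]
      rw [integral_finsetSum _ fun i _ => integrable_finsetSum _ fun j _ => hint μ i j]
      refine Finset.sum_congr rfl fun i _ => ?_
      rw [integral_finsetSum _ fun j _ => hint μ i j]
      exact Finset.sum_congr rfl fun j _ => integral_const_mul _ _
    rw [← heq]
    have hm : StronglyMeasurable fun y => inner ℝ a (act (W y - Wt) b) :=
      StronglyMeasurable.inner stronglyMeasurable_const
        (stronglyMeasurable_act _ (fun i j => (hd i j).measurable) stronglyMeasurable_const)
    have hb : ∀ y, |inner ℝ a (act (W y - Wt) b)| ≤ ρ * (‖a‖ * ‖b‖) := fun y => by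
      refine (abs_real_inner_le_norm _ _).trans ?_
      calc ‖a‖ * ‖act (W y - Wt) b‖ ≤ ‖a‖ * (ρ * ‖b‖) :=
            mul_le_mul_of_nonneg_left (hN.norm_noise_le y b) (norm_nonneg _)
        _ = _ := by ring
    have h0 : ∫ y, inner ℝ a (act (W y - Wt) b) ∂π = 0 := by
      rw [heq]
      refine Finset.sum_eq_zero fun i _ => Finset.sum_eq_zero fun j _ => ?_
      have hWi : Integrable (fun y => W y i j) π := by
        have := (integrable_of_bounded (μ := π) (hd i j) (C := ρ) (hdb i j)).add
          (integrable_const (Wt i j))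
        refine this.congr (Filter.Eventually.of_forall fun y => ?_)
        simp
      have : ∫ y, (W y - Wt) i j ∂π = 0 := by
        simp_rw [Matrix.sub_apply]
        rw [integral_sub hWi (integrable_const _), hN.unbiased]
        simp
      rw [this, mul_zero]
    have := abs_integral_pow_le hN.chain.invariant hN.ergodic hm hb h0 m s
    calc _ ≤ _ := this
      _ = _ := by ring
  rw [hlhs]
  have hum : StronglyMeasurable u := hu.mono hle
  have hvm : StronglyMeasurable v := hv.mono hle
  rw [← integral_const_mul]
  refine abs_integral_le_integral_abs.trans ?_
  refine integral_mono_of_nonneg (Filter.Eventually.of_forall fun _ => abs_nonneg _) ?_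
    (Filter.Eventually.of_forall fun ω => hpt (u ω) (v ω) (Z t ω))
  refine Integrable.const_mul (integrable_of_bounded (hum.norm.mul hvm.norm) (C := cu * cv)
    fun ω => ?_) _
  rw [Pi.mul_apply, norm_mul, norm_norm, norm_norm]
  exact mul_le_mul (hcu ω) (hcv ω) (norm_nonneg _) ((norm_nonneg _).trans (hcu ω))

/-- The error of a batch mean over `2 ^ a * B` rounds. -/
noncomputable def batchError (w : ℕ → Matrix (Fin n) (Fin n) ℝ) (Wt : Matrix (Fin n) (Fin n) ℝ)
    (B t a : ℕ) (y : EuclideanSpace ℝ (Fin n)) : EuclideanSpace ℝ (Fin n) :=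
  batchMean w B t a y - act Wt y

theorem batchError_eq (w : ℕ → Matrix (Fin n) (Fin n) ℝ) (Wt : Matrix (Fin n) (Fin n) ℝ)
    {B : ℕ} (hB : 0 < B) (t a : ℕ) (y : EuclideanSpace ℝ (Fin n)) :
    batchError w Wt B t a y = ((2 : ℝ) ^ a * (B : ℝ))⁻¹ •
      ∑ i ∈ Finset.Icc 1 (2 ^ a * B), act (w (t + i) - Wt) y := by
  have hB' : (0 : ℝ) < B := by exact_mod_cast hB
  have h0 : (2 : ℝ) ^ a * (B : ℝ) ≠ 0 := by positivity
  simp_rw [act_sub, sub_apply]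
  rw [Finset.sum_sub_distrib, Finset.sum_const, Nat.card_Icc, Nat.add_sub_cancel, smul_sub,
    ← Nat.cast_smul_eq_nsmul ℝ, smul_smul]
  push_cast
  rw [inv_mul_cancel₀ h0, one_smul]
  rfl

section Moments

variable (hN : NetworkAssumptions P Z Q π graph W Wt τ ρ) {B : ℕ} (hB : 0 < B) (t a : ℕ)
  {u v : Ω → EuclideanSpace ℝ (Fin n)} (hu : StronglyMeasurable[pastSigma Z t] u)
  (hv : StronglyMeasurable[pastSigma Z t] v) {cu cv : ℝ} (hcu : ∀ ω, ‖u ω‖ ≤ cu)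
  (hcv : ∀ ω, ‖v ω‖ ≤ cv)

include hN hB hu hv hcu hcv in
theorem abs_integral_inner_batchError_le :
    |∫ ω, inner ℝ (u ω) (batchError (fun i => W (Z i ω)) Wt B t a (v ω)) ∂P|
      ≤ 8 / 3 * ρ * τ / (2 ^ a * B) * ∫ ω, ‖u ω‖ * ‖v ω‖ ∂P := by
  have hle := fun k => pastSigma_le hN.chain.measurable k
  have hB' : (0 : ℝ) < B := by exact_mod_cast hB
  have hρ := hN.noise_nonneg
  simp_rw [batchError_eq _ _ hB, real_inner_smul_right, inner_sum]
  have hint : ∀ i, Integrable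
      (fun ω => inner ℝ (u ω) (act (W (Z (t + i) ω) - Wt) (v ω))) P := fun i => by
    refine integrable_of_bounded ((hu.mono (hle t)).inner
      ((stronglyMeasurable_noise hN t hv (by omega : t ≤ t + i) le_rfl).mono (hle _)))
      (C := cu * (ρ * cv)) fun ω => ?_
    refine (abs_real_inner_le_norm _ _).trans (mul_le_mul (hcu ω) ?_ (norm_nonneg _)
      ((norm_nonneg _).trans (hcu ω)))
    exact (hN.norm_noise_le _ _).trans (mul_le_mul_of_nonneg_left (hcv ω) hρ)
  rw [integral_const_mul, integral_finsetSum _ fun i _ => hint i, abs_mul]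
  have hI : 0 ≤ ∫ ω, ‖u ω‖ * ‖v ω‖ ∂P := integral_nonneg fun ω => by positivity
  have h1 : |∑ i ∈ Finset.Icc 1 (2 ^ a * B),
      ∫ ω, inner ℝ (u ω) (act (W (Z (t + i) ω) - Wt) (v ω)) ∂P|
      ≤ 8 / 3 * ρ * τ * ∫ ω, ‖u ω‖ * ‖v ω‖ ∂P := by
    calc _ ≤ ∑ i ∈ Finset.Icc 1 (2 ^ a * B),
          2 * ρ * (1 / 4 : ℝ) ^ (i / τ) * ∫ ω, ‖u ω‖ * ‖v ω‖ ∂P :=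
        (Finset.abs_sum_le_sum_abs _ _).trans (Finset.sum_le_sum fun i _ =>
          hN.abs_integral_inner_noise_le t i hu hv hcu hcv)
      _ = 2 * ρ * (∑ i ∈ Finset.Icc 1 (2 ^ a * B), (1 / 4 : ℝ) ^ (i / τ))
          * ∫ ω, ‖u ω‖ * ‖v ω‖ ∂P := by rw [Finset.mul_sum, Finset.sum_mul]
      _ ≤ 2 * ρ * (4 / 3 * τ) * ∫ ω, ‖u ω‖ * ‖v ω‖ ∂P := by
        gcongr
        exact sum_quarter_pow_div_le hN.ergodic.1 _ (f := fun i => i) fun _ _ _ _ h => h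
      _ = _ := by ring
  have h0 : (0 : ℝ) < 2 ^ a * B := by positivity
  rw [abs_of_pos (inv_pos.2 h0)]
  calc _ ≤ ((2 : ℝ) ^ a * B)⁻¹ * (8 / 3 * ρ * τ * ∫ ω, ‖u ω‖ * ‖v ω‖ ∂P) :=
        mul_le_mul_of_nonneg_left h1 (inv_pos.2 h0).le
    _ = _ := by ring

include hN hv hcv in
/-- Noise terms decorrelate: the earlier one is known when the later one is tested against it. -/
theorem integral_inner_noise_le (i j : ℕ) :
    ∫ ω, inner ℝ (act (W (Z (t + i) ω) - Wt) (v ω)) (act (W (Z (t + j) ω) - Wt) (v ω)) ∂P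
      ≤ 2 * ρ ^ 2 * (1 / 4 : ℝ) ^ (Nat.dist i j / τ) * ∫ ω, ‖v ω‖ ^ 2 ∂P := by
  wlog hij : i ≤ j generalizing i j
  · have := this j i (by omega)
    simp_rw [real_inner_comm] at this ⊢
    rwa [Nat.dist_comm]
  have hle := fun k => pastSigma_le hN.chain.measurable k
  have hρ := hN.noise_nonneg
  have hvI : Integrable (fun ω => ‖v ω‖ ^ 2) P :=
    integrable_of_bounded ((hv.mono (hle t)).norm.pow 2) (C := cv ^ 2) fun ω => by
      rw [norm_pow, norm_norm]; exact pow_le_pow_left₀ (norm_nonneg _) (hcv ω) 2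
  have hcv' : ∀ ω, ‖act (W (Z (t + i) ω) - Wt) (v ω)‖ ≤ ρ * cv := fun ω =>
    (hN.norm_noise_le _ _).trans (mul_le_mul_of_nonneg_left (hcv ω) hρ)
  have hij' : t + j = t + i + (j - i) := by omega
  have h := hN.abs_integral_inner_noise_le (t + i) (j - i)
    (stronglyMeasurable_noise hN t hv (by omega : t ≤ t + i) le_rfl)
    (hv.mono (pastSigma_mono Z (by omega))) hcv' hcv
  rw [← hij'] at h
  have hd : Nat.dist i j = j - i := by simp only [Nat.dist]; omega
  rw [hd]
  refine (le_abs_self _).trans (h.trans ?_)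
  have h2 : ∫ ω, ‖act (W (Z (t + i) ω) - Wt) (v ω)‖ * ‖v ω‖ ∂P ≤ ρ * ∫ ω, ‖v ω‖ ^ 2 ∂P := by
    rw [← integral_const_mul]
    refine integral_mono_of_nonneg (Filter.Eventually.of_forall fun ω => by positivity)
      (hvI.const_mul _) (Filter.Eventually.of_forall fun ω => ?_)
    calc ‖act (W (Z (t + i) ω) - Wt) (v ω)‖ * ‖v ω‖ ≤ ρ * ‖v ω‖ * ‖v ω‖ :=
          mul_le_mul_of_nonneg_right (hN.norm_noise_le _ _) (norm_nonneg _)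
      _ = _ := by ring
  calc _ ≤ 2 * ρ * (1 / 4 : ℝ) ^ ((j - i) / τ) * (ρ * ∫ ω, ‖v ω‖ ^ 2 ∂P) :=
        mul_le_mul_of_nonneg_left h2 (by positivity)
    _ = _ := by ring

include hN hB hv hcv in
theorem integral_norm_batchError_sq_le :
    ∫ ω, ‖batchError (fun i => W (Z i ω)) Wt B t a (v ω)‖ ^ 2 ∂P
      ≤ 16 / 3 * ρ ^ 2 * τ / (2 ^ a * B) * ∫ ω, ‖v ω‖ ^ 2 ∂P := by
  have hle := fun k => pastSigma_le hN.chain.measurable k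
  have hB' : (0 : ℝ) < B := by exact_mod_cast hB
  have hρ := hN.noise_nonneg
  have hY : 0 ≤ ∫ ω, ‖v ω‖ ^ 2 ∂P := integral_nonneg fun ω => by positivity
  have hsq : ∀ ω, ‖batchError (fun i => W (Z i ω)) Wt B t a (v ω)‖ ^ 2
      = (((2 : ℝ) ^ a * B)⁻¹) ^ 2 * ∑ i ∈ Finset.Icc 1 (2 ^ a * B),
        ∑ j ∈ Finset.Icc 1 (2 ^ a * B), inner ℝ (act (W (Z (t + i) ω) - Wt) (v ω))
          (act (W (Z (t + j) ω) - Wt) (v ω)) := fun ω => by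
    rw [batchError_eq _ _ hB, norm_smul, mul_pow, Real.norm_eq_abs, sq_abs,
      ← real_inner_self_eq_norm_sq, sum_inner]
    simp_rw [inner_sum]
  simp_rw [hsq]
  have hn : ∀ i ω, ‖act (W (Z (t + i) ω) - Wt) (v ω)‖ ≤ ρ * cv := fun i ω =>
    (hN.norm_noise_le _ _).trans (mul_le_mul_of_nonneg_left (hcv ω) hρ)
  have hint : ∀ i j, Integrable (fun ω => inner ℝ (act (W (Z (t + i) ω) - Wt) (v ω))
      (act (W (Z (t + j) ω) - Wt) (v ω))) P := fun i j => by
    refine integrable_of_bounded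
      (((stronglyMeasurable_noise hN t hv (by omega : t ≤ t + i) le_rfl).mono (hle _)).inner
      ((stronglyMeasurable_noise hN t hv (by omega : t ≤ t + j) le_rfl).mono (hle _)))
      (C := ρ * cv * (ρ * cv)) fun ω => ?_
    exact (abs_real_inner_le_norm _ _).trans (mul_le_mul (hn i ω) (hn j ω) (norm_nonneg _)
      ((norm_nonneg _).trans (hn i ω)))
  rw [integral_const_mul, integral_finsetSum _ fun i _ => integrable_finsetSum _ fun j _ =>
    hint i j]
  have h1 : ∑ i ∈ Finset.Icc 1 (2 ^ a * B), ∫ ω, ∑ j ∈ Finset.Icc 1 (2 ^ a * B),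
      inner ℝ (act (W (Z (t + i) ω) - Wt) (v ω)) (act (W (Z (t + j) ω) - Wt) (v ω)) ∂P
      ≤ ((2 : ℝ) ^ a * B) * (16 / 3 * ρ ^ 2 * τ * ∫ ω, ‖v ω‖ ^ 2 ∂P) := by
    calc _ ≤ ∑ i ∈ Finset.Icc 1 (2 ^ a * B), 16 / 3 * ρ ^ 2 * τ * ∫ ω, ‖v ω‖ ^ 2 ∂P := by
          refine Finset.sum_le_sum fun i _ => ?_
          rw [integral_finsetSum _ fun j _ => hint i j]
          calc _ ≤ ∑ j ∈ Finset.Icc 1 (2 ^ a * B), 2 * ρ ^ 2 * (1 / 4 : ℝ) ^ (Nat.dist i j / τ)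
                * ∫ ω, ‖v ω‖ ^ 2 ∂P :=
              Finset.sum_le_sum fun j _ => integral_inner_noise_le hN t hv hcv i j
            _ = 2 * ρ ^ 2 * (∑ j ∈ Finset.Icc 1 (2 ^ a * B), (1 / 4 : ℝ) ^ (Nat.dist i j / τ))
                * ∫ ω, ‖v ω‖ ^ 2 ∂P := by rw [Finset.mul_sum, Finset.sum_mul]
            _ ≤ 2 * ρ ^ 2 * (8 / 3 * τ) * ∫ ω, ‖v ω‖ ^ 2 ∂P := by
              gcongr
              exact sum_quarter_pow_dist_div_le hN.ergodic.1 _ i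
            _ = _ := by ring
      _ = _ := by
        rw [Finset.sum_const, Nat.card_Icc, Nat.add_sub_cancel, nsmul_eq_mul]
        push_cast; ring
  have h0 : (0 : ℝ) < 2 ^ a * B := by positivity
  calc _ ≤ (((2 : ℝ) ^ a * B)⁻¹) ^ 2 * (((2 : ℝ) ^ a * B) * (16 / 3 * ρ ^ 2 * τ
        * ∫ ω, ‖v ω‖ ^ 2 ∂P)) := mul_le_mul_of_nonneg_left h1 (by positivity)
    _ = _ := by field_simp

end Moments

end Noise

/-! ### The recursion for a fixed network and seed -/

section Recursion

variable {n : ℕ}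

/-- The extrapolated point `x_g`. -/
noncomputable def extrap (q : Params) (a : AlgState n) : EuclideanSpace ℝ (Fin n) :=
  q.θ • a.xf + (1 - q.θ) • a.x

theorem params_beta_sq {l γ : ℝ} (hl : 0 < l) (hγ : 0 < γ) (b : ℕ) :
    (params l γ b).β ^ 2 = l * γ / 12 := by
  change Real.sqrt _ ^ 2 = _
  rw [Real.sq_sqrt (by positivity)]; ring

theorem params_beta_pos {l γ : ℝ} (hl : 0 < l) (hγ : 0 < γ) (b : ℕ) : 0 < (params l γ b).β :=
  Real.sqrt_pos.2 (by positivity)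

theorem params_eta {l γ : ℝ} (hl : 0 < l) (hγ : 0 < γ) (b : ℕ) :
    (params l γ b).η = ((params l γ b).β)⁻¹ := by
  change Real.sqrt _ = (Real.sqrt _)⁻¹
  rw [← Real.sqrt_inv]
  congr 1
  field_simp; norm_num

theorem extrap_eq {l γ : ℝ} (hl : 0 < l) (hγ : 0 < γ) (b : ℕ) (hβ : (params l γ b).β < 1)
    (a : AlgState n) :
    (4 - (params l γ b).β ^ 2) • extrap (params l γ b) a
      = (4 - (params l γ b).β) • a.xf
        + ((params l γ b).β * (1 - (params l γ b).β)) • a.x := by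
  have h0 := params_beta_pos hl hγ b
  have hθ : (params l γ b).θ = ((1 / 4 : ℝ) * (params l γ b).η⁻¹ - 1)
    / ((params l γ b).β * (1 / 4) * (params l γ b).η⁻¹ - 1) := rfl
  rw [params_eta hl hγ, inv_inv] at hθ
  unfold extrap
  set β := (params l γ b).β
  have hd : (4 - β ^ 2) ≠ 0 := by nlinarith
  have hd' : β * (1 / 4) * β - 1 ≠ 0 := by nlinarith
  have h1 : (4 - β ^ 2) * (params l γ b).θ = 4 - β := by
    rw [hθ, mul_div_assoc', div_eq_iff hd']; ring
  rw [smul_add, smul_smul, smul_smul, h1]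
  congr 2
  linear_combination -h1

/-- The iteration in closed form: `x⁺ = (1 - β) x + β x_g - (3β/l) g`,
`x_f⁺ = x_g - (3β²/l) g`. -/
theorem step_eq {l γ : ℝ} (hl : 0 < l) (hγ : 0 < γ) (b : ℕ) (hβ : (params l γ b).β < 1)
    (w : ℕ → Matrix (Fin n) (Fin n) ℝ) (j : ℕ) (a : AlgState n) :
    (step (params l γ b) w j a).x = (1 - (params l γ b).β) • a.x
        + (params l γ b).β • extrap (params l γ b) a - (3 * (params l γ b).β / l) •
        estimator w (params l γ b).M (params l γ b).B a.T j (extrap (params l γ b) a) ∧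
    (step (params l γ b) w j a).xf = extrap (params l γ b) a - (3 * (params l γ b).β ^ 2 / l) •
        estimator w (params l γ b).M (params l γ b).B a.T j (extrap (params l γ b) a) := by
  have h0 := params_beta_pos hl hγ b
  have hx := extrap_eq hl hγ b hβ a
  have h2 := params_beta_sq hl hγ b
  have hs1 : (step (params l γ b) w j a).xf = extrap (params l γ b) a - ((1 / 4 : ℝ) * γ) •
    estimator w (params l γ b).M (params l γ b).B a.T j (extrap (params l γ b) a) := rfl
  have hs2 : (step (params l γ b) w j a).x = (params l γ b).η • (step (params l γ b) w j a).xf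
    + ((1 / 4 : ℝ) - (params l γ b).η) • a.xf + ((1 - (1 / 4 : ℝ)) * (1 - (params l γ b).β)) • a.x
    + ((1 - (1 / 4 : ℝ)) * (params l γ b).β) • extrap (params l γ b) a := rfl
  rw [hs2, hs1, params_eta hl hγ]
  set g := estimator w (params l γ b).M (params l γ b).B a.T j (extrap (params l γ b) a)
  set xg := extrap (params l γ b) a
  set β := (params l γ b).β
  have hγ' : γ = 12 * β ^ 2 / l := by rw [h2]; field_simp
  constructor
  · ext i
    have hxi := congrArg (fun v : EuclideanSpace ℝ (Fin n) => v i) hx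
    simp only [PiLp.add_apply, PiLp.sub_apply, PiLp.smul_apply, smul_eq_mul] at hxi ⊢
    rw [hγ']
    field_simp
    linear_combination l * hxi
  · rw [hγ']
    congr 2
    ring

/-- The Lyapunov function `‖x‖² + (24/l) f(x_f)` with `f(y) = ⟨y, A y⟩ / 2`. -/
noncomputable def lyapunov (A : Matrix (Fin n) (Fin n) ℝ) (l : ℝ)
    (x xf : EuclideanSpace ℝ (Fin n)) : ℝ :=
  ‖x‖ ^ 2 + 12 / l * inner ℝ xf (act A xf)

/-- One iteration with an arbitrary gradient estimate `g`, of error `e = g - A x_g`: the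
Lyapunov function contracts up to a term linear and a term quadratic in `e`. -/
theorem lyapunov_step_le {A : Matrix (Fin n) (Fin n) ℝ} (hA : A.IsHermitian) {l L β : ℝ}
    (hl : 0 < l) (hβ : 0 < β) (hβ1 : β < 1) (hβL : β ^ 2 * L ≤ l / 16)
    (hpsd : ∀ z, 0 ≤ inner ℝ z (act A z)) (hL : ∀ z, inner ℝ z (act A z) ≤ L * ‖z‖ ^ 2)
    {x xf xg : EuclideanSpace ℝ (Fin n)} (g : EuclideanSpace ℝ (Fin n))
    (hxg : (4 - β ^ 2) • xg = (4 - β) • xf + (β * (1 - β)) • x)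
    (hconv : l * ‖xg‖ ^ 2 ≤ inner ℝ xg (act A xg)) :
    lyapunov A l ((1 - β) • x + β • xg - (3 * β / l) • g) (xg - (3 * β ^ 2 / l) • g)
      ≤ (1 - β / 4) * lyapunov A l x xf - 3 / 4 * β * ‖x‖ ^ 2 - 2 * β * ‖xg‖ ^ 2
        - 6 * β / l * inner ℝ ((1 - β) • x + β • xg) (g - act A xg)
        + 36 * (β ^ 2 / l ^ 2) * ‖g - act A xg‖ ^ 2 := by
  set h := act A xg with hh
  set e := g - h with he
  have hg : g = h + e := by rw [he]; abel
  set w := (1 - β) • x + β • xg with hw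
  -- expansion of the two squares
  have e1 : ‖w - (3 * β / l) • g‖ ^ 2
      = ‖w‖ ^ 2 - 6 * β / l * inner ℝ w g + 9 * (β ^ 2 / l ^ 2) * ‖g‖ ^ 2 := by
    rw [norm_sub_sq_real, real_inner_smul_right, norm_smul, mul_pow, Real.norm_eq_abs, sq_abs]
    ring
  have e2 : inner ℝ (xg - (3 * β ^ 2 / l) • g) (act A (xg - (3 * β ^ 2 / l) • g))
      = inner ℝ xg h - 6 * β ^ 2 / l * inner ℝ g h
        + 9 * (β ^ 4 / l ^ 2) * inner ℝ g (act A g) := by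
    have hs : inner ℝ xg (act A g) = inner ℝ g h := by
      rw [← inner_act_symm hA, real_inner_comm]
    rw [map_sub, map_smul, inner_sub_left, inner_sub_right, inner_sub_right,
      real_inner_smul_left, real_inner_smul_left, real_inner_smul_right, real_inner_smul_right, hs]
    ring
  have e3 : ‖w‖ ^ 2 ≤ (1 - β) * ‖x‖ ^ 2 + β * ‖xg‖ ^ 2 := by
    have h1 : ‖w‖ ^ 2 = (1 - β) * ‖x‖ ^ 2 + β * ‖xg‖ ^ 2 - β * (1 - β) * ‖x - xg‖ ^ 2 := by
      rw [hw, norm_add_sq_real, norm_sub_sq_real, real_inner_smul_left, real_inner_smul_right,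
        norm_smul, norm_smul, mul_pow, mul_pow, Real.norm_eq_abs, sq_abs, Real.norm_eq_abs, sq_abs]
      ring
    have h2 : 0 ≤ β * (1 - β) * ‖x - xg‖ ^ 2 :=
      mul_nonneg (mul_nonneg hβ.le (by linarith)) (sq_nonneg _)
    linarith
  -- convexity of the quadratic form along `x_g - x_f`
  have e4 : inner ℝ xg h - inner ℝ xf h ≥ 1 / 2 * inner ℝ xg h - 1 / 2 * inner ℝ xf (act A xf) := by
    have h1 := hpsd (xg - xf)
    have hs : inner ℝ xg (act A xf) = inner ℝ xf h := by
      rw [← inner_act_symm hA, real_inner_comm]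
    rw [map_sub, inner_sub_left, inner_sub_right, inner_sub_right, hs] at h1
    linarith
  have e5 : β * inner ℝ w h = β * inner ℝ xg h + (4 - β) * (inner ℝ xg h - inner ℝ xf h) := by
    have h1 := congrArg (fun v => inner ℝ v h) hxg
    simp only [inner_add_left, real_inner_smul_left] at h1
    rw [hw, inner_add_left, real_inner_smul_left, real_inner_smul_left]
    linear_combination -h1
  have e6 : inner ℝ w g = inner ℝ w h + inner ℝ w e := by rw [hg, inner_add_right]
  have e7 : inner ℝ g h = ‖h‖ ^ 2 + inner ℝ h e := by
    rw [hg, inner_add_left, real_inner_self_eq_norm_sq, real_inner_comm e h]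
  have e8 : ‖g‖ ^ 2 = ‖h‖ ^ 2 + 2 * inner ℝ h e + ‖e‖ ^ 2 := by rw [hg, norm_add_sq_real]
  have e9 : -(81 / 2) * inner ℝ h e ≤ 81 / 4 * (‖h‖ ^ 2 + ‖e‖ ^ 2) := by
    have := norm_add_sq_real h e
    nlinarith [sq_nonneg ‖h + e‖]
  -- smoothness: `β² L ≤ l / 16` controls the second-order term of `f(x_f⁺)`
  have e10 : 108 * (β ^ 4 / l ^ 3) * inner ℝ g (act A g) ≤ 27 / 4 * (β ^ 2 / l ^ 2) * ‖g‖ ^ 2 := by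
    calc 108 * (β ^ 4 / l ^ 3) * inner ℝ g (act A g)
        ≤ 108 * (β ^ 4 / l ^ 3) * (L * ‖g‖ ^ 2) :=
          mul_le_mul_of_nonneg_left (hL g) (by positivity)
      _ = 108 * (β ^ 2 / l ^ 3) * (β ^ 2 * L) * ‖g‖ ^ 2 := by ring
      _ ≤ 108 * (β ^ 2 / l ^ 3) * (l / 16) * ‖g‖ ^ 2 := by gcongr
      _ = _ := by field_simp; ring
  have f1 : 6 * β / l * inner ℝ w g = 6 / l * (β * inner ℝ w h) + 6 * β / l * inner ℝ w e := by
    rw [e6]; ring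
  have f2 : 6 / l * (β * inner ℝ w h) ≥ 6 / l * (β * inner ℝ xg h + (4 - β) *
      (1 / 2 * inner ℝ xg h - 1 / 2 * inner ℝ xf (act A xf))) := by
    rw [e5]
    have h4 : 0 ≤ 4 - β := by linarith
    gcongr
  have f3 : 3 * β / l * inner ℝ xg h ≥ 3 * β * ‖xg‖ ^ 2 := by
    calc 3 * β / l * inner ℝ xg h ≥ 3 * β / l * (l * ‖xg‖ ^ 2) := by gcongr
      _ = _ := by field_simp
  -- with `g = h + e` the left side is `-(225/4) ‖h‖² - (81/2) ⟨h, e⟩ + (63/4) ‖e‖²`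
  have f4 : (β ^ 2 / l ^ 2) * (63 / 4 * ‖g‖ ^ 2 - 72 * inner ℝ g h)
      ≤ (β ^ 2 / l ^ 2) * (36 * ‖e‖ ^ 2) := by
    refine mul_le_mul_of_nonneg_left ?_ (by positivity)
    rw [e7, e8]
    nlinarith [sq_nonneg ‖h‖]
  unfold lyapunov
  rw [e1, e2]
  have f5 : 12 / l * (inner ℝ xg h - 6 * β ^ 2 / l * inner ℝ g h
        + 9 * (β ^ 4 / l ^ 2) * inner ℝ g (act A g))
      = 12 / l * inner ℝ xg h - 72 * (β ^ 2 / l ^ 2) * inner ℝ g h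
        + 108 * (β ^ 4 / l ^ 3) * inner ℝ g (act A g) := by
    field_simp
    ring
  rw [f5, f1]
  have f6 : 6 / l * (β * inner ℝ xg h + (4 - β) *
      (1 / 2 * inner ℝ xg h - 1 / 2 * inner ℝ xf (act A xf)))
      = 12 / l * inner ℝ xg h + 3 * β / l * inner ℝ xg h
        - (1 - β / 4) * (12 / l * inner ℝ xf (act A xf)) := by ring
  rw [f6] at f2
  linarith

/-! ### Structural properties of the run -/

theorem run_T (q : Params) (w : ℕ → Matrix (Fin n) (Fin n) ℝ) (J : ℕ → ℕ)
    (x0 : EuclideanSpace ℝ (Fin n)) (k : ℕ) :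
    (run q w J x0 k).T = ∑ i ∈ Finset.range k, 2 ^ J i * q.B := by
  induction k with
  | zero => rfl
  | succ k ih => rw [Finset.sum_range_succ, ← ih]; rfl

theorem run_congr (q : Params) (w : ℕ → Matrix (Fin n) (Fin n) ℝ) {J J' : ℕ → ℕ}
    (x0 : EuclideanSpace ℝ (Fin n)) {k : ℕ} (h : ∀ i < k, J i = J' i) :
    run q w J x0 k = run q w J' x0 k := by
  induction k with
  | zero => rfl
  | succ k ih =>
    change step q w (J k) (run q w J x0 k) = step q w (J' k) (run q w J' x0 k)
    rw [ih fun i hi => h i (by omega), h k (by omega)]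

theorem batchMean_add_of_act_eq_zero {w : ℕ → Matrix (Fin n) (Fin n) ℝ}
    {c : EuclideanSpace ℝ (Fin n)} (hc : ∀ t, act (w t) c = 0) (B T j : ℕ)
    (y : EuclideanSpace ℝ (Fin n)) : batchMean w B T j (y + c) = batchMean w B T j y := by
  unfold batchMean
  simp_rw [map_add, hc, add_zero]

/-- Consensus vectors are invisible to the gossip matrices, so translating the start by one
translates the whole run. -/
theorem run_add_of_act_eq_zero (q : Params) {w : ℕ → Matrix (Fin n) (Fin n) ℝ} (J : ℕ → ℕ)
    (x0 : EuclideanSpace ℝ (Fin n)) {c : EuclideanSpace ℝ (Fin n)} (hc : ∀ t, act (w t) c = 0)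
    (k : ℕ) :
    (run q w J (x0 + c) k).x = (run q w J x0 k).x + c ∧
      (run q w J (x0 + c) k).xf = (run q w J x0 k).xf + c := by
  induction k with
  | zero => exact ⟨rfl, rfl⟩
  | succ k ih =>
    obtain ⟨h1, h2⟩ := ih
    have hT : (run q w J (x0 + c) k).T = (run q w J x0 k).T := by rw [run_T, run_T]
    set a := run q w J x0 k with ha
    set a' := run q w J (x0 + c) k with ha'
    have hxg : extrap q a' = extrap q a + c := by
      unfold extrap; rw [h1, h2]; module
    have hg : estimator w q.M q.B a'.T (J k) (extrap q a')
        = estimator w q.M q.B a.T (J k) (extrap q a) := by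
      unfold estimator
      simp only [hxg, hT, batchMean_add_of_act_eq_zero hc]
    have hxf : (step q w (J k) a').xf = (step q w (J k) a).xf + c := by
      change extrap q a' - (q.p * q.γ) • estimator w q.M q.B a'.T (J k) (extrap q a')
        = extrap q a - (q.p * q.γ) • estimator w q.M q.B a.T (J k) (extrap q a) + c
      rw [hg, hxg]; abel
    refine ⟨?_, hxf⟩
    change q.η • (step q w (J k) a').xf + (q.p - q.η) • a'.xf + ((1 - q.p) * (1 - q.β)) • a'.x
      + ((1 - q.p) * q.β) • extrap q a' = q.η • (step q w (J k) a).xf + (q.p - q.η) • a.xf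
      + ((1 - q.p) * (1 - q.β)) • a.x + ((1 - q.p) * q.β) • extrap q a + c
    rw [hxf, hxg, h1, h2]; module

theorem map_batchMean_eq_zero {w : ℕ → Matrix (Fin n) (Fin n) ℝ}
    (s : EuclideanSpace ℝ (Fin n) →ₗ[ℝ] ℝ) (hs : ∀ t y, s (act (w t) y) = 0) (B T j : ℕ)
    (y : EuclideanSpace ℝ (Fin n)) : s (batchMean w B T j y) = 0 := by
  unfold batchMean
  rw [map_smul, map_sum]
  simp [hs]

theorem map_estimator_eq_zero {w : ℕ → Matrix (Fin n) (Fin n) ℝ}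
    (s : EuclideanSpace ℝ (Fin n) →ₗ[ℝ] ℝ) (hs : ∀ t y, s (act (w t) y) = 0) (M : ℝ) (B T j : ℕ)
    (y : EuclideanSpace ℝ (Fin n)) : s (estimator w M B T j y) = 0 := by
  unfold estimator
  split_ifs <;> simp [map_batchMean_eq_zero s hs]

/-- A linear functional annihilated by the gossip matrices (such as the sum of the coordinates)
stays zero along the run. -/
theorem map_run_eq_zero (q : Params) {w : ℕ → Matrix (Fin n) (Fin n) ℝ} (J : ℕ → ℕ)
    {x0 : EuclideanSpace ℝ (Fin n)} (s : EuclideanSpace ℝ (Fin n) →ₗ[ℝ] ℝ)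
    (hs : ∀ t y, s (act (w t) y) = 0) (h0 : s x0 = 0) (k : ℕ) :
    s (run q w J x0 k).x = 0 ∧ s (run q w J x0 k).xf = 0 := by
  induction k with
  | zero => exact ⟨h0, h0⟩
  | succ k ih =>
    obtain ⟨h1, h2⟩ := ih
    have hxg : s (extrap q (run q w J x0 k)) = 0 := by
      unfold extrap; simp [h1, h2]
    have hxf : s (step q w (J k) (run q w J x0 k)).xf = 0 := by
      change s (extrap q (run q w J x0 k) - (q.p * q.γ) • estimator w q.M q.B
        (run q w J x0 k).T (J k) (extrap q (run q w J x0 k))) = 0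
      rw [map_sub, map_smul, hxg, map_estimator_eq_zero s hs]; simp
    refine ⟨?_, hxf⟩
    change s (q.η • (step q w (J k) (run q w J x0 k)).xf + (q.p - q.η) • (run q w J x0 k).xf
      + ((1 - q.p) * (1 - q.β)) • (run q w J x0 k).x
      + ((1 - q.p) * q.β) • extrap q (run q w J x0 k)) = 0
    simp [hxf, h1, h2, hxg]

theorem norm_batchMean_le {w : ℕ → Matrix (Fin n) (Fin n) ℝ} {R : ℝ} (hR : ∀ t, ‖act (w t)‖ ≤ R)
    (B T j : ℕ) (y : EuclideanSpace ℝ (Fin n)) : ‖batchMean w B T j y‖ ≤ R * ‖y‖ := by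
  have hR0 : 0 ≤ R := (norm_nonneg _).trans (hR 0)
  unfold batchMean
  rw [norm_smul, norm_inv]
  have h1 : ‖∑ i ∈ Finset.Icc 1 (2 ^ j * B), act (w (T + i)) y‖ ≤ (2 ^ j * B : ℝ) * (R * ‖y‖) := by
    refine (norm_sum_le_of_le _ (f := fun i => act (w (T + i)) y) (n := fun _ => R * ‖y‖) fun i _ =>
      (act _).le_of_opNorm_le (hR _) y).trans (le_of_eq ?_)
    rw [Finset.sum_const, Nat.card_Icc, Nat.add_sub_cancel, nsmul_eq_mul]
    push_cast; ring
  have h0 : (0 : ℝ) ≤ 2 ^ j * B := by positivity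
  rw [Real.norm_of_nonneg h0]
  rcases h0.eq_or_lt with h | h
  · rw [← h, inv_zero, zero_mul]; positivity
  · calc _ ≤ (2 ^ j * (B : ℝ))⁻¹ * ((2 ^ j * B : ℝ) * (R * ‖y‖)) :=
          mul_le_mul_of_nonneg_left h1 (inv_nonneg.2 h0)
      _ = _ := inv_mul_cancel_left₀ h.ne' _

theorem norm_estimator_le {w : ℕ → Matrix (Fin n) (Fin n) ℝ} {R : ℝ} (hR : ∀ t, ‖act (w t)‖ ≤ R)
    {M : ℝ} (hM : 0 ≤ M) (B T j : ℕ) (y : EuclideanSpace ℝ (Fin n)) :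
    ‖estimator w M B T j y‖ ≤ (1 + 2 * M) * R * ‖y‖ := by
  have hR0 : 0 ≤ R := (norm_nonneg _).trans (hR 0)
  have hRy : 0 ≤ R * ‖y‖ := by positivity
  have hb := norm_batchMean_le hR B T
  unfold estimator
  split_ifs with h
  · refine (norm_add_le _ _).trans ?_
    rw [norm_smul, Real.norm_of_nonneg (by positivity)]
    have h2 : ‖batchMean w B T j y - batchMean w B T (j - 1) y‖ ≤ 2 * (R * ‖y‖) :=
      (norm_sub_le _ _).trans (by linarith [hb j y, hb (j - 1) y])
    have h3 := mul_le_mul h h2 (norm_nonneg _) hM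
    linarith [hb 0 y]
  · rw [add_zero]
    have := mul_nonneg hM hRy
    linarith [hb 0 y]

/-- The iterates are bounded uniformly over bounded networks and all seeds, so that every
expectation in the argument is one of a bounded function. -/
theorem exists_norm_run_le (q : Params) (hM : 0 ≤ q.M) (R : ℝ) (x0 : EuclideanSpace ℝ (Fin n))
    (k : ℕ) : ∃ C : ℝ, ∀ w : ℕ → Matrix (Fin n) (Fin n) ℝ, (∀ t, ‖act (w t)‖ ≤ R) → ∀ J,
      ‖(run q w J x0 k).x‖ ≤ C ∧ ‖(run q w J x0 k).xf‖ ≤ C := by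
  induction k with
  | zero => exact ⟨‖x0‖, fun _ _ _ => ⟨le_rfl, le_rfl⟩⟩
  | succ k ih =>
    obtain ⟨C, hC⟩ := ih
    set C1 := |q.θ| * C + |1 - q.θ| * C with hC1
    set C2 := C1 + |q.p * q.γ| * ((1 + 2 * q.M) * R * C1) with hC2
    set C3 := |q.η| * C2 + |q.p - q.η| * C + |(1 - q.p) * (1 - q.β)| * C
      + |(1 - q.p) * q.β| * C1
    refine ⟨max C2 C3, fun w hw J => ?_⟩
    obtain ⟨h1, h2⟩ := hC w hw J
    have hR0 : 0 ≤ R := (norm_nonneg _).trans (hw 0)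
    have hs : ∀ (r : ℝ) (v : EuclideanSpace ℝ (Fin n)) (c : ℝ), ‖v‖ ≤ c → ‖r • v‖ ≤ |r| * c :=
      fun r v c h => by
        rw [norm_smul]; exact mul_le_mul_of_nonneg_left h (abs_nonneg _)
    have hxg : ‖extrap q (run q w J x0 k)‖ ≤ C1 :=
      norm_add_le_of_le (hs _ _ _ h2) (hs _ _ _ h1)
    have hxf : ‖(step q w (J k) (run q w J x0 k)).xf‖ ≤ C2 := by
      change ‖extrap q (run q w J x0 k) - (q.p * q.γ) • estimator w q.M q.B
        (run q w J x0 k).T (J k) (extrap q (run q w J x0 k))‖ ≤ C2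
      refine norm_sub_le_of_le hxg (hs _ _ _ ?_)
      exact (norm_estimator_le hw hM _ _ _ _).trans
        (mul_le_mul_of_nonneg_left hxg (by positivity))
    refine ⟨le_trans ?_ (le_max_right _ _), hxf.trans (le_max_left _ _)⟩
    change ‖q.η • (step q w (J k) (run q w J x0 k)).xf + (q.p - q.η) • (run q w J x0 k).xf
      + ((1 - q.p) * (1 - q.β)) • (run q w J x0 k).x
      + ((1 - q.p) * q.β) • extrap q (run q w J x0 k)‖ ≤ C3
    exact norm_add_le_of_le (norm_add_le_of_le (norm_add_le_of_le (hs _ _ _ hxf) (hs _ _ _ h2))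
      (hs _ _ _ h1)) (hs _ _ _ hxg)

theorem stronglyMeasurable_batchMean {Ω : Type*} (m : MeasurableSpace Ω)
    {w : ℕ → Ω → Matrix (Fin n) (Fin n) ℝ} {B T a : ℕ}
    (hw : ∀ t ≤ T + 2 ^ a * B, ∀ i j, Measurable[m] fun ω => w t ω i j)
    {y : Ω → EuclideanSpace ℝ (Fin n)} (hy : StronglyMeasurable[m] y) :
    StronglyMeasurable[m] fun ω => batchMean (fun t => w t ω) B T a (y ω) := by
  unfold batchMean
  refine StronglyMeasurable.fun_const_smul ?_ ((2 : ℝ) ^ a * (B : ℝ))⁻¹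
  refine Finset.stronglyMeasurable_fun_sum _ fun i hi => ?_
  rw [Finset.mem_Icc] at hi
  exact stronglyMeasurable_act m (hw _ (by omega)) hy

theorem stronglyMeasurable_estimator {Ω : Type*} (m : MeasurableSpace Ω)
    {w : ℕ → Ω → Matrix (Fin n) (Fin n) ℝ} (M : ℝ) {B T a : ℕ}
    (hw : ∀ t ≤ T + 2 ^ a * B, ∀ i j, Measurable[m] fun ω => w t ω i j)
    {y : Ω → EuclideanSpace ℝ (Fin n)} (hy : StronglyMeasurable[m] y) :
    StronglyMeasurable[m] fun ω => estimator (fun t => w t ω) M B T a (y ω) := by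
  have hb : ∀ c ≤ a, StronglyMeasurable[m] fun ω => batchMean (fun t => w t ω) B T c (y ω) :=
    fun c hc => stronglyMeasurable_batchMean m (fun t ht => hw t (ht.trans (by gcongr; norm_num)))
      hy
  unfold estimator
  refine (hb 0 (Nat.zero_le _)).add ?_
  by_cases h : (2 : ℝ) ^ a ≤ M
  · simp only [h, if_true]
    exact ((hb a le_rfl).sub (hb (a - 1) (Nat.sub_le _ _))).fun_const_smul ((2 : ℝ) ^ a)
  · simp only [h, if_false]
    exact stronglyMeasurable_const

/-- With a fixed seed, the `k`-th state depends only on the rounds up to its (deterministic) time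
counter. -/
theorem stronglyMeasurable_run {Ω : Type*} (m : ℕ → MeasurableSpace Ω) (hm : Monotone m)
    {w : ℕ → Ω → Matrix (Fin n) (Fin n) ℝ} (hw : ∀ t i j, Measurable[m t] fun ω => w t ω i j)
    (q : Params) (J : ℕ → ℕ) (x0 : EuclideanSpace ℝ (Fin n)) (k : ℕ) :
    StronglyMeasurable[m (∑ i ∈ Finset.range k, 2 ^ J i * q.B)]
        (fun ω => (run q (fun t => w t ω) J x0 k).x) ∧
      StronglyMeasurable[m (∑ i ∈ Finset.range k, 2 ^ J i * q.B)]
        (fun ω => (run q (fun t => w t ω) J x0 k).xf) := by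
  induction k with
  | zero => exact ⟨stronglyMeasurable_const, stronglyMeasurable_const⟩
  | succ k ih =>
    set T := ∑ i ∈ Finset.range k, 2 ^ J i * q.B with hT
    rw [Finset.sum_range_succ, ← hT]
    have hle : m T ≤ m (T + 2 ^ J k * q.B) := hm (by omega)
    have h1 := ih.1.mono hle
    have h2 := ih.2.mono hle
    have hxg : StronglyMeasurable[m (T + 2 ^ J k * q.B)]
        fun ω => extrap q (run q (fun t => w t ω) J x0 k) :=
      (h2.fun_const_smul q.θ).add (h1.fun_const_smul (1 - q.θ))
    have hg : StronglyMeasurable[m (T + 2 ^ J k * q.B)] fun ω => estimator (fun t => w t ω) q.M q.B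
        (run q (fun t => w t ω) J x0 k).T (J k) (extrap q (run q (fun t => w t ω) J x0 k)) := by
      simp_rw [run_T, ← hT]
      exact stronglyMeasurable_estimator _ q.M (fun t ht i j => (hw t i j).mono (hm ht) le_rfl) hxg
    have hxf : StronglyMeasurable[m (T + 2 ^ J k * q.B)]
        fun ω => (run q (fun t => w t ω) J x0 (k + 1)).xf :=
      hxg.sub (hg.fun_const_smul (q.p * q.γ))
    exact ⟨(((hxf.fun_const_smul q.η).add (h2.fun_const_smul (q.p - q.η))).add
      (h1.fun_const_smul ((1 - q.p) * (1 - q.β)))).add (hxg.fun_const_smul ((1 - q.p) * q.β)), hxf⟩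

end Recursion

/-! ### Expected contraction over one iteration -/

section LevelMean

/-- The mean of `φ` over the sampled level: level `a ∈ {1, …, m}` has weight `2⁻ᵃ`, and all other
levels act like level `0`. -/
noncomputable def levelMean (m : ℕ) (φ : ℕ → ℝ) : ℝ :=
  φ 0 + ∑ a ∈ Finset.Icc 1 m, (1 / 2 : ℝ) ^ a * (φ a - φ 0)

theorem levelMean_succ (m : ℕ) (φ : ℕ → ℝ) :
    levelMean (m + 1) φ = levelMean m φ + (1 / 2 : ℝ) ^ (m + 1) * (φ (m + 1) - φ 0) := by
  unfold levelMean
  rw [Finset.sum_Icc_succ_top (by omega)]; ring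

theorem levelMean_eq (m : ℕ) (φ : ℕ → ℝ) :
    levelMean m φ = (1 / 2 : ℝ) ^ m * φ 0 + ∑ a ∈ Finset.Icc 1 m, (1 / 2 : ℝ) ^ a * φ a := by
  induction m with
  | zero => simp [levelMean]
  | succ m ih => rw [levelMean_succ, ih, Finset.sum_Icc_succ_top (by omega)]; ring

theorem levelMean_le_levelMean {m : ℕ} {φ ψ : ℕ → ℝ} (h : ∀ a ≤ m, φ a ≤ ψ a) :
    levelMean m φ ≤ levelMean m ψ := by
  rw [levelMean_eq, levelMean_eq]
  refine add_le_add (mul_le_mul_of_nonneg_left (h 0 (Nat.zero_le _)) (by positivity))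
    (Finset.sum_le_sum fun a ha => mul_le_mul_of_nonneg_left (h a (Finset.mem_Icc.1 ha).2)
      (by positivity))

theorem levelMean_affine (m : ℕ) (c d e : ℝ) (φ ψ : ℕ → ℝ) :
    levelMean m (fun a => c + d * φ a + e * ψ a) = c + d * levelMean m φ + e * levelMean m ψ := by
  induction m with
  | zero => simp [levelMean]
  | succ m ih => rw [levelMean_succ, levelMean_succ, levelMean_succ, ih]; ring

theorem levelMean_add_mul (m : ℕ) (c d : ℝ) (φ : ℕ → ℝ) :
    levelMean m (fun a => c + d * φ a) = c + d * levelMean m φ := by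
  simpa using levelMean_affine m c d 0 φ 0

/-- The randomised estimator telescopes in the mean: on average only the finest level is left. -/
theorem levelMean_telescope (m : ℕ) (s : ℕ → ℝ) :
    levelMean m (fun a => s 0 + 2 ^ a * (s a - s (a - 1))) = s m := by
  induction m with
  | zero => simp [levelMean]
  | succ m ih =>
    have h : (1 / 2 : ℝ) ^ (m + 1) * 2 ^ (m + 1) = 1 := by rw [← mul_pow]; norm_num
    rw [levelMean_succ, ih]
    simp only [Nat.add_sub_cancel, pow_zero, zero_tsub, sub_self, mul_zero, add_zero,
      add_sub_cancel_left]
    linear_combination (s (m + 1) - s m) * h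

theorem levelMean_two_pow_le (m : ℕ) : levelMean m (fun a => (2 : ℝ) ^ a) ≤ 1 + m := by
  induction m with
  | zero => simp [levelMean]
  | succ m ih =>
    have h : (1 / 2 : ℝ) ^ (m + 1) * 2 ^ (m + 1) = 1 := by rw [← mul_pow]; norm_num
    have h1 : (0 : ℝ) ≤ (1 / 2 : ℝ) ^ (m + 1) := by positivity
    rw [levelMean_succ, mul_sub, h]
    push_cast
    linarith

end LevelMean

section BddMeas

/-- Bounded and strongly measurable. -/
def BddMeas {Ω F : Type*} [MeasurableSpace Ω] [NormedAddCommGroup F] (f : Ω → F) : Prop :=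
  StronglyMeasurable f ∧ ∃ C : ℝ, ∀ ω, ‖f ω‖ ≤ C

variable {Ω F : Type*} [MeasurableSpace Ω] [NormedAddCommGroup F] {f g : Ω → F}

theorem BddMeas.integrable {μ : Measure Ω} [IsFiniteMeasure μ] (hf : BddMeas f) :
    Integrable f μ := by
  obtain ⟨h, C, hC⟩ := hf
  exact integrable_of_bounded h hC

theorem BddMeas.add (hf : BddMeas f) (hg : BddMeas g) : BddMeas fun ω => f ω + g ω := by
  obtain ⟨h, C, hC⟩ := hf
  obtain ⟨h', C', hC'⟩ := hg
  exact ⟨h.add h', C + C', fun ω => norm_add_le_of_le (hC ω) (hC' ω)⟩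

theorem BddMeas.sub (hf : BddMeas f) (hg : BddMeas g) : BddMeas fun ω => f ω - g ω := by
  obtain ⟨h, C, hC⟩ := hf
  obtain ⟨h', C', hC'⟩ := hg
  exact ⟨h.sub h', C + C', fun ω => norm_sub_le_of_le (hC ω) (hC' ω)⟩

theorem BddMeas.norm (hf : BddMeas f) : BddMeas fun ω => ‖f ω‖ := by
  obtain ⟨h, C, hC⟩ := hf
  exact ⟨h.norm, C, fun ω => by rw [norm_norm]; exact hC ω⟩

theorem BddMeas.clm {G : Type*} [NormedAddCommGroup G] [NormedSpace ℝ F] [NormedSpace ℝ G]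
    (hf : BddMeas f) (A : F →L[ℝ] G) : BddMeas fun ω => A (f ω) := by
  obtain ⟨h, C, hC⟩ := hf
  exact ⟨A.continuous.comp_stronglyMeasurable h, ‖A‖ * C, fun ω => A.le_opNorm_of_le (hC ω)⟩

theorem BddMeas.const_smul [NormedSpace ℝ F] (hf : BddMeas f) (c : ℝ) :
    BddMeas fun ω => c • f ω :=
  hf.clm (c • ContinuousLinearMap.id ℝ F)

theorem BddMeas.const_mul {f : Ω → ℝ} (hf : BddMeas f) (c : ℝ) : BddMeas fun ω => c * f ω :=
  hf.const_smul c

theorem BddMeas.mul {f g : Ω → ℝ} (hf : BddMeas f) (hg : BddMeas g) :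
    BddMeas fun ω => f ω * g ω := by
  obtain ⟨h, C, hC⟩ := hf
  obtain ⟨h', C', hC'⟩ := hg
  exact ⟨h.mul h', C * C', fun ω => by
    rw [norm_mul]
    exact mul_le_mul (hC ω) (hC' ω) (norm_nonneg _) ((norm_nonneg _).trans (hC ω))⟩

theorem BddMeas.norm_sq (hf : BddMeas f) : BddMeas fun ω => ‖f ω‖ ^ 2 := by
  simp_rw [sq]
  exact hf.norm.mul hf.norm

theorem BddMeas.inner [InnerProductSpace ℝ F] (hf : BddMeas f) (hg : BddMeas g) :
    BddMeas fun ω => inner ℝ (f ω) (g ω) := by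
  obtain ⟨h, C, hC⟩ := hf
  obtain ⟨h', C', hC'⟩ := hg
  exact ⟨StronglyMeasurable.inner h h', C * C', fun ω => (abs_real_inner_le_norm _ _).trans
    (mul_le_mul (hC ω) (hC' ω) (norm_nonneg _) ((norm_nonneg _).trans (hC ω)))⟩

theorem BddMeas.lyapunov {n : ℕ} {x xf : Ω → EuclideanSpace ℝ (Fin n)} (hx : BddMeas x)
    (hxf : BddMeas xf) (A : Matrix (Fin n) (Fin n) ℝ) (l : ℝ) :
    BddMeas fun ω => lyapunov A l (x ω) (xf ω) :=
  hx.norm_sq.add ((hxf.inner (hxf.clm (act A))).const_mul _)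

end BddMeas

section OneStep

theorem estimator_sub_act {n : ℕ} (w : ℕ → Matrix (Fin n) (Fin n) ℝ)
    (Wt : Matrix (Fin n) (Fin n) ℝ) {M : ℝ} (B t : ℕ) {c : ℕ} (hc : (2 : ℝ) ^ c ≤ M)
    (y : EuclideanSpace ℝ (Fin n)) :
    estimator w M B t c y - act Wt y = batchError w Wt B t 0 y
      + (2 : ℝ) ^ c • (batchError w Wt B t c y - batchError w Wt B t (c - 1) y) := by
  unfold estimator batchError
  rw [if_pos hc, sub_sub_sub_cancel_right]
  abel

variable {n : ℕ} {Ω S : Type*} [MeasurableSpace Ω] [MeasurableSpace S] {P : Measure Ω}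
  {Z : ℕ → Ω → S} {Q : Kernel S S} [IsMarkovKernel Q] {π : Measure S}
  {graph : S → SimpleGraph (Fin n)} {W : S → Matrix (Fin n) (Fin n) ℝ}
  {Wt : Matrix (Fin n) (Fin n) ℝ} {τ : ℕ} {ρ : ℝ}

theorem NetworkAssumptions.norm_act_le (hN : NetworkAssumptions P Z Q π graph W Wt τ ρ) (s : S) :
    ‖act (W s)‖ ≤ ρ + ‖act Wt‖ := by
  have : act (W s) = act (W s - Wt) + act Wt := by rw [act_sub, sub_add_cancel]
  rw [this]
  exact norm_add_le_of_le (hN.bounded s) le_rfl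

variable [IsProbabilityMeasure P]

theorem NetworkAssumptions.bddMeas_batchMean (hN : NetworkAssumptions P Z Q π graph W Wt τ ρ)
    (B t c : ℕ) {y : Ω → EuclideanSpace ℝ (Fin n)} (hy : BddMeas y) :
    BddMeas fun ω => batchMean (fun i => W (Z i ω)) B t c (y ω) := by
  obtain ⟨h, C, hC⟩ := hy
  have hR : 0 ≤ ρ + ‖act Wt‖ := add_nonneg hN.noise_nonneg (norm_nonneg _)
  exact ⟨stronglyMeasurable_batchMean _ (w := fun i ω => W (Z i ω))
    (fun s _ i j => (hN.measurable i j).comp (hN.chain.measurable s)) h, (ρ + ‖act Wt‖) * C,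
    fun ω => (norm_batchMean_le (fun _ => hN.norm_act_le _) B t c _).trans
      (mul_le_mul_of_nonneg_left (hC ω) hR)⟩

theorem NetworkAssumptions.bddMeas_estimator (hN : NetworkAssumptions P Z Q π graph W Wt τ ρ)
    {M : ℝ} (hM : 0 ≤ M) (B t c : ℕ) {y : Ω → EuclideanSpace ℝ (Fin n)} (hy : BddMeas y) :
    BddMeas fun ω => estimator (fun i => W (Z i ω)) M B t c (y ω) := by
  obtain ⟨h, C, hC⟩ := hy
  have hR : 0 ≤ ρ + ‖act Wt‖ := add_nonneg hN.noise_nonneg (norm_nonneg _)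
  exact ⟨stronglyMeasurable_estimator _ (w := fun i ω => W (Z i ω)) M
    (fun s _ i j => (hN.measurable i j).comp (hN.chain.measurable s)) h,
    (1 + 2 * M) * (ρ + ‖act Wt‖) * C,
    fun ω => (norm_estimator_le (fun _ => hN.norm_act_le _) hM B t c _).trans
      (mul_le_mul_of_nonneg_left (hC ω) (by positivity))⟩

/-- The variance of the randomised estimator: level `c` has probability `2⁻ᶜ` and second moment
of order `2ᶜ`, so each of the `m` levels contributes equally. -/
theorem NetworkAssumptions.levelMean_variance_le
    (hN : NetworkAssumptions P Z Q π graph W Wt τ ρ) {B m : ℕ} {M : ℝ} (hB : 0 < B)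
    (hm : ∀ c ≤ m, (2 : ℝ) ^ c ≤ M) (t : ℕ)
    {y : Ω → EuclideanSpace ℝ (Fin n)} (hy : StronglyMeasurable[pastSigma Z t] y) {C : ℝ}
    (hC : ∀ ω, ‖y ω‖ ≤ C) :
    levelMean m (fun c => ∫ ω, ‖estimator (fun i => W (Z i ω)) M B t c (y ω)
        - act Wt (y ω)‖ ^ 2 ∂P)
      ≤ (14 + 12 * m) * (16 / 3 * ρ ^ 2 * τ / B * ∫ ω, ‖y ω‖ ^ 2 ∂P) := by
  have hyb : BddMeas y := ⟨hy.mono (pastSigma_le hN.chain.measurable t), C, hC⟩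
  have hB' : (0 : ℝ) < B := by exact_mod_cast hB
  set v := 16 / 3 * ρ ^ 2 * τ / B * ∫ ω, ‖y ω‖ ^ 2 ∂P with hv
  have hv0 : 0 ≤ v := mul_nonneg (by positivity) (integral_nonneg fun ω => by positivity)
  have hbe : ∀ c, BddMeas fun ω => batchError (fun i => W (Z i ω)) Wt B t c (y ω) := fun c =>
    (hN.bddMeas_batchMean B t c hyb).sub (hyb.clm (act Wt))
  have hvar : ∀ c, (2 : ℝ) ^ c * ∫ ω, ‖batchError (fun i => W (Z i ω)) Wt B t c (y ω)‖ ^ 2 ∂P ≤ v :=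
    fun c => by
      have h := mul_le_mul_of_nonneg_left (integral_norm_batchError_sq_le hN hB t c hy hC)
        (by positivity : (0 : ℝ) ≤ 2 ^ c)
      refine h.trans (le_of_eq ?_)
      rw [hv]; field_simp
  have hbound : ∀ c ≤ m, ∫ ω, ‖estimator (fun i => W (Z i ω)) M B t c (y ω) - act Wt (y ω)‖ ^ 2 ∂P
      ≤ 2 * v + 12 * v * (2 : ℝ) ^ c := by
    intro c hc
    set I : ℕ → ℝ := fun c => ∫ ω, ‖batchError (fun i => W (Z i ω)) Wt B t c (y ω)‖ ^ 2 ∂P with hI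
    have hI0 : I 0 ≤ v := by simpa using hvar 0
    have h1 : ∫ ω, ‖estimator (fun i => W (Z i ω)) M B t c (y ω) - act Wt (y ω)‖ ^ 2 ∂P
        ≤ 2 * I 0 + 4 * (2 ^ c) ^ 2 * (I c + I (c - 1)) := by
      have hint := ((hbe 0).norm_sq.const_mul 2).add
        (((hbe c).norm_sq.add (hbe (c - 1)).norm_sq).const_mul (4 * (2 ^ c) ^ 2))
      calc _ ≤ ∫ ω, (2 * ‖batchError (fun i => W (Z i ω)) Wt B t 0 (y ω)‖ ^ 2
            + 4 * (2 ^ c) ^ 2 * (‖batchError (fun i => W (Z i ω)) Wt B t c (y ω)‖ ^ 2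
            + ‖batchError (fun i => W (Z i ω)) Wt B t (c - 1) (y ω)‖ ^ 2)) ∂P := by
            refine integral_mono_of_nonneg (Filter.Eventually.of_forall fun ω => by positivity)
              hint.integrable (Filter.Eventually.of_forall fun ω => ?_)
            dsimp only
            rw [estimator_sub_act _ _ _ _ (hm c hc)]
            set b0 := batchError (fun i => W (Z i ω)) Wt B t 0 (y ω)
            set b1 := batchError (fun i => W (Z i ω)) Wt B t c (y ω)
            set b2 := batchError (fun i => W (Z i ω)) Wt B t (c - 1) (y ω)
            have e1 := norm_add_le b0 ((2 : ℝ) ^ c • (b1 - b2))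
            have e2 := norm_sub_le b1 b2
            rw [norm_smul, Real.norm_of_nonneg (by positivity)] at e1
            have e3 : ‖b1 - b2‖ ^ 2 ≤ 2 * (‖b1‖ ^ 2 + ‖b2‖ ^ 2) := by
              nlinarith [sq_nonneg (‖b1‖ - ‖b2‖), norm_nonneg (b1 - b2)]
            have e4 : ‖b0 + (2 : ℝ) ^ c • (b1 - b2)‖ ^ 2
                ≤ 2 * ‖b0‖ ^ 2 + 2 * ((2 : ℝ) ^ c * ‖b1 - b2‖) ^ 2 := by
              nlinarith [sq_nonneg (‖b0‖ - (2 : ℝ) ^ c * ‖b1 - b2‖),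
                norm_nonneg (b0 + (2 : ℝ) ^ c • (b1 - b2))]
            have e5 := mul_le_mul_of_nonneg_left e3 (by positivity : (0 : ℝ) ≤ 2 * (2 ^ c) ^ 2)
            rw [mul_pow] at e4
            linarith
        _ = _ := by
          rw [integral_add ((hbe 0).norm_sq.const_mul 2).integrable (((hbe c).norm_sq.add
            (hbe (c - 1)).norm_sq).const_mul (4 * (2 ^ c) ^ 2)).integrable, integral_const_mul,
            integral_const_mul, integral_add (hbe c).norm_sq.integrable
            (hbe (c - 1)).norm_sq.integrable]
    have h2 : (2 : ℝ) ^ c * (I c + I (c - 1)) ≤ 3 * v := by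
      have h3 : (2 : ℝ) ^ c * I (c - 1) ≤ 2 * v := by
        -- at `c = 0` the natural subtraction gives `c - 1 = 0`, where the level-`0` bound applies
        rcases Nat.eq_zero_or_pos c with rfl | hc0
        · have := hvar 0
          simp only [pow_zero, one_mul] at this ⊢
          change I 0 ≤ v at this
          change I 0 ≤ 2 * v
          linarith
        · obtain ⟨d, rfl⟩ := Nat.exists_eq_add_of_lt hc0
          have := hvar d
          simp only [zero_add, Nat.add_sub_cancel]
          rw [pow_succ]
          change (2 : ℝ) ^ d * I d ≤ v at this
          linarith
      have := hvar c
      change (2 : ℝ) ^ c * I c ≤ v at this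
      linarith
    have h4 := mul_le_mul_of_nonneg_left h2 (by positivity : (0 : ℝ) ≤ 4 * 2 ^ c)
    linarith
  refine (levelMean_le_levelMean hbound).trans ?_
  rw [levelMean_add_mul]
  have := mul_le_mul_of_nonneg_left (levelMean_two_pow_le m) (by positivity : 0 ≤ 12 * v)
  linarith

/-- The bias of the randomised estimator is that of its finest level `m`, of order `ρ / M`. -/
theorem NetworkAssumptions.abs_levelMean_bias_le
    (hN : NetworkAssumptions P Z Q π graph W Wt τ ρ) {B m : ℕ} {M : ℝ} (hB : 0 < B)
    (hm : ∀ c ≤ m, (2 : ℝ) ^ c ≤ M) (hM0 : 0 < M) (hM : M ≤ 2 ^ (m + 1)) (hτB : τ ≤ B) (t : ℕ)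
    {u y : Ω → EuclideanSpace ℝ (Fin n)} (hu : StronglyMeasurable[pastSigma Z t] u)
    (hy : StronglyMeasurable[pastSigma Z t] y) {cu C : ℝ} (hcu : ∀ ω, ‖u ω‖ ≤ cu)
    (hC : ∀ ω, ‖y ω‖ ≤ C) :
    |levelMean m (fun c => ∫ ω, inner ℝ (u ω) (estimator (fun i => W (Z i ω)) M B t c (y ω)
        - act Wt (y ω)) ∂P)| ≤ 16 / 3 * (ρ / M) * ∫ ω, ‖u ω‖ * ‖y ω‖ ∂P := by
  have hle := pastSigma_le hN.chain.measurable t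
  have hyb : BddMeas y := ⟨hy.mono hle, C, hC⟩
  have hub : BddMeas u := ⟨hu.mono hle, cu, hcu⟩
  have hρ := hN.noise_nonneg
  have hB' : (0 : ℝ) < B := by exact_mod_cast hB
  have hbe : ∀ c, BddMeas fun ω => batchError (fun i => W (Z i ω)) Wt B t c (y ω) := fun c =>
    (hN.bddMeas_batchMean B t c hyb).sub (hyb.clm (act Wt))
  set s : ℕ → ℝ := fun c =>
    ∫ ω, inner ℝ (u ω) (batchError (fun i => W (Z i ω)) Wt B t c (y ω)) ∂P with hs
  have heq : ∀ c ≤ m, ∫ ω, inner ℝ (u ω) (estimator (fun i => W (Z i ω)) M B t c (y ω)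
        - act Wt (y ω)) ∂P = s 0 + 2 ^ c * (s c - s (c - 1)) := by
    intro c hc
    simp_rw [estimator_sub_act _ Wt _ _ (hm c hc), inner_add_right, real_inner_smul_right,
      inner_sub_right]
    rw [integral_add (hub.inner (hbe 0)).integrable
      (((hub.inner (hbe c)).sub (hub.inner (hbe (c - 1)))).const_mul _).integrable,
      integral_const_mul, integral_sub (hub.inner (hbe c)).integrable
      (hub.inner (hbe (c - 1))).integrable]
  have h1 : levelMean m (fun c => ∫ ω, inner ℝ (u ω) (estimator (fun i => W (Z i ω)) M B t c (y ω)
        - act Wt (y ω)) ∂P) = s m := by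
    rw [← levelMean_telescope m s]
    exact le_antisymm (levelMean_le_levelMean fun c hc => (heq c hc).le)
      (levelMean_le_levelMean fun c hc => (heq c hc).ge)
  rw [h1]
  refine (abs_integral_inner_batchError_le hN hB t m hu hy hcu hC).trans ?_
  refine mul_le_mul_of_nonneg_right ?_ (integral_nonneg fun ω => by positivity)
  have hτ : (τ : ℝ) ≤ B := by exact_mod_cast hτB
  rw [← mul_div_assoc, div_le_div_iff₀ (by positivity) hM0]
  calc 8 / 3 * ρ * τ * M ≤ 8 / 3 * ρ * B * 2 ^ (m + 1) := by gcongr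
    _ = 16 / 3 * ρ * (2 ^ m * B) := by ring

/-- For a fixed past, the Lyapunov function contracts by `1 - β/4` on average over the level and
the network: the curvature terms `-(3/4) β ‖x‖² - 2 β ‖x_g‖²` absorb bias and variance. -/
theorem NetworkAssumptions.levelMean_lyapunov_le
    (hN : NetworkAssumptions P Z Q π graph W Wt τ ρ) {B m : ℕ} {M l L β : ℝ} (hm1 : 1 ≤ m)
    (hm : ∀ c ≤ m, (2 : ℝ) ^ c ≤ M) (hM : M ≤ 2 ^ (m + 1)) (hmB : τ * m ≤ B)
    (hl : 0 < l) (hβ : 0 < β) (hβ1 : β < 1) (hβL : β ^ 2 * L ≤ l / 16)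
    (hβρ : 12000 * (β * ρ ^ 2) ≤ l ^ 2) (hβM : 1 ≤ 2 * β * M ^ 2)
    (hL : ∀ z, inner ℝ z (act Wt z) ≤ L * ‖z‖ ^ 2) (t : ℕ)
    {x xf xg : Ω → EuclideanSpace ℝ (Fin n)} (hx : StronglyMeasurable[pastSigma Z t] x)
    (hxf : StronglyMeasurable[pastSigma Z t] xf) (hxg : StronglyMeasurable[pastSigma Z t] xg)
    {C : ℝ} (hxC : ∀ ω, ‖x ω‖ ≤ C) (hxfC : ∀ ω, ‖xf ω‖ ≤ C) (hxgC : ∀ ω, ‖xg ω‖ ≤ C)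
    (hrel : ∀ ω, (4 - β ^ 2) • xg ω = (4 - β) • xf ω + (β * (1 - β)) • x ω)
    (hconv : ∀ ω, l * ‖xg ω‖ ^ 2 ≤ inner ℝ (xg ω) (act Wt (xg ω))) :
    levelMean m (fun c => ∫ ω, lyapunov Wt l
        ((1 - β) • x ω + β • xg ω
          - (3 * β / l) • estimator (fun i => W (Z i ω)) M B t c (xg ω))
        (xg ω - (3 * β ^ 2 / l) • estimator (fun i => W (Z i ω)) M B t c (xg ω)) ∂P)
      ≤ (1 - β / 4) * ∫ ω, lyapunov Wt l (x ω) (xf ω) ∂P := by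
  have hle := pastSigma_le hN.chain.measurable t
  have hτ := hN.ergodic.1
  have hρ := hN.noise_nonneg
  have hτB : τ ≤ B := (Nat.le_mul_of_pos_right τ hm1).trans hmB
  have hB : 0 < B := hτ.trans_le hτB
  have hB' : (0 : ℝ) < B := by exact_mod_cast hB
  have hM0 : 0 < M := lt_of_lt_of_le (by norm_num) (hm 0 (Nat.zero_le _))
  have bx : BddMeas x := ⟨hx.mono hle, C, hxC⟩
  have bxf : BddMeas xf := ⟨hxf.mono hle, C, hxfC⟩
  have bxg : BddMeas xg := ⟨hxg.mono hle, C, hxgC⟩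
  have bw : BddMeas fun ω => (1 - β) • x ω + β • xg ω := (bx.const_smul _).add (bxg.const_smul _)
  have hw : StronglyMeasurable[pastSigma Z t] fun ω => (1 - β) • x ω + β • xg ω :=
    (hx.fun_const_smul (1 - β)).add (hxg.fun_const_smul β)
  have be : ∀ c, BddMeas fun ω => estimator (fun i => W (Z i ω)) M B t c (xg ω) - act Wt (xg ω) :=
    fun c => (hN.bddMeas_estimator hM0.le B t c bxg).sub (bxg.clm (act Wt))
  obtain ⟨cw, hcw⟩ := bw.2
  set V := ∫ ω, lyapunov Wt l (x ω) (xf ω) ∂P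
  set X := ∫ ω, ‖x ω‖ ^ 2 ∂P
  set Y := ∫ ω, ‖xg ω‖ ^ 2 ∂P with hY
  have hX0 : 0 ≤ X := integral_nonneg fun ω => by positivity
  have hY0 : 0 ≤ Y := integral_nonneg fun ω => by positivity
  have hstep : ∀ c ≤ m, ∫ ω, lyapunov Wt l
        ((1 - β) • x ω + β • xg ω
          - (3 * β / l) • estimator (fun i => W (Z i ω)) M B t c (xg ω))
        (xg ω - (3 * β ^ 2 / l) • estimator (fun i => W (Z i ω)) M B t c (xg ω)) ∂P
      ≤ ((1 - β / 4) * V - 3 / 4 * β * X - 2 * β * Y)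
        + -(6 * β / l) * ∫ ω, inner ℝ ((1 - β) • x ω + β • xg ω)
          (estimator (fun i => W (Z i ω)) M B t c (xg ω) - act Wt (xg ω)) ∂P
        + 36 * (β ^ 2 / l ^ 2)
          * ∫ ω, ‖estimator (fun i => W (Z i ω)) M B t c (xg ω) - act Wt (xg ω)‖ ^ 2 ∂P := by
    intro c _
    have bg := hN.bddMeas_estimator hM0.le B t c bxg
    have i1 := (bx.lyapunov bxf Wt l).const_mul (1 - β / 4)
    have i2 := bx.norm_sq.const_mul (3 / 4 * β)
    have i3 := bxg.norm_sq.const_mul (2 * β)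
    have i4 := (bw.inner (be c)).const_mul (6 * β / l)
    have i5 := (be c).norm_sq.const_mul (36 * (β ^ 2 / l ^ 2))
    have hmono := integral_mono (μ := P)
      (((bw.sub (bg.const_smul (3 * β / l))).lyapunov
        (bxg.sub (bg.const_smul (3 * β ^ 2 / l))) Wt l).integrable)
      ((((i1.sub i2).sub i3).sub i4).add i5).integrable
      (fun ω => lyapunov_step_le hN.mean_posSemidef.isHermitian hl hβ hβ1 hβL
        (inner_act_nonneg hN.mean_posSemidef) hL
        (estimator (fun i => W (Z i ω)) M B t c (xg ω)) (hrel ω) (hconv ω))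
    refine hmono.trans (le_of_eq ?_)
    rw [integral_add (((i1.sub i2).sub i3).sub i4).integrable i5.integrable,
      integral_sub ((i1.sub i2).sub i3).integrable i4.integrable,
      integral_sub (i1.sub i2).integrable i3.integrable,
      integral_sub i1.integrable i2.integrable]
    simp_rw [integral_const_mul]
    ring
  refine (levelMean_le_levelMean hstep).trans ?_
  rw [levelMean_affine]
  have hbias := hN.abs_levelMean_bias_le hB hm hM0 hM hτB t hw hxg hcw hxgC
  have hvar := hN.levelMean_variance_le hB hm t hxg hxgC
  set bias := levelMean m (fun c => ∫ ω, inner ℝ ((1 - β) • x ω + β • xg ω)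
          (estimator (fun i => W (Z i ω)) M B t c (xg ω) - act Wt (xg ω)) ∂P)
  set var := levelMean m (fun c =>
    ∫ ω, ‖estimator (fun i => W (Z i ω)) M B t c (xg ω) - act Wt (xg ω)‖ ^ 2 ∂P)
  -- `‖w‖ ‖x_g‖ ≤ (‖x‖ + ‖x_g‖) ‖x_g‖`
  have hwY : ∫ ω, ‖(1 - β) • x ω + β • xg ω‖ * ‖xg ω‖ ∂P ≤ 1 / 2 * X + 3 / 2 * Y := by
    have hi := (bx.norm_sq.const_mul (1 / 2)).add (bxg.norm_sq.const_mul (3 / 2))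
    calc _ ≤ ∫ ω, (1 / 2 * ‖x ω‖ ^ 2 + 3 / 2 * ‖xg ω‖ ^ 2) ∂P := by
          refine integral_mono (bw.norm.mul bxg.norm).integrable hi.integrable fun ω => ?_
          have h1 : ‖(1 - β) • x ω + β • xg ω‖ ≤ ‖x ω‖ + ‖xg ω‖ := by
            refine (norm_add_le _ _).trans (add_le_add ?_ ?_)
            · rw [norm_smul, Real.norm_of_nonneg (by linarith)]
              nlinarith [norm_nonneg (x ω)]
            · rw [norm_smul, Real.norm_of_nonneg hβ.le]
              nlinarith [norm_nonneg (xg ω)]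
          have h2 := mul_le_mul_of_nonneg_right h1 (norm_nonneg (xg ω))
          dsimp only
          nlinarith [sq_nonneg (‖x ω‖ - ‖xg ω‖)]
      _ = _ := by
        rw [integral_add (bx.norm_sq.const_mul (1 / 2)).integrable
          (bxg.norm_sq.const_mul (3 / 2)).integrable, integral_const_mul, integral_const_mul]
  -- `(ρ / (l M))² ≤ 2 β ρ² / l² ≤ 1 / 6000`
  have hr : ρ / (l * M) ≤ 1 / 64 := by
    have h1 : (ρ / (l * M)) ^ 2 ≤ (1 / 64) ^ 2 := by
      rw [div_pow, div_le_iff₀ (by positivity)]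
      have h2 : ρ ^ 2 ≤ ρ ^ 2 * (2 * β * M ^ 2) := le_mul_of_one_le_right (by positivity) hβM
      have h3 := mul_le_mul_of_nonneg_right hβρ (by positivity : 0 ≤ M ^ 2)
      have h4 : 0 ≤ l ^ 2 * M ^ 2 := by positivity
      nlinarith
    exact le_of_sq_le_sq h1 (by norm_num)
  have hb1 : -(6 * β / l) * bias ≤ β * (1 / 2) * (1 / 2 * X + 3 / 2 * Y) := by
    calc -(6 * β / l) * bias ≤ 6 * β / l * |bias| := by
          have := mul_le_mul_of_nonneg_left (neg_abs_le bias) (by positivity : 0 ≤ 6 * β / l)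
          linarith
      _ ≤ 6 * β / l * (16 / 3 * (ρ / M) * (1 / 2 * X + 3 / 2 * Y)) := by
          refine mul_le_mul_of_nonneg_left (hbias.trans ?_) (by positivity)
          exact mul_le_mul_of_nonneg_left hwY (by positivity)
      _ = β * (32 * (ρ / (l * M))) * (1 / 2 * X + 3 / 2 * Y) := by
          field_simp; ring
      _ ≤ _ := by
          refine mul_le_mul_of_nonneg_right (mul_le_mul_of_nonneg_left ?_ hβ.le) (by positivity)
          linarith
  have hv1 : 36 * (β ^ 2 / l ^ 2) * var ≤ β * (1 / 2) * Y := by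
    have h1 : (14 + 12 * (m : ℝ)) * (16 / 3 * ρ ^ 2 * τ / B * Y) ≤ 416 / 3 * ρ ^ 2 * Y := by
      have h2 : (14 + 12 * (m : ℝ)) ≤ 26 * m := by
        have : (1 : ℝ) ≤ m := by exact_mod_cast hm1
        linarith
      have h3 : (τ : ℝ) * m / B ≤ 1 := by
        rw [div_le_one hB']; exact_mod_cast hmB
      calc _ ≤ 26 * (m : ℝ) * (16 / 3 * ρ ^ 2 * τ / B * Y) :=
            mul_le_mul_of_nonneg_right h2 (by positivity)
        _ = 416 / 3 * ρ ^ 2 * Y * (τ * m / B) := by ring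
        _ ≤ 416 / 3 * ρ ^ 2 * Y * 1 := mul_le_mul_of_nonneg_left h3 (by positivity)
        _ = _ := by ring
    calc 36 * (β ^ 2 / l ^ 2) * var ≤ 36 * (β ^ 2 / l ^ 2) * (416 / 3 * ρ ^ 2 * Y) :=
          mul_le_mul_of_nonneg_left (hvar.trans h1) (by positivity)
      _ = β * Y * (4992 * (β * ρ ^ 2) / l ^ 2) := by ring
      _ ≤ β * Y * (1 / 2) := by
          refine mul_le_mul_of_nonneg_left ?_ (by positivity)
          rw [div_le_iff₀ (by positivity)]
          have : 0 ≤ β * ρ ^ 2 := by positivity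
          linarith
      _ = _ := by ring
  have p1 := mul_nonneg hβ.le hX0
  have p2 := mul_nonneg hβ.le hY0
  linarith

end OneStep

/-! ### Averaging over the seed -/

section Seed

variable {Ω S : Type*} [MeasurableSpace Ω] [MeasurableSpace S] {P : Measure Ω}
  {Z : ℕ → Ω → S} {J : ℕ → Ω → ℕ}

/-- The sequence with the given first `k` values, extended by `0`. -/
def extendSeed {k : ℕ} (a : Fin k → ℕ) : ℕ → ℕ := fun i => if h : i < k then a ⟨i, h⟩ else 0

theorem extendSeed_apply (j : ℕ → ℕ) {k i : ℕ} (hi : i < k) :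
    extendSeed (fun i : Fin k => j i) i = j i := by
  simp [extendSeed, hi]

theorem IsGeometricSeed.stronglyMeasurable_comp (hJ : IsGeometricSeed P Z J) {k : ℕ}
    {G : (ℕ → ℕ) → ℝ} (hG : ∀ j j', (∀ i < k, j i = j' i) → G j = G j') :
    StronglyMeasurable fun ω => G fun i => J i ω := by
  have h1 : (fun ω => G fun i => J i ω)
      = (fun a : Fin k → ℕ => G (extendSeed a)) ∘ fun ω (i : Fin k) => J i ω := by
    funext ω
    exact hG _ _ fun i hi => (extendSeed_apply (fun i => J i ω) hi).symm
  rw [h1]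
  exact ((measurable_of_countable fun a : Fin k → ℕ => G (extendSeed a)).comp
    (measurable_pi_lambda (fun ω (i : Fin k) => J i ω) fun i => hJ.measurable i)).stronglyMeasurable

theorem IsGeometricSeed.integral_ite_mul (hJ : IsGeometricSeed P Z J) {k a : ℕ} (ha : 1 ≤ a)
    {G : (ℕ → ℕ) → ℝ} (hG : ∀ j j', (∀ i < k, j i = j' i) → G j = G j') :
    ∫ ω, (if J k ω = a then (1 : ℝ) else 0) * G (fun i => J i ω) ∂P
      = (1 / 2 : ℝ) ^ a * ∫ ω, G (fun i => J i ω) ∂P := by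
  have hind := hJ.iIndep.indepFun_finset {k} (Finset.range k) (by simp) hJ.measurable
  have hind2 : IndepFun (fun ω => if J k ω = a then (1 : ℝ) else 0)
      (fun ω => G fun i => J i ω) P := by
    have h1 : (fun ω => G fun i => J i ω) = (fun b : ↥(Finset.range k) → ℕ =>
        G fun i => if h : i ∈ Finset.range k then b ⟨i, h⟩ else 0) ∘
        fun ω (i : ↥(Finset.range k)) => J i ω := by
      funext ω
      refine hG _ _ fun i hi => ?_
      simp [hi]
    rw [h1]
    exact hind.comp (φ := fun b : ↥({k} : Finset ℕ) → ℕ =>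
      if b ⟨k, by simp⟩ = a then (1 : ℝ) else 0) (measurable_of_countable _)
      (measurable_of_countable _)
  have hs : MeasurableSet {ω | J k ω = a} := hJ.measurable k (measurableSet_singleton a)
  have hite : StronglyMeasurable fun ω => if J k ω = a then (1 : ℝ) else 0 :=
    StronglyMeasurable.ite hs stronglyMeasurable_const stronglyMeasurable_const
  have h2 := hind2.integral_mul_eq_mul_integral hite.aestronglyMeasurable
    (hJ.stronglyMeasurable_comp hG).aestronglyMeasurable
  have h3 : ∫ ω, (if J k ω = a then (1 : ℝ) else 0) ∂P = (1 / 2 : ℝ) ^ a := by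
    have : (fun ω => if J k ω = a then (1 : ℝ) else 0)
        = {ω | J k ω = a}.indicator fun _ => (1 : ℝ) := by
      funext ω; simp [Set.indicator]
    rw [this, integral_indicator hs, setIntegral_const, smul_eq_mul, mul_one, hJ.law k a ha]
  rw [← h3, ← h2]
  rfl

variable [IsProbabilityMeasure P]

/-- Independence of the seed and the network, as Fubini's theorem: the network may be averaged
out with the seed held fixed. -/
theorem IsGeometricSeed.integral_eq_integral_integral (hJ : IsGeometricSeed P Z J)
    (hZ : ∀ k, Measurable (Z k)) {k : ℕ} {Φ : (ℕ → ℕ) → (ℕ → S) → ℝ}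
    (hΦ : ∀ j j', (∀ i < k, j i = j' i) → Φ j = Φ j') (hm : ∀ j, StronglyMeasurable (Φ j))
    {C : ℝ} (hC : ∀ j ω, |Φ j (fun i => Z i ω)| ≤ C) :
    BddMeas (fun ω => Φ (fun i => J i ω) fun i => Z i ω) ∧
    ∫ ω, Φ (fun i => J i ω) (fun i => Z i ω) ∂P
      = ∫ ω, ∫ ω', Φ (fun i => J i ω) (fun i => Z i ω') ∂P ∂P := by
  set Jk : Ω → Fin k → ℕ := fun ω i => J i ω with hJk
  set Zs : Ω → ℕ → S := fun ω i => Z i ω with hZs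
  have hJm : Measurable Jk := measurable_pi_lambda _ fun i => hJ.measurable i
  have hZm : Measurable Zs := measurable_pi_lambda _ fun i => hZ i
  have hind : IndepFun Jk Zs P :=
    hJ.indep.comp (φ := fun j (i : Fin k) => j i) (ψ := id)
      (measurable_pi_lambda _ fun i => measurable_pi_apply _) measurable_id
  have heq := (indepFun_iff_map_prod_eq_prod_map_map hJm.aemeasurable hZm.aemeasurable).1 hind
  set Ψ : (Fin k → ℕ) × (ℕ → S) → ℝ := fun p => Φ (extendSeed p.1) p.2 with hΨ
  have hΨm : StronglyMeasurable Ψ :=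
    (measurable_from_prod_countable_right fun a =>
      (hm (extendSeed a)).measurable).stronglyMeasurable
  have hΨJ : ∀ ω, Φ (fun i => J i ω) = fun z => Ψ (Jk ω, z) := fun ω =>
    hΦ _ _ fun i hi => (extendSeed_apply (fun i => J i ω) hi).symm
  have hmeas : StronglyMeasurable fun ω => Ψ (Jk ω, Zs ω) :=
    hΨm.comp_measurable (hJm.prodMk hZm)
  simp_rw [hΨJ]
  refine ⟨⟨hmeas, C, fun ω => hC _ ω⟩, ?_⟩
  have hint : Integrable Ψ ((P.map Jk).prod (P.map Zs)) := by
    rw [← heq, integrable_map_measure hΨm.aestronglyMeasurable (hJm.prodMk hZm).aemeasurable]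
    exact integrable_of_bounded hmeas (C := C) fun ω => hC _ ω
  have h1 : ∫ ω, Ψ (Jk ω, Zs ω) ∂P = ∫ p, Ψ p ∂((P.map Jk).prod (P.map Zs)) := by
    rw [← heq, integral_map (hJm.prodMk hZm).aemeasurable hΨm.aestronglyMeasurable]
  change ∫ ω, Ψ (Jk ω, Zs ω) ∂P = _
  have hmJ := Measure.isProbabilityMeasure_map (μ := P) hJm.aemeasurable
  have hmZ := Measure.isProbabilityMeasure_map (μ := P) hZm.aemeasurable
  rw [h1, integral_prod _ hint, integral_map hJm.aemeasurable
    hint.integral_prod_left.aestronglyMeasurable]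
  refine integral_congr_ae (Filter.Eventually.of_forall fun ω => ?_)
  exact integral_map hZm.aemeasurable
    (hΨm.comp_measurable measurable_prodMk_left).aestronglyMeasurable

/-- If all levels outside `{1, …, m}` act like level `0`, averaging over the seed of the current
iteration is taking the `levelMean`. -/
theorem IsGeometricSeed.integral_eq_integral_levelMean (hJ : IsGeometricSeed P Z J) {k m : ℕ}
    {G : (ℕ → ℕ) → ℝ} (hG : ∀ j j', (∀ i < k + 1, j i = j' i) → G j = G j') {C : ℝ}
    (hC : ∀ j, |G j| ≤ C)
    (h0 : ∀ j, j k ∉ Finset.Icc 1 m → G j = G (Function.update j k 0)) :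
    ∫ ω, G (fun i => J i ω) ∂P
      = ∫ ω, levelMean m (fun c => G (Function.update (fun i => J i ω) k c)) ∂P := by
  have hG' : ∀ c j j', (∀ i < k, j i = j' i) →
      G (Function.update j k c) = G (Function.update j' k c) := fun c j j' h =>
    hG _ _ fun i hi => by
      rcases eq_or_ne i k with rfl | hne
      · simp
      · simp [hne, h i (by omega)]
  have hI : ∀ c, Integrable (fun ω => G (Function.update (fun i => J i ω) k c)) P := fun c =>
    integrable_of_bounded (hJ.stronglyMeasurable_comp (G := fun j => G (Function.update j k c))
      (hG' c)) (C := C) fun ω => hC _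
  have hdec : ∀ j, G j = G (Function.update j k 0) + ∑ c ∈ Finset.Icc 1 m,
      (if j k = c then (1 : ℝ) else 0)
        * (G (Function.update j k c) - G (Function.update j k 0)) := by
    intro j
    by_cases h : j k ∈ Finset.Icc 1 m
    · rw [Finset.sum_eq_single_of_mem _ h fun c _ hc => by rw [if_neg (Ne.symm hc), zero_mul],
        if_pos rfl, Function.update_eq_self]
      ring
    · rw [Finset.sum_eq_zero fun c hc => by
        rw [if_neg (fun h' : j k = c => h (h' ▸ hc)), zero_mul], add_zero, h0 j h]
  have hI2 : ∀ c, Integrable (fun ω => (if J k ω = c then (1 : ℝ) else 0)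
      * (G (Function.update (fun i => J i ω) k c) - G (Function.update (fun i => J i ω) k 0))) P :=
    fun c => by
      have hs : MeasurableSet {ω | J k ω = c} := hJ.measurable k (measurableSet_singleton c)
      have := ((hI c).sub (hI 0)).indicator hs
      refine this.congr (Filter.Eventually.of_forall fun ω => ?_)
      simp only [Set.indicator, Set.mem_ofPred_eq, Pi.sub_apply, ite_mul, one_mul, zero_mul]
  calc ∫ ω, G (fun i => J i ω) ∂P
      = ∫ ω, (G (Function.update (fun i => J i ω) k 0) + ∑ c ∈ Finset.Icc 1 m,
        (if J k ω = c then (1 : ℝ) else 0) * (G (Function.update (fun i => J i ω) k c)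
          - G (Function.update (fun i => J i ω) k 0))) ∂P :=
        integral_congr_ae (Filter.Eventually.of_forall fun ω => hdec _)
    _ = _ := by
      have hI3 : ∀ c, Integrable (fun ω => (1 / 2 : ℝ) ^ c *
          (G (Function.update (fun i => J i ω) k c)
            - G (Function.update (fun i => J i ω) k 0))) P := fun c =>
        ((hI c).sub (hI 0)).const_mul _
      unfold levelMean
      rw [integral_add (hI 0) (integrable_finsetSum _ fun c _ => hI2 c),
        integral_finsetSum _ fun c _ => hI2 c,
        integral_add (hI 0) (integrable_finsetSum _ fun c _ => hI3 c),
        integral_finsetSum _ fun c _ => hI3 c]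
      congr 1
      refine Finset.sum_congr rfl fun c hc => ?_
      rw [integral_const_mul]
      exact hJ.integral_ite_mul (Finset.mem_Icc.1 hc).1
        (G := fun j => G (Function.update j k c) - G (Function.update j k 0))
        fun j j' h => by rw [hG' c j j' h, hG' 0 j j' h]

end Seed

/-! ### Linear convergence in expectation -/

section Parameters

/-- The largest level `m` with `2 ^ m ≤ M`, for `1 ≤ M`. -/
noncomputable def topLevel (M : ℝ) : ℕ := Nat.log 2 ⌊M⌋₊

theorem two_pow_le_iff_le_topLevel {M : ℝ} (hM : 2 ≤ M) (c : ℕ) :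
    (2 : ℝ) ^ c ≤ M ↔ c ≤ topLevel M := by
  have hf : 2 ≤ ⌊M⌋₊ := Nat.le_floor (by exact_mod_cast hM)
  unfold topLevel
  rw [Nat.le_log_iff_pow_le (by norm_num) (by omega), Nat.le_floor_iff (by linarith)]
  push_cast
  rfl

theorem one_le_topLevel {M : ℝ} (hM : 2 ≤ M) : 1 ≤ topLevel M :=
  (two_pow_le_iff_le_topLevel hM 1).1 (by simpa using hM)

theorem le_two_pow_topLevel_succ {M : ℝ} (hM : 2 ≤ M) : M ≤ 2 ^ (topLevel M + 1) := by
  by_contra! h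
  have := (two_pow_le_iff_le_topLevel hM _).1 h.le
  omega

theorem topLevel_le_logb {M : ℝ} (hM : 2 ≤ M) : (topLevel M : ℝ) ≤ Real.logb 2 M := by
  rw [Real.le_logb_iff_rpow_le (by norm_num) (by linarith), Real.rpow_natCast]
  exact (two_pow_le_iff_le_topLevel hM _).2 le_rfl

theorem two_le_params_M (l γ : ℝ) (b : ℕ) : 2 ≤ (params l γ b).M := le_max_left _ _

theorem one_le_two_mul_beta_mul_params_M_sq {l γ : ℝ} (hl : 0 < l) (hγ : 0 < γ) (b : ℕ) :
    1 ≤ 2 * (params l γ b).β * (params l γ b).M ^ 2 := by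
  have hβ := params_beta_pos hl hγ b
  have hM : Real.sqrt ((1 / 4) * (1 + 2 / (params l γ b).β)) ≤ (params l γ b).M := le_max_right _ _
  set β := (params l γ b).β
  have h1 := pow_le_pow_left₀ (Real.sqrt_nonneg _) hM 2
  rw [Real.sq_sqrt (by positivity)] at h1
  have h2 := mul_le_mul_of_nonneg_left h1 (by positivity : 0 ≤ 2 * β)
  have h3 : 2 * β * ((1 / 4) * (1 + 2 / β)) = β / 2 + 1 := by field_simp; ring
  linarith

theorem mul_topLevel_le_params_B (l γ : ℝ) (b : ℕ) :
    b * topLevel (params l γ b).M ≤ (params l γ b).B := by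
  have h : ((b * topLevel (params l γ b).M : ℕ) : ℝ) ≤ b * Real.logb 2 (params l γ b).M := by
    push_cast
    exact mul_le_mul_of_nonneg_left (topLevel_le_logb (two_le_params_M _ _ _)) (by positivity)
  exact_mod_cast h.trans (Nat.le_ceil _)

theorem params_beta_lt {l L γ : ℝ} (hl : 0 < l) (hlL : l ≤ L) (hγ : 0 < γ)
    (h : γ * (4 * L) < 3) (b : ℕ) : (params l γ b).β < 1 / 4 := by
  have h1 := params_beta_sq hl hγ b
  have h2 : l * γ ≤ L * γ := mul_le_mul_of_nonneg_right hlL hγ.le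
  refine lt_of_pow_lt_pow_left₀ 2 (by norm_num) ?_
  rw [h1]; linarith

theorem params_beta_sq_mul_le {l L γ : ℝ} (hl : 0 < l) (hγ : 0 < γ)
    (h : γ * (4 * L) < 3) (b : ℕ) : (params l γ b).β ^ 2 * L ≤ l / 16 := by
  rw [params_beta_sq hl hγ b]
  have := mul_le_mul_of_nonneg_left h.le hl.le
  linarith

/-- The second restriction on the step size says that `β` is small against `l² / ρ²`. -/
theorem params_beta_mul_noise_sq_le {l γ ρ : ℝ} (hl : 0 < l) (hγ : 0 < γ) {τ : ℕ} (hτ : 0 < τ)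
    (h : γ * (1800 * ρ ^ 2 * ((τ : ℝ) / τ + (τ : ℝ) ^ 2 / (τ : ℝ) ^ 2)) ^ 2 < l ^ 3) :
    12000 * ((params l γ τ).β * ρ ^ 2) ≤ l ^ 2 := by
  have hτ' : (τ : ℝ) ≠ 0 := by positivity
  have hβ := params_beta_pos hl hγ τ
  rw [div_self hτ', div_self (pow_ne_zero 2 hτ')] at h
  have h1 := mul_lt_mul_of_pos_left h hl
  refine le_of_sq_le_sq ?_ (by positivity)
  have h2 : (12000 * ((params l γ τ).β * ρ ^ 2)) ^ 2
      = 12000 ^ 2 * (params l γ τ).β ^ 2 * ρ ^ 4 := by ring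
  rw [h2, params_beta_sq hl hγ]
  -- the hypothesis reads `l γ (3600 ρ²)² < l⁴`, and `12000² / 12 ≤ 3600²`
  have h3 : 0 ≤ l * γ * ρ ^ 4 := by positivity
  nlinarith

end Parameters

section Contraction

theorem estimator_eq_of_not_mem {n : ℕ} (w : ℕ → Matrix (Fin n) (Fin n) ℝ) {M : ℝ} (hM : 2 ≤ M)
    (B t : ℕ) {c : ℕ} (hc : c ∉ Finset.Icc 1 (topLevel M)) (y : EuclideanSpace ℝ (Fin n)) :
    estimator w M B t c y = estimator w M B t 0 y := by
  rcases Nat.eq_zero_or_pos c with rfl | h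
  · rfl
  · have h1 : ¬ (2 : ℝ) ^ c ≤ M := fun h' =>
      hc (Finset.mem_Icc.2 ⟨h, (two_pow_le_iff_le_topLevel hM c).1 h'⟩)
    unfold estimator
    rw [if_neg h1]
    simp

theorem lamMin_nonneg {n : ℕ} (A : Matrix (Fin n) (Fin n) ℝ) : 0 ≤ lamMin A :=
  Real.sInf_nonneg fun _ h => h.2.le

theorem norm_sq_le_lyapunov {n : ℕ} {A : Matrix (Fin n) (Fin n) ℝ} (hA : A.PosSemidef) {l : ℝ}
    (hl : 0 ≤ l) (x xf : EuclideanSpace ℝ (Fin n)) : ‖x‖ ^ 2 ≤ lyapunov A l x xf :=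
  le_add_of_nonneg_right (mul_nonneg (by positivity) (inner_act_nonneg hA xf))

/-- The sum of the coordinates. -/
noncomputable def coordSum (n : ℕ) : EuclideanSpace ℝ (Fin n) →ₗ[ℝ] ℝ :=
  ∑ i, (EuclideanSpace.proj (𝕜 := ℝ) i).toLinearMap

theorem coordSum_apply {n : ℕ} (x : EuclideanSpace ℝ (Fin n)) : coordSum n x = ∑ i, x i := by
  simp [coordSum]

theorem coordSum_act {n : ℕ} {A : Matrix (Fin n) (Fin n) ℝ} (hA : Matrix.vecMul 1 A = 0)
    (x : EuclideanSpace ℝ (Fin n)) : coordSum n (act A x) = 0 := by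
  rw [coordSum_apply]
  simp_rw [act_apply]
  rw [Finset.sum_comm]
  refine Finset.sum_eq_zero fun j _ => ?_
  rw [← Finset.sum_mul]
  have := congrFun hA j
  simp only [Matrix.vecMul, dotProduct, Pi.one_apply, one_mul, Pi.zero_apply] at this
  rw [this, zero_mul]

/-- The Lyapunov function along the run on a fixed network path `z` with a fixed seed `j`. -/
noncomputable def runLyapunov {n : ℕ} {S : Type*} (W : S → Matrix (Fin n) (Fin n) ℝ)
    (Wt : Matrix (Fin n) (Fin n) ℝ) (q : Params) (x0 : EuclideanSpace ℝ (Fin n)) (k : ℕ)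
    (j : ℕ → ℕ) (z : ℕ → S) : ℝ :=
  lyapunov Wt (lamMin Wt) (run q (fun t => W (z t)) j x0 k).x (run q (fun t => W (z t)) j x0 k).xf

theorem runLyapunov_congr {n : ℕ} {S : Type*} {W : S → Matrix (Fin n) (Fin n) ℝ}
    {Wt : Matrix (Fin n) (Fin n) ℝ} (q : Params) (x0 : EuclideanSpace ℝ (Fin n)) {k : ℕ}
    {j j' : ℕ → ℕ}
    (h : ∀ i < k, j i = j' i) :
    runLyapunov W Wt q x0 k j = runLyapunov W Wt q x0 k j' := by
  funext z
  unfold runLyapunov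
  rw [run_congr q _ x0 h]

variable {n : ℕ} {Ω S : Type*} [MeasurableSpace Ω] [MeasurableSpace S] {P : Measure Ω}
  {Z : ℕ → Ω → S} {Q : Kernel S S} [IsMarkovKernel Q] {π : Measure S}
  {graph : S → SimpleGraph (Fin n)} {W : S → Matrix (Fin n) (Fin n) ℝ}
  {Wt : Matrix (Fin n) (Fin n) ℝ} {τ : ℕ} {ρ γ : ℝ} {J : ℕ → Ω → ℕ}

theorem NetworkAssumptions.stronglyMeasurable_runLyapunov
    (hN : NetworkAssumptions P Z Q π graph W Wt τ ρ) (q : Params)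
    (x0 : EuclideanSpace ℝ (Fin n)) (k : ℕ) (j : ℕ → ℕ) :
    StronglyMeasurable (runLyapunov W Wt q x0 k j) := by
  obtain ⟨h1, h2⟩ := stronglyMeasurable_run (fun _ => (inferInstance : MeasurableSpace (ℕ → S)))
    monotone_const (w := fun t z => W (z t))
    (fun t a b => (hN.measurable a b).comp (measurable_pi_apply t)) q j x0 k
  exact (h1.norm.pow 2).add
    (stronglyMeasurable_const.mul (h2.inner ((act Wt).continuous.comp_stronglyMeasurable h2)))

theorem NetworkAssumptions.exists_abs_runLyapunov_le
    (hN : NetworkAssumptions P Z Q π graph W Wt τ ρ) (q : Params) (hM : 0 ≤ q.M)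
    (x0 : EuclideanSpace ℝ (Fin n)) (k : ℕ) :
    ∃ C, ∀ j z, |runLyapunov W Wt q x0 k j z| ≤ C := by
  obtain ⟨C, hC⟩ := exists_norm_run_le q hM (ρ + ‖act Wt‖) x0 k
  refine ⟨C ^ 2 + |12 / lamMin Wt| * (C * (‖act Wt‖ * C)), fun j z => ?_⟩
  obtain ⟨h1, h2⟩ := hC (fun t => W (z t)) (fun t => hN.norm_act_le _) j
  unfold runLyapunov lyapunov
  refine (abs_add_le _ _).trans (add_le_add ?_ ?_)
  · rw [abs_of_nonneg (by positivity)]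
    exact pow_le_pow_left₀ (norm_nonneg _) h1 2
  · rw [abs_mul]
    refine mul_le_mul_of_nonneg_left ((abs_real_inner_le_norm _ _).trans ?_) (abs_nonneg _)
    exact mul_le_mul h2 ((act Wt).le_opNorm_of_le h2) (norm_nonneg _)
      ((norm_nonneg _).trans h2)

variable [IsProbabilityMeasure P]

/-- Contraction for a fixed past seed `j`: the time counter is then deterministic, and only the
network and the current level are averaged out. -/
theorem NetworkAssumptions.levelMean_runLyapunov_le (hn : 2 ≤ n)
    (hN : NetworkAssumptions P Z Q π graph W Wt τ ρ) (hγ : AdmissibleStep Wt ρ τ τ γ)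
    {x0 : EuclideanSpace ℝ (Fin n)} (hx0 : ∑ i, x0 i = 0) (k : ℕ) (j : ℕ → ℕ) :
    levelMean (topLevel (params (lamMin Wt) γ τ).M) (fun c => ∫ ω, runLyapunov W Wt
        (params (lamMin Wt) γ τ) x0 (k + 1) (Function.update j k c) (fun t => Z t ω) ∂P)
      ≤ (1 - (params (lamMin Wt) γ τ).β / 4) * ∫ ω, runLyapunov W Wt (params (lamMin Wt) γ τ) x0 k
        j (fun t => Z t ω) ∂P := by
  obtain ⟨Gt, -, hGt⟩ := hN.mean_gossip
  obtain ⟨hl, hlL⟩ := lamMin_pos_and_le hn hN.mean_posSemidef hGt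
  obtain ⟨hγ0, hγ1, hγ2⟩ := hγ
  have hM := two_le_params_M (lamMin Wt) γ τ
  have hβ := params_beta_pos hl hγ0 τ
  have hβ4 := params_beta_lt hl hlL hγ0 hγ1 τ
  have hβ1 : (params (lamMin Wt) γ τ).β < 1 := by linarith
  obtain ⟨C, hC⟩ := exists_norm_run_le (params (lamMin Wt) γ τ) (by linarith) (ρ + ‖act Wt‖) x0 k
  have hx := stronglyMeasurable_run (pastSigma Z) (fun _ _ h => pastSigma_mono Z h)
    (w := fun t ω => W (Z t ω))
    (fun t a b => (hN.measurable a b).comp (measurable_pastSigma Z le_rfl))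
    (params (lamMin Wt) γ τ) j x0 k
  have hzero := fun ω => map_run_eq_zero (params (lamMin Wt) γ τ) (w := fun t => W (Z t ω)) j
    (coordSum n) (fun t y => coordSum_act (hN.sum_preserving _) y)
    (by rw [coordSum_apply, hx0]) k
  have hrunT := fun ω => run_T (params (lamMin Wt) γ τ) (fun t => W (Z t ω)) j x0 k
  have hupd : ∀ c z, runLyapunov W Wt (params (lamMin Wt) γ τ) x0 (k + 1)
      (Function.update j k c) z = lyapunov Wt (lamMin Wt)
        (step (params (lamMin Wt) γ τ) (fun t => W (z t)) c
          (run (params (lamMin Wt) γ τ) (fun t => W (z t)) j x0 k)).x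
        (step (params (lamMin Wt) γ τ) (fun t => W (z t)) c
          (run (params (lamMin Wt) γ τ) (fun t => W (z t)) j x0 k)).xf := by
    intro c z
    have h1 : run (params (lamMin Wt) γ τ) (fun t => W (z t)) (Function.update j k c) x0 k
        = run (params (lamMin Wt) γ τ) (fun t => W (z t)) j x0 k :=
      run_congr _ _ _ fun i hi => Function.update_of_ne (by omega) _ _
    unfold runLyapunov
    simp only [run, h1, Function.update_self]
  simp_rw [hupd, (step_eq hl hγ0 τ hβ1 _ _ _).1, (step_eq hl hγ0 τ hβ1 _ _ _).2, hrunT]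
  set q := params (lamMin Wt) γ τ with hq
  have hxgm : StronglyMeasurable[pastSigma Z (∑ i ∈ Finset.range k, 2 ^ j i * q.B)]
      fun ω => extrap q (run q (fun t => W (Z t ω)) j x0 k) :=
    (hx.2.fun_const_smul q.θ).add (hx.1.fun_const_smul (1 - q.θ))
  have hR := fun ω => hC (fun t => W (Z t ω)) (fun t => hN.norm_act_le _) j
  have hC0 : 0 ≤ C := by
    obtain ⟨ω⟩ := nonempty_of_isProbabilityMeasure P
    exact (norm_nonneg _).trans (hR ω).1
  have hxgC : ∀ ω, ‖extrap q (run q (fun t => W (Z t ω)) j x0 k)‖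
      ≤ |q.θ| * C + |1 - q.θ| * C := fun ω => by
    refine norm_add_le_of_le ?_ ?_
    · rw [norm_smul]; exact mul_le_mul_of_nonneg_left (hR ω).2 (abs_nonneg _)
    · rw [norm_smul]; exact mul_le_mul_of_nonneg_left (hR ω).1 (abs_nonneg _)
  refine hN.levelMean_lyapunov_le (one_le_topLevel hM)
    (fun c hc => (two_pow_le_iff_le_topLevel hM c).2 hc) (le_two_pow_topLevel_succ hM)
    (mul_topLevel_le_params_B _ _ _) hl hβ hβ1 (params_beta_sq_mul_le hl hγ0 hγ1 τ)
    (params_beta_mul_noise_sq_le hl hγ0 hN.ergodic.1 hγ2)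
    (one_le_two_mul_beta_mul_params_M_sq hl hγ0 τ)
    (inner_act_le hN.mean_posSemidef.isHermitian) _ hx.1 hx.2 hxgm
    (C := max C (|q.θ| * C + |1 - q.θ| * C))
    (fun ω => (hR ω).1.trans (le_max_left _ _)) (fun ω => (hR ω).2.trans (le_max_left _ _))
    (fun ω => (hxgC ω).trans (le_max_right _ _)) (fun ω => extrap_eq hl hγ0 τ hβ1 _) fun ω => ?_
  refine lamMin_mul_le_inner_act hN.mean_posSemidef hGt _ ?_
  rw [← coordSum_apply]
  unfold extrap
  rw [map_add, map_smul, map_smul, (hzero ω).1, (hzero ω).2]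
  simp

/-- The expected Lyapunov function contracts by the factor `1 - β/4` in each iteration. -/
theorem NetworkAssumptions.integral_runLyapunov_succ_le (hn : 2 ≤ n)
    (hN : NetworkAssumptions P Z Q π graph W Wt τ ρ) (hJ : IsGeometricSeed P Z J)
    (hγ : AdmissibleStep Wt ρ τ τ γ)
    {x0 : EuclideanSpace ℝ (Fin n)} (hx0 : ∑ i, x0 i = 0) (k : ℕ) :
    ∫ ω, runLyapunov W Wt (params (lamMin Wt) γ τ) x0 (k + 1) (fun i => J i ω)
        (fun t => Z t ω) ∂P
      ≤ (1 - (params (lamMin Wt) γ τ).β / 4) * ∫ ω, runLyapunov W Wt (params (lamMin Wt) γ τ) x0 k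
        (fun i => J i ω) (fun t => Z t ω) ∂P := by
  have hM := two_le_params_M (lamMin Wt) γ τ
  have hstep := hN.levelMean_runLyapunov_le hn hγ hx0 k
  set q := params (lamMin Wt) γ τ with hq
  obtain ⟨C1, hC1⟩ := hN.exists_abs_runLyapunov_le q (by linarith) x0 (k + 1)
  obtain ⟨C0, hC0⟩ := hN.exists_abs_runLyapunov_le q (by linarith) x0 k
  have hfub := fun k C (hC : ∀ j z, |runLyapunov W Wt q x0 k j z| ≤ C) =>
    (hJ.integral_eq_integral_integral hN.chain.measurable
    (fun j j' h => runLyapunov_congr (W := W) (Wt := Wt) q x0 (k := k) h)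
    (fun j => hN.stronglyMeasurable_runLyapunov q x0 k j) (C := C) fun j ω => hC j _).2
  rw [hfub (k + 1) C1 hC1, hfub k C0 hC0]
  have hbd : ∀ k C, (∀ j z, |runLyapunov W Wt q x0 k j z| ≤ C) → ∀ j,
      |∫ ω, runLyapunov W Wt q x0 k j (fun t => Z t ω) ∂P| ≤ C := fun k C hC j => by
    have := norm_integral_le_of_norm_le_const (μ := P)
      (f := fun ω => runLyapunov W Wt q x0 k j (fun t => Z t ω)) (C := C)
      (Filter.Eventually.of_forall fun ω => hC j _)
    simpa using this
  have hcongr : ∀ k j j', (∀ i < k, j i = j' i) →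
      ∫ ω, runLyapunov W Wt q x0 k j (fun t => Z t ω) ∂P
        = ∫ ω, runLyapunov W Wt q x0 k j' (fun t => Z t ω) ∂P := fun k j j' h => by
    rw [runLyapunov_congr q x0 h]
  rw [hJ.integral_eq_integral_levelMean (m := topLevel q.M)
    (G := fun j => ∫ ω, runLyapunov W Wt q x0 (k + 1) j (fun t => Z t ω) ∂P)
    (hcongr (k + 1)) (hbd (k + 1) C1 hC1) ?_, ← integral_const_mul]
  · refine integral_mono_of_nonneg (Filter.Eventually.of_forall fun ω => ?_) ?_
      (Filter.Eventually.of_forall fun ω => hstep fun i => J i ω)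
    · have h := levelMean_le_levelMean (m := topLevel q.M) (φ := fun _ => (0 : ℝ))
        (ψ := fun c => ∫ ω', runLyapunov W Wt q x0 (k + 1)
          (Function.update (fun i => J i ω) k c) (fun t => Z t ω') ∂P)
        fun c _ => integral_nonneg fun ω' => (sq_nonneg _).trans
          (norm_sq_le_lyapunov hN.mean_posSemidef (lamMin_nonneg _) _ _)
      simpa [levelMean] using h
    · exact (integrable_of_bounded (hJ.stronglyMeasurable_comp (hcongr k)) (C := C0)
        fun ω => hbd k C0 hC0 _).const_mul _
  -- the levels outside `{1, …, topLevel M}` use the coarsest batch mean only; they differ in the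
  -- time counter, which the Lyapunov function does not see
  · intro j hj
    congr 1
    funext ω
    have h1 : run q (fun t => W (Z t ω)) (Function.update j k 0) x0 k
        = run q (fun t => W (Z t ω)) j x0 k :=
      run_congr _ _ _ fun i hi => Function.update_of_ne (by omega) _ _
    unfold runLyapunov
    simp only [run, h1, Function.update_self, step, estimator_eq_of_not_mem _ hM _ _ hj]

end Contraction

section Convergence

variable {n : ℕ} {Ω S : Type*} [MeasurableSpace Ω] [MeasurableSpace S] {P : Measure Ω}
  {Z : ℕ → Ω → S} {Q : Kernel S S} [IsMarkovKernel Q] {π : Measure S}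
  {graph : S → SimpleGraph (Fin n)} {W : S → Matrix (Fin n) (Fin n) ℝ}
  {Wt : Matrix (Fin n) (Fin n) ℝ} {τ : ℕ} {ρ γ : ℝ} {J : ℕ → Ω → ℕ}

theorem sum_sub_consensus (hn : 2 ≤ n) (x0 : EuclideanSpace ℝ (Fin n)) :
    ∑ i, (x0 - consensus x0) i = 0 := by
  have hn' : (n : ℝ) ≠ 0 := by positivity
  simp only [consensus, PiLp.sub_apply, Finset.sum_sub_distrib, Finset.sum_const,
    Finset.card_univ, Fintype.card_fin, nsmul_eq_mul]
  field_simp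
  ring

theorem IsGossip.act_consensus {G : SimpleGraph (Fin n)} {A : Matrix (Fin n) (Fin n) ℝ}
    (hA : IsGossip G A) (x0 : EuclideanSpace ℝ (Fin n)) : act A (consensus x0) = 0 := by
  have h := (hA.2 (consensus x0).ofLp).2 fun _ _ => rfl
  ext i
  exact congrFun h i

theorem sqError_eq (hN : NetworkAssumptions P Z Q π graph W Wt τ ρ) (q : Params)
    (x0 : EuclideanSpace ℝ (Fin n)) (k : ℕ) (ω : Ω) :
    sqError Z W J q x0 k ω
      = ‖(run q (fun t => W (Z t ω)) (fun i => J i ω) (x0 - consensus x0) k).x‖ ^ 2 := by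
  have h := (run_add_of_act_eq_zero q (w := fun t => W (Z t ω)) (fun i => J i ω)
    (x0 - consensus x0) (fun t => (hN.gossip _).act_consensus x0) k).1
  rw [sub_add_cancel] at h
  unfold sqError trajectory
  rw [h, add_sub_cancel_right]

variable [IsProbabilityMeasure P]

theorem NetworkAssumptions.integral_sqError_le (hn : 2 ≤ n)
    (hN : NetworkAssumptions P Z Q π graph W Wt τ ρ) (hJ : IsGeometricSeed P Z J)
    (hγ : AdmissibleStep Wt ρ τ τ γ) (x0 : EuclideanSpace ℝ (Fin n)) (k : ℕ) :
    Integrable (sqError Z W J (params (lamMin Wt) γ τ) x0 k) P ∧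
      ∫ ω, sqError Z W J (params (lamMin Wt) γ τ) x0 k ω ∂P
        ≤ (1 - (params (lamMin Wt) γ τ).β / 4) ^ k
          * ((1 + 12 * chi Wt) * ‖x0 - consensus x0‖ ^ 2) := by
  obtain ⟨Gt, -, hGt⟩ := hN.mean_gossip
  obtain ⟨hl, hlL⟩ := lamMin_pos_and_le hn hN.mean_posSemidef hGt
  have hβ4 := params_beta_lt hl hlL hγ.1 hγ.2.1 τ
  have hM := two_le_params_M (lamMin Wt) γ τ
  have hV := hN.integral_runLyapunov_succ_le hn hJ hγ (sum_sub_consensus hn x0)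
  have hfun : sqError Z W J (params (lamMin Wt) γ τ) x0 k = fun ω => ‖(run (params (lamMin Wt) γ τ)
      (fun t => W (Z t ω)) (fun i => J i ω) (x0 - consensus x0) k).x‖ ^ 2 :=
    funext fun ω => sqError_eq hN _ x0 k ω
  rw [hfun]
  set q := params (lamMin Wt) γ τ with hq
  set y0 := x0 - consensus x0
  have hgeo : ∀ k, ∫ ω, runLyapunov W Wt q y0 k (fun i => J i ω) (fun t => Z t ω) ∂P
      ≤ (1 - q.β / 4) ^ k * ((1 + 12 * chi Wt) * ‖y0‖ ^ 2) := by
    intro k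
    induction k with
    | zero =>
      have h0 : ∀ ω, runLyapunov W Wt q y0 0 (fun i => J i ω) (fun t => Z t ω)
          = lyapunov Wt (lamMin Wt) y0 y0 := fun ω => rfl
      simp_rw [h0]
      rw [integral_const, probReal_univ, one_smul, pow_zero, one_mul]
      unfold lyapunov chi
      have h1 := mul_le_mul_of_nonneg_left (inner_act_le hN.mean_posSemidef.isHermitian y0)
        (by positivity : 0 ≤ 12 / lamMin Wt)
      have h2 : 12 / lamMin Wt * (lamMax Wt * ‖y0‖ ^ 2)
          = 12 * (lamMax Wt / lamMin Wt) * ‖y0‖ ^ 2 := by ring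
      linarith
    | succ k ih =>
      refine (hV k).trans ?_
      rw [pow_succ', mul_assoc]
      exact mul_le_mul_of_nonneg_left ih (by linarith)
  obtain ⟨C, hC⟩ := exists_norm_run_le q (by linarith) (ρ + ‖act Wt‖) y0 k
  obtain ⟨C', hC'⟩ := hN.exists_abs_runLyapunov_le q (by linarith) y0 k
  have hbd := (hJ.integral_eq_integral_integral hN.chain.measurable
    (fun j j' h => runLyapunov_congr (W := W) (Wt := Wt) q y0 (k := k) h)
    (fun j => hN.stronglyMeasurable_runLyapunov q y0 k j) (C := C') fun j ω => hC' j _).1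
  have hnorm := (hJ.integral_eq_integral_integral hN.chain.measurable (k := k)
    (Φ := fun j z => ‖(run q (fun t => W (z t)) j y0 k).x‖ ^ 2)
    (fun j j' h => by funext z; rw [run_congr q _ y0 h])
    (fun j => ((stronglyMeasurable_run (fun _ => (inferInstance : MeasurableSpace (ℕ → S)))
      monotone_const (w := fun t z => W (z t))
      (fun t a b => (hN.measurable a b).comp (measurable_pi_apply t)) q j y0 k).1.norm.pow 2))
    (C := C ^ 2) fun j ω => by
      rw [abs_of_nonneg (by positivity)]
      exact pow_le_pow_left₀ (norm_nonneg _) (hC _ (fun t => hN.norm_act_le _) j).1 2).1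
  refine ⟨hnorm.integrable, (integral_mono hnorm.integrable hbd.integrable fun ω => ?_).trans
    (hgeo k)⟩
  exact norm_sq_le_lyapunov hN.mean_posSemidef (lamMin_nonneg _) _ _

end Convergence

/-! ### The number of communication rounds -/

section Rounds

variable {Ω S : Type*} [MeasurableSpace Ω] [MeasurableSpace S] {P : Measure Ω}
  [IsProbabilityMeasure P] {Z : ℕ → Ω → S} {J : ℕ → Ω → ℕ}

/-- The length `2 ^ c * B` of an iteration at level `c`, truncated above level `m`. -/
noncomputable def truncatedRounds (m B c : ℕ) : ℝ :=
  if c ∈ Finset.Icc 1 m then (2 : ℝ) ^ c * B else B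

theorem truncatedRounds_nonneg (m B c : ℕ) : 0 ≤ truncatedRounds m B c := by
  unfold truncatedRounds; split_ifs <;> positivity

theorem truncatedRounds_le (m B c : ℕ) : truncatedRounds m B c ≤ 2 ^ m * B := by
  unfold truncatedRounds
  split_ifs with h
  · have := pow_le_pow_right₀ (by norm_num : (1 : ℝ) ≤ 2) (Finset.mem_Icc.1 h).2
    gcongr
  · exact le_mul_of_one_le_left (by positivity) (one_le_pow₀ (by norm_num))

/-- Level `c` has length `2ᶜ B` and probability `2⁻ᶜ`: each of the `m` levels contributes `B`. -/
theorem IsGeometricSeed.integral_truncatedRounds_le (hJ : IsGeometricSeed P Z J) (m B k : ℕ) :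
    Integrable (fun ω => truncatedRounds m B (J k ω)) P ∧
      ∫ ω, truncatedRounds m B (J k ω) ∂P ≤ B * (1 + m) := by
  have hdep : ∀ j j' : ℕ → ℕ, (∀ i < k + 1, j i = j' i) →
      truncatedRounds m B (j k) = truncatedRounds m B (j' k) := fun j j' h => by
    rw [h k (by omega)]
  have hb : ∀ j : ℕ → ℕ, |truncatedRounds m B (j k)| ≤ 2 ^ m * B := fun j => by
    rw [abs_of_nonneg (truncatedRounds_nonneg _ _ _)]; exact truncatedRounds_le _ _ _
  refine ⟨integrable_of_bounded (hJ.stronglyMeasurable_comp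
    (G := fun j => truncatedRounds m B (j k)) hdep) fun ω => hb fun i => J i ω, ?_⟩
  rw [hJ.integral_eq_integral_levelMean (G := fun j => truncatedRounds m B (j k)) (m := m) hdep hb
    fun j hj => by simp [truncatedRounds, hj]]
  simp only [Function.update_self]
  rw [integral_const, probReal_univ, one_smul]
  have h1 : levelMean m (fun c => truncatedRounds m B c)
      ≤ levelMean m (fun c => 0 + B * (2 : ℝ) ^ c) :=
    levelMean_le_levelMean fun c _ => by
      unfold truncatedRounds
      split_ifs
      · linarith
      · have : (B : ℝ) ≤ B * 2 ^ c := le_mul_of_one_le_right (by positivity)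
          (one_le_pow₀ (by norm_num))
        linarith
  refine h1.trans ?_
  rw [levelMean_add_mul]
  have := mul_le_mul_of_nonneg_left (levelMean_two_pow_le m) (by positivity : (0 : ℝ) ≤ B)
  linarith

theorem IsGeometricSeed.measureReal_level_not_mem (hJ : IsGeometricSeed P Z J) (m k : ℕ) :
    P.real {ω | J k ω ∉ Finset.Icc 1 m} = (1 / 2 : ℝ) ^ m := by
  have hs : MeasurableSet {ω | J k ω ∉ Finset.Icc 1 m} :=
    hJ.measurable k (MeasurableSet.of_discrete (s := {c | c ∉ Finset.Icc 1 m}))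
  have h1 : P.real {ω | J k ω ∉ Finset.Icc 1 m}
      = ∫ ω, (if J k ω ∈ Finset.Icc 1 m then (0 : ℝ) else 1) ∂P := by
    have : (fun ω => if J k ω ∈ Finset.Icc 1 m then (0 : ℝ) else 1)
        = {ω | J k ω ∉ Finset.Icc 1 m}.indicator fun _ => (1 : ℝ) := by
      funext ω
      by_cases h : J k ω ∈ Finset.Icc 1 m <;> simp only [Set.indicator, Set.mem_ofPred_eq, h] <;>
        simp
    rw [this, integral_indicator hs, setIntegral_const, smul_eq_mul, mul_one]
  rw [h1, hJ.integral_eq_integral_levelMean (m := m) (k := k) (C := 1)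
    (G := fun j => if j k ∈ Finset.Icc 1 m then (0 : ℝ) else 1)
    (fun j j' h => by rw [h k (by omega)]) (fun j => by split_ifs <;> simp)
    fun j hj => by simp [hj]]
  simp only [Function.update_self]
  rw [integral_const, probReal_univ, one_smul, levelMean_eq, Finset.sum_eq_zero fun a ha => by
    rw [if_pos ha, mul_zero]]
  simp

theorem neededComm_eq (q : Params) (hM : 2 ≤ q.M) (j : ℕ → ℕ) (N : ℕ) :
    (neededComm q j N : ℝ) = ∑ k ∈ Finset.range N, truncatedRounds (topLevel q.M) q.B (j k) := by
  unfold neededComm truncatedRounds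
  push_cast
  refine Finset.sum_congr rfl fun k _ => ?_
  -- at level `0` both sides are `B`
  rcases Nat.eq_zero_or_pos (j k) with h | h
  · simp [h]
  · simp [two_pow_le_iff_le_topLevel hM, Finset.mem_Icc, Nat.succ_le_iff, h]

theorem IsGeometricSeed.integral_neededComm_le (hJ : IsGeometricSeed P Z J) (q : Params)
    (hM : 2 ≤ q.M) (N : ℕ) :
    Integrable (fun ω => (neededComm q (fun i => J i ω) N : ℝ)) P ∧
      ∫ ω, (neededComm q (fun i => J i ω) N : ℝ) ∂P ≤ N * (q.B * (1 + topLevel q.M)) := by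
  simp_rw [neededComm_eq q hM]
  have h := fun k => hJ.integral_truncatedRounds_le (topLevel q.M) q.B k
  refine ⟨integrable_finsetSum _ fun k _ => (h k).1, ?_⟩
  rw [integral_finsetSum _ fun k _ => (h k).1]
  refine (Finset.sum_le_sum fun k _ => (h k).2).trans (le_of_eq ?_)
  rw [Finset.sum_const, Finset.card_range, nsmul_eq_mul]

/-- The number of elapsed rounds is not integrable; truncating all levels at `m` costs a
probability `N / 2 ^ m`, and Markov's inequality applies to the truncated sum. -/
theorem IsGeometricSeed.measureReal_rounds_le (hJ : IsGeometricSeed P Z J) (N m B : ℕ) {t : ℝ}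
    (ht : 0 < t) :
    P.real {ω | t < ((∑ k ∈ Finset.range N, 2 ^ J k ω * B : ℕ) : ℝ)}
      ≤ N * (1 / 2 : ℝ) ^ m + N * (B * (1 + m)) / t := by
  have hsub : {ω | t < ((∑ k ∈ Finset.range N, 2 ^ J k ω * B : ℕ) : ℝ)}
      ⊆ (⋃ k ∈ Finset.range N, {ω | J k ω ∉ Finset.Icc 1 m}) ∪
        {ω | t ≤ ∑ k ∈ Finset.range N, truncatedRounds m B (J k ω)} := by
    intro ω hω
    by_cases h : ∀ k ∈ Finset.range N, J k ω ∈ Finset.Icc 1 m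
    · right
      have : ((∑ k ∈ Finset.range N, 2 ^ J k ω * B : ℕ) : ℝ)
          = ∑ k ∈ Finset.range N, truncatedRounds m B (J k ω) := by
        push_cast
        exact Finset.sum_congr rfl fun k hk => by rw [truncatedRounds, if_pos (h k hk)]
      have hω' : t < ((∑ k ∈ Finset.range N, 2 ^ J k ω * B : ℕ) : ℝ) := hω
      rw [this] at hω'
      exact hω'.le
    · left
      push Not at h
      obtain ⟨k, hk, hk'⟩ := h
      exact Set.mem_biUnion hk hk'
  refine (measureReal_mono hsub).trans ((measureReal_union_le _ _).trans (add_le_add ?_ ?_))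
  · refine (measureReal_biUnion_finset_le _ _).trans (le_of_eq ?_)
    simp_rw [hJ.measureReal_level_not_mem]
    rw [Finset.sum_const, Finset.card_range, nsmul_eq_mul]
  · have h := fun k => hJ.integral_truncatedRounds_le m B k
    have hm := mul_meas_ge_le_integral_of_nonneg (μ := P)
      (f := fun ω => ∑ k ∈ Finset.range N, truncatedRounds m B (J k ω))
      (Filter.Eventually.of_forall fun ω => Finset.sum_nonneg fun k _ =>
        truncatedRounds_nonneg _ _ _) (integrable_finsetSum _ fun k _ => (h k).1) t
    rw [le_div_iff₀ ht, mul_comm]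
    refine hm.trans ?_
    rw [integral_finsetSum _ fun k _ => (h k).1]
    refine (Finset.sum_le_sum fun k _ => (h k).2).trans (le_of_eq ?_)
    rw [Finset.sum_const, Finset.card_range, nsmul_eq_mul]

end Rounds

/-! ### Complexity bounds -/

section Complexity

theorem one_le_kappa {n : ℕ} {A : Matrix (Fin n) (Fin n) ℝ} (ρ : ℝ) (hl : 0 < lamMin A)
    (hlL : lamMin A ≤ lamMax A) : 1 ≤ kappa A ρ := by
  have h1 : 1 ≤ chi A := (one_le_div hl).2 hlL
  have h2 : 1 ≤ Real.sqrt (chi A) := Real.one_le_sqrt.2 h1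
  have h3 : 0 ≤ ρ ^ 2 / lamMin A ^ 2 := by positivity
  unfold kappa
  linarith

theorem chi_le_kappa_sq {n : ℕ} {A : Matrix (Fin n) (Fin n) ℝ} (ρ : ℝ) (hl : 0 < lamMin A)
    (hlL : lamMin A ≤ lamMax A) : chi A ≤ kappa A ρ ^ 2 := by
  have h1 : 1 ≤ chi A := (one_le_div hl).2 hlL
  have h3 : 0 ≤ ρ ^ 2 / lamMin A ^ 2 := by positivity
  calc chi A = Real.sqrt (chi A) ^ 2 := (Real.sq_sqrt (by linarith)).symm
    _ ≤ kappa A ρ ^ 2 := pow_le_pow_left₀ (Real.sqrt_nonneg _) (le_add_of_nonneg_right h3) 2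

/-- A step size of the prescribed order makes `1/β` at most a constant times `κ`. -/
theorem inv_params_beta_le {n : ℕ} {A : Matrix (Fin n) (Fin n) ℝ} {ρ γ c : ℝ} (hc : 0 < c)
    (hl : 0 < lamMin A) (hlL : lamMin A ≤ lamMax A) (hγ : 0 < γ) (h : StepAtLeast A ρ c γ)
    (b : ℕ) : ((params (lamMin A) γ b).β)⁻¹ ≤ (1 + 12 / c) * kappa A ρ := by
  have hβ := params_beta_pos hl hγ b
  have hκ := one_le_kappa ρ hl hlL
  have hc12 : 0 < 12 / c := by positivity
  refine le_of_sq_le_sq ?_ (by positivity)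
  have h1 : (12 / c) * kappa A ρ ^ 2 ≤ ((1 + 12 / c) * kappa A ρ) ^ 2 := by
    rw [mul_pow]
    refine mul_le_mul_of_nonneg_right ?_ (by positivity)
    nlinarith
  refine le_trans ?_ h1
  rw [inv_pow, params_beta_sq hl hγ]
  rcases h with h | h
  · have h2 := chi_le_kappa_sq ρ hl hlL
    refine le_trans ?_ (mul_le_mul_of_nonneg_left h2 hc12.le)
    unfold chi
    rw [inv_div, div_mul_div_comm, div_le_div_iff₀ (by positivity) (by positivity)]
    have := mul_le_mul_of_nonneg_left h (by positivity : 0 ≤ 12 * lamMin A)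
    linarith
  · have h2 : ρ ^ 4 / lamMin A ^ 4 ≤ kappa A ρ ^ 2 := by
      have h3 : ρ ^ 2 / lamMin A ^ 2 ≤ kappa A ρ := le_add_of_nonneg_left (Real.sqrt_nonneg _)
      calc ρ ^ 4 / lamMin A ^ 4 = (ρ ^ 2 / lamMin A ^ 2) ^ 2 := by rw [div_pow]; ring
        _ ≤ _ := pow_le_pow_left₀ (by positivity) h3 2
    refine le_trans ?_ (mul_le_mul_of_nonneg_left h2 hc12.le)
    rw [inv_div, div_mul_div_comm, div_le_div_iff₀ (by positivity) (by positivity)]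
    have := mul_le_mul_of_nonneg_left h (by positivity : 0 ≤ 12 * lamMin A)
    calc 12 * (c * lamMin A ^ 4) = 12 * lamMin A * (c * lamMin A ^ 3) := by ring
      _ ≤ _ := this
      _ = _ := by ring

theorem one_le_log_two_add {x : ℝ} (hx : 1 ≤ x) : 1 ≤ Real.log (2 + x) := by
  rw [Real.le_log_iff_exp_le (by linarith)]
  linarith [Real.exp_one_lt_d9]

theorem half_le_logAccuracy {n : ℕ} (x0 : EuclideanSpace ℝ (Fin n)) {ε : ℝ} (hε : 0 < ε) :
    1 / 2 ≤ logAccuracy x0 ε := by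
  have h : 0 ≤ ‖x0 - consensus x0‖ ^ 2 / ε := by positivity
  have h1 : Real.log 2 ≤ logAccuracy x0 ε := Real.log_le_log (by norm_num) (by linarith)
  linarith [Real.log_two_gt_d9]

/-- After `N ≈ (4/β) log ((1 + 12 χ) (2 + D/ε))` iterations the error bound drops below `ε`. -/
theorem pow_mul_le_of_le {β a D ε : ℝ} (hβ : 0 < β) (hβ4 : β ≤ 4) (ha : 0 < a) (hD : 0 ≤ D)
    (hε : 0 < ε) {k : ℕ} (hk : 4 / β * Real.log (a * (2 + D / ε)) ≤ k) :
    (1 - β / 4) ^ k * (a * D) ≤ ε := by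
  have hD' : 0 ≤ D / ε := by positivity
  have hpos : 0 < a * (2 + D / ε) := by positivity
  have h1 : (1 - β / 4) ^ k ≤ (a * (2 + D / ε))⁻¹ := by
    calc (1 - β / 4) ^ k ≤ Real.exp (-(β / 4)) ^ k :=
          pow_le_pow_left₀ (by linarith) (by linarith [Real.add_one_le_exp (-(β / 4))]) k
      _ = Real.exp (-(β / 4 * k)) := by rw [← Real.exp_nat_mul]; ring_nf
      _ ≤ Real.exp (-Real.log (a * (2 + D / ε))) := by
          refine Real.exp_le_exp.2 (neg_le_neg ?_)
          have := mul_le_mul_of_nonneg_left hk (by positivity : 0 ≤ β / 4)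
          calc Real.log (a * (2 + D / ε)) = β / 4 * (4 / β * Real.log (a * (2 + D / ε))) := by
                field_simp
            _ ≤ _ := this
      _ = _ := by rw [Real.exp_neg, Real.exp_log hpos]
  calc (1 - β / 4) ^ k * (a * D) ≤ (a * (2 + D / ε))⁻¹ * (a * D) :=
        mul_le_mul_of_nonneg_right h1 (by positivity)
    _ = D / (2 + D / ε) := by field_simp
    _ ≤ ε := by
      rw [div_le_iff₀ (by positivity)]
      have : ε * (2 + D / ε) = 2 * ε + D := by field_simp
      linarith

theorem log_one_add_twelve_mul_le {χ κ : ℝ} (hχ : 0 ≤ χ) (hκ : 1 ≤ κ) (h : χ ≤ κ ^ 2) :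
    Real.log (1 + 12 * χ) ≤ 5 * Real.log (2 + κ) := by
  have h1 : 1 + 12 * χ ≤ (2 + κ) ^ 5 := by
    have h2 : (27 : ℝ) ≤ (2 + κ) ^ 3 := by
      have := pow_le_pow_left₀ (by norm_num) (by linarith : (3 : ℝ) ≤ 2 + κ) 3
      linarith
    have h3 : κ ^ 2 ≤ (2 + κ) ^ 2 := pow_le_pow_left₀ (by linarith) (by linarith) 2
    have h4 := mul_le_mul h2 h3 (by positivity) (by positivity)
    have h5 : 1 ≤ κ ^ 2 := one_le_pow₀ hκ
    calc 1 + 12 * χ ≤ 27 * κ ^ 2 := by linarith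
      _ ≤ _ := h4
      _ = _ := by ring
  calc Real.log (1 + 12 * χ) ≤ Real.log ((2 + κ) ^ 5) := Real.log_le_log (by linarith) h1
    _ = _ := by rw [Real.log_pow]; norm_num

theorem iteration_count_le {β A κ χ ℓ : ℝ} (hA : 1 ≤ A) (hβA : β⁻¹ ≤ A * κ)
    (hκ : 1 ≤ κ) (hχ : 0 ≤ χ) (hχκ : χ ≤ κ ^ 2) (hℓ : 1 / 2 ≤ ℓ) :
    4 / β * (Real.log (1 + 12 * χ) + ℓ) + 1 ≤ 46 * A * κ * Real.log (2 + κ) * ℓ := by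
  have hΛ := one_le_log_two_add hκ
  have h1 := log_one_add_twelve_mul_le hχ hκ hχκ
  set Λ := Real.log (2 + κ)
  have h2 : Real.log (1 + 12 * χ) + ℓ ≤ 11 * (Λ * ℓ) := by nlinarith
  have h0 : 0 ≤ Real.log (1 + 12 * χ) + ℓ := by
    have := Real.log_nonneg (by linarith : (1 : ℝ) ≤ 1 + 12 * χ)
    linarith
  have h3 : 4 / β * (Real.log (1 + 12 * χ) + ℓ) ≤ 4 * (A * κ) * (11 * (Λ * ℓ)) := by
    rw [div_eq_mul_inv]
    exact mul_le_mul (mul_le_mul_of_nonneg_left hβA (by norm_num)) h2 h0 (by positivity)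
  have h4 : 1 ≤ A * κ * (Λ * (2 * ℓ)) :=
    one_le_mul_of_one_le_of_one_le (one_le_mul_of_one_le_of_one_le hA hκ)
      (one_le_mul_of_one_le_of_one_le hΛ (by linarith))
  linarith

theorem logb_two_le {x : ℝ} (hx : 1 ≤ x) : Real.logb 2 x ≤ 2 * Real.log x := by
  have h2 := Real.log_two_gt_d9
  unfold Real.logb
  rw [div_le_iff₀ (by linarith)]
  have := Real.log_nonneg hx
  nlinarith

theorem params_M_le {l γ : ℝ} (hl : 0 < l) (hγ : 0 < γ) (b : ℕ) :
    (params l γ b).M ≤ 2 + ((params l γ b).β)⁻¹ := by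
  have hβ := params_beta_pos hl hγ b
  have hi : 0 < ((params l γ b).β)⁻¹ := inv_pos.2 hβ
  have h : (1 / 4) * (1 + 2 / (params l γ b).β) ≤ (2 + ((params l γ b).β)⁻¹) ^ 2 := by
    rw [div_eq_mul_inv 2]
    nlinarith
  exact max_le (by linarith) (Real.sqrt_le_iff.2 ⟨by positivity, h⟩)

theorem logb_params_M_le {l γ A κ : ℝ} (hl : 0 < l) (hγ : 0 < γ) (b : ℕ) (hA : 1 ≤ A)
    (hκ : 1 ≤ κ) (hβA : ((params l γ b).β)⁻¹ ≤ A * κ) :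
    Real.logb 2 (params l γ b).M ≤ 2 * (1 + A) * Real.log (2 + κ) := by
  have hM2 := two_le_params_M l γ b
  have hM := params_M_le hl hγ b
  have hΛ := one_le_log_two_add hκ
  have h1 : (params l γ b).M ≤ A * (2 + κ) := by linarith
  have h2 := logb_two_le (by linarith : 1 ≤ (params l γ b).M)
  have h3 : Real.log (params l γ b).M ≤ Real.log A + Real.log (2 + κ) := by
    rw [← Real.log_mul (by positivity) (by positivity)]
    exact Real.log_le_log (by linarith) h1
  have h4 : Real.log A ≤ A - 1 := Real.log_le_sub_one_of_pos (by linarith)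
  have h5 := le_mul_of_one_le_right (by linarith : 0 ≤ A) hΛ
  linarith

theorem params_B_le {l γ a Λ : ℝ} {b : ℕ} (hb : 0 < b)
    (hlog : Real.logb 2 (params l γ b).M ≤ a * Λ) (ha : 1 ≤ a * Λ) :
    ((params l γ b).B : ℝ) ≤ 2 * a * b * Λ := by
  have hb' : (1 : ℝ) ≤ b := by exact_mod_cast hb
  have hM2 := two_le_params_M l γ b
  have h0 : 0 ≤ Real.logb 2 (params l γ b).M :=
    Real.logb_nonneg (by norm_num) (by linarith)
  have h1 : ((params l γ b).B : ℝ) < b * Real.logb 2 (params l γ b).M + 1 :=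
    Nat.ceil_lt_add_one (by positivity)
  have h2 := mul_le_mul_of_nonneg_left hlog (by positivity : (0 : ℝ) ≤ b)
  have h3 := one_le_mul_of_one_le_of_one_le hb' ha
  linarith

/-- The truncation level `m = ⌈log₂ (2 N / δ)⌉` is logarithmic. -/
theorem log_truncation_le {A κ ℓ δ N : ℝ} (hA : 1 ≤ A) (hκ : 1 ≤ κ) (hℓ : 1 / 2 ≤ ℓ)
    (hδ : 0 < δ) (hδ1 : δ < 1) (hN : 1 ≤ N) (hNle : N ≤ 46 * A * κ * Real.log (2 + κ) * ℓ) :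
    1 + (⌈Real.logb 2 (2 * N / δ)⌉₊ : ℝ) ≤ (184 * A + 10) * Real.log (2 + κ + ℓ + δ⁻¹) := by
  have hδi : 1 < δ⁻¹ := (one_lt_inv₀ hδ).2 hδ1
  have hΛ := one_le_log_two_add hκ
  set H := Real.log (2 + κ + ℓ + δ⁻¹) with hH
  have hlog : ∀ y, 0 < y → y ≤ 2 + κ + ℓ + δ⁻¹ → Real.log y ≤ H := fun y h1 h2 =>
    Real.log_le_log h1 h2
  have hH1 : 1 ≤ H := hΛ.trans (hlog _ (by linarith) (by linarith))
  have hΛκ : Real.log (2 + κ) ≤ 2 + κ := Real.log_le_self (by linarith)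
  have h1 : 1 ≤ 2 * N / δ := by rw [le_div_iff₀ hδ]; linarith
  have h2 : 2 * N / δ ≤ 92 * A * κ * Real.log (2 + κ) * ℓ * δ⁻¹ := by
    rw [div_eq_mul_inv]
    refine mul_le_mul_of_nonneg_right ?_ (by positivity)
    linarith
  have h3 : Real.log (2 * N / δ) ≤ Real.log (92 * A) + Real.log κ
      + Real.log (Real.log (2 + κ)) + Real.log ℓ + Real.log δ⁻¹ := by
    have hΛ0 : Real.log (2 + κ) ≠ 0 := by linarith
    rw [← Real.log_mul (by positivity) (by positivity), ← Real.log_mul (by positivity) hΛ0,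
      ← Real.log_mul (by positivity) (by positivity),
      ← Real.log_mul (by positivity) (by positivity)]
    exact Real.log_le_log (by linarith) h2
  have h4 : Real.log (92 * A) ≤ 92 * A := Real.log_le_self (by positivity)
  have h5 := hlog κ (by linarith) (by linarith)
  have h6 := hlog (Real.log (2 + κ)) (by linarith) (by linarith)
  have h7 := hlog ℓ (by linarith) (by linarith)
  have h8 := hlog δ⁻¹ (by linarith) (by linarith)
  have h9 := logb_two_le h1
  have h10 : (⌈Real.logb 2 (2 * N / δ)⌉₊ : ℝ) < Real.logb 2 (2 * N / δ) + 1 :=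
    Nat.ceil_lt_add_one (Real.logb_nonneg (by norm_num) h1)
  have h11 := le_mul_of_one_le_right (by linarith : 0 ≤ 184 * A) hH1
  linarith

end Complexity

end MarkovConsensus

open MarkovConsensus in
theorem mainTheorem2 :
    ∃ q : ℕ, ∀ c : ℝ, 0 < c → ∃ C : ℝ, 0 < C ∧
      ∀ (n : ℕ) (_ : 2 ≤ n) (Ω : Type*) (S : Type*) (_ : MeasurableSpace Ω) (_ : MeasurableSpace S)
        (P : Measure Ω) (_ : IsProbabilityMeasure P)
        (Z : ℕ → Ω → S) (Q : Kernel S S) (_ : IsMarkovKernel Q) (π : Measure S)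
        (graph : S → SimpleGraph (Fin n)) (W : S → Matrix (Fin n) (Fin n) ℝ)
        (Wt : Matrix (Fin n) (Fin n) ℝ) (τ : ℕ) (ρ : ℝ)
        (_ : NetworkAssumptions P Z Q π graph W Wt τ ρ)
        (J : ℕ → Ω → ℕ) (_ : IsGeometricSeed P Z J)
        (γ : ℝ) (_ : AdmissibleStep Wt ρ τ τ γ) (_ : StepAtLeast Wt ρ c γ)
        (x0 : EuclideanSpace ℝ (Fin n)) (ε : ℝ) (_ : 0 < ε),
        ∃ N : ℕ,
          (∀ k, N ≤ k →
            Integrable (sqError Z W J (params (lamMin Wt) γ τ) x0 k) P ∧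
            ∫ ω, sqError Z W J (params (lamMin Wt) γ τ) x0 k ω ∂P ≤ ε) ∧
          (Integrable (fun ω => (neededComm (params (lamMin Wt) γ τ) (fun i => J i ω) N : ℝ)) P ∧
            ∫ ω, (neededComm (params (lamMin Wt) γ τ) (fun i => J i ω) N : ℝ) ∂P ≤
              C * τ * kappa Wt ρ * logAccuracy x0 ε * Real.log (2 + kappa Wt ρ) ^ q) ∧
          ∀ δ : ℝ, 0 < δ → δ < 1 →
            P.real {ω | C * τ * kappa Wt ρ * logAccuracy x0 ε * δ⁻¹ *
                Real.log (2 + kappa Wt ρ + logAccuracy x0 ε + δ⁻¹) ^ q <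
              ((trajectory Z W J (params (lamMin Wt) γ τ) x0 N ω).T : ℝ)} ≤ δ := by
  -- one logarithm comes from the number of iterations, one from `B`, one from the mean level
  refine ⟨3, fun c hc => ?_⟩
  -- `1/β ≤ A κ` and `log₂ M ≤ a log (2 + κ)`
  set A : ℝ := 1 + 12 / c with hA
  set a : ℝ := 2 * (1 + A) with ha
  have hA1 : 1 ≤ A := le_add_of_nonneg_right (by positivity)
  have ha1 : 1 ≤ a := by linarith
  refine ⟨184 * A * a ^ 2 + 184 * A * a * (184 * A + 10), by positivity, ?_⟩
  intro n hn Ω S _ _ P _ Z Q _ π graph W Wt τ ρ hN J hJ γ hγ hγc x0 ε hε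
  obtain ⟨Gt, -, hGt⟩ := hN.mean_gossip
  obtain ⟨hl, hlL⟩ := lamMin_pos_and_le hn hN.mean_posSemidef hGt
  have hγ0 := hγ.1
  have hβ := params_beta_pos hl hγ0 τ
  have hβ4 := params_beta_lt hl hlL hγ0 hγ.2.1 τ
  have hκ := one_le_kappa ρ hl hlL
  have hχκ := chi_le_kappa_sq ρ hl hlL
  have hχ : 0 ≤ chi Wt := div_nonneg (hl.le.trans hlL) hl.le
  have hℓ := half_le_logAccuracy x0 hε
  have hβA : ((params (lamMin Wt) γ τ).β)⁻¹ ≤ A * kappa Wt ρ :=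
    inv_params_beta_le hc hl hlL hγ0 hγc τ
  have hM2 := two_le_params_M (lamMin Wt) γ τ
  have hΛ := one_le_log_two_add hκ
  have hlogM : Real.logb 2 (params (lamMin Wt) γ τ).M ≤ a * Real.log (2 + kappa Wt ρ) :=
    logb_params_M_le hl hγ0 τ hA1 hκ hβA
  have haΛ := one_le_mul_of_one_le_of_one_le ha1 hΛ
  have hB := params_B_le hN.ergodic.1 hlogM haΛ
  have hm : 1 + (topLevel (params (lamMin Wt) γ τ).M : ℝ)
      ≤ 2 * a * Real.log (2 + kappa Wt ρ) := by
    linarith [topLevel_le_logb hM2]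
  have hcount := iteration_count_le hA1 hβA hκ hχ hχκ hℓ
  have herr := hN.integral_sqError_le hn hJ hγ x0
  have hcomm := hJ.integral_neededComm_le (params (lamMin Wt) γ τ) hM2
  have htail := fun N m (t : ℝ) (ht : 0 < t) =>
    hJ.measureReal_rounds_le N m (params (lamMin Wt) γ τ).B ht
  set q := params (lamMin Wt) γ τ with hq
  set κ := kappa Wt ρ with hκdef
  set ℓ := logAccuracy x0 ε with hℓdef
  set Λ := Real.log (2 + κ) with hΛdef
  have hτ : (1 : ℝ) ≤ τ := by exact_mod_cast hN.ergodic.1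
  have hD : 0 ≤ ‖x0 - consensus x0‖ ^ 2 / ε := by positivity
  have hsplit : Real.log ((1 + 12 * chi Wt) * (2 + ‖x0 - consensus x0‖ ^ 2 / ε))
      = Real.log (1 + 12 * chi Wt) + ℓ := Real.log_mul (by positivity) (by positivity)
  have hlog0 := Real.log_nonneg (by linarith : (1 : ℝ) ≤ 1 + 12 * chi Wt)
  have hpos : 0 < 4 / q.β * (Real.log (1 + 12 * chi Wt) + ℓ) := by
    have : 0 < Real.log (1 + 12 * chi Wt) + ℓ := by linarith
    positivity
  set N := ⌈4 / q.β * (Real.log (1 + 12 * chi Wt) + ℓ)⌉₊ with hNdef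
  have hN1 : (1 : ℝ) ≤ N := by exact_mod_cast Nat.ceil_pos.2 hpos
  have hNle : (N : ℝ) ≤ 46 * A * κ * Λ * ℓ := (Nat.ceil_lt_add_one hpos.le).le.trans hcount
  refine ⟨N, fun k hk => ⟨(herr k).1, (herr k).2.trans ?_⟩, ⟨(hcomm N).1, ?_⟩, ?_⟩
  · refine pow_mul_le_of_le hβ (by linarith) (by positivity) (by positivity) hε ?_
    rw [hsplit]
    exact (Nat.le_ceil _).trans (by exact_mod_cast hk)
  · refine (hcomm N).2.trans ?_
    calc (N : ℝ) * (q.B * (1 + topLevel q.M))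
        ≤ (46 * A * κ * Λ * ℓ) * ((2 * a * τ * Λ) * (2 * a * Λ)) := by gcongr
      _ = 184 * A * a ^ 2 * (τ * κ * ℓ * Λ ^ 3) := by ring
      _ ≤ (184 * A * a ^ 2 + 184 * A * a * (184 * A + 10)) * (τ * κ * ℓ * Λ ^ 3) := by
          refine mul_le_mul_of_nonneg_right (le_add_of_nonneg_right ?_) ?_ <;> positivity
      _ = _ := by ring
  · intro δ hδ hδ1
    -- half of `δ` pays for the truncation at level `m`, half for Markov's inequality
    have hT : ∀ ω, (trajectory Z W J q x0 N ω).T = ∑ k ∈ Finset.range N, 2 ^ J k ω * q.B :=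
      fun ω => run_T q _ _ x0 N
    simp_rw [hT]
    have hδi : 1 < δ⁻¹ := (one_lt_inv₀ hδ).2 hδ1
    have hmδ := log_truncation_le hA1 hκ hℓ hδ hδ1 hN1 hNle
    set m := ⌈Real.logb 2 (2 * N / δ)⌉₊ with hmdef
    set H := Real.log (2 + κ + ℓ + δ⁻¹) with hHdef
    have hΛH : Λ ≤ H := Real.log_le_log (by linarith) (by linarith)
    have hH1 : 1 ≤ H := hΛ.trans hΛH
    set t := (184 * A * a ^ 2 + 184 * A * a * (184 * A + 10)) * τ * κ * ℓ * δ⁻¹ * H ^ 3 with ht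
    have ht0 : 0 < t := by
      have : 0 < ℓ := by linarith
      positivity
    have hpow : (N : ℝ) * (1 / 2 : ℝ) ^ m ≤ δ / 2 := by
      have h1 : 2 * N / δ ≤ (2 : ℝ) ^ m := by
        have h2 := (Real.logb_le_iff_le_rpow (by norm_num) (by positivity)).1
          (Nat.le_ceil (Real.logb 2 (2 * N / δ)))
        rwa [Real.rpow_natCast] at h2
      rw [div_le_iff₀ hδ] at h1
      rw [one_div, inv_pow, ← div_eq_mul_inv, div_le_iff₀ (by positivity)]
      linarith
    have hmain : (N : ℝ) * (q.B * (1 + m)) ≤ δ / 2 * t := by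
      calc (N : ℝ) * (q.B * (1 + m))
          ≤ (46 * A * κ * Λ * ℓ) * ((2 * a * τ * Λ) * ((184 * A + 10) * H)) := by gcongr
        _ ≤ (46 * A * κ * H * ℓ) * ((2 * a * τ * H) * ((184 * A + 10) * H)) := by gcongr
        _ = 184 * A * a * (184 * A + 10) * (τ * κ * ℓ * H ^ 3 / 2) := by ring
        _ ≤ (184 * A * a ^ 2 + 184 * A * a * (184 * A + 10)) * (τ * κ * ℓ * H ^ 3 / 2) := by
            refine mul_le_mul_of_nonneg_right (le_add_of_nonneg_left ?_) ?_ <;> positivity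
        _ = δ / 2 * t := by rw [ht]; field_simp
    refine (htail N m t ht0).trans ?_
    have h3 : (N : ℝ) * (q.B * (1 + m)) / t ≤ δ / 2 := (div_le_iff₀ ht0).2 hmain
    linarith
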